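/- Let $n\ge 1$ and $-1=a_0\le a_1<a_2\le a_3<a_4\le\dots<a_{2n}\le a_{2n+1}=1$. Put $c_j=[a_{2j-1},a_{2j}]$ ($j=1,\dots,n$, the gaps), $\gamma_j=[a_{2j-2},a_{2j-1}]$ ($j=1,\dots,n+1$, the bands, which may collapse to points) and $\Gamma=\bigcup_{j=1}^n c_j\subset[-1,1]$. Let $R_0(z)=\sqrt{z^2-1}\sim z$ (cut $[-1,1]$) and $R(z)=\bigl(\prod_{j=1}^{2n}(z-a_j)\bigr)^{1/2}\sim z^n$ (cut $\Gamma$) as $z\to\infty$; on the cuts the boundary values from the upper half-plane are used. Let $\mathcal R_n$ be the superband surface, i.e. the smooth compact model of $y^2=\prod_{j=0}^{2n+1}(z-a_j)$, with $y=R R_0$; its branch points are the points that occur an odd number of times among $a_0,\dots,a_{2n+1}$. Let $K(z,w)=\ln\left|\frac{R_0(z)R_0(w)+wz-1}{z-w}\right|$. The density of states (DOS) $u$ and the density of fluxes (DOF) $v$ of the defNLS soliton condensate ($\sigma\equiv0$) with spectral support $\Gamma$ are the solutions of $$\int_\Gamma K(z,w)u(w)\,dw=|R_0(z)|,\qquad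 \int_\Gamma K(z,w)v(w)\,dw=2z|R_0(z)|,\qquad z\in\Gamma,$$ in the class of real integrable densities on $\Gamma$ of finite energy (that is, $K(z,w)u(z)u(w)$ is integrable on $\Gamma\times\Gamma$, and likewise for $v$), for which these integrals converge absolutely. Then $u$ and $v$ exist, are unique up to equality almost everywhere on $\Gamma$, and are given by $$u=\frac{P}{R\,R_0},\qquad v=\frac{Q}{R\,R_0},$$ where $P$ and $Q$ are polynomials of degree $n+1$ and $n+2$, respectively, such that: (i) $u$ and $v$ satisfy, in the interior of $\Gamma$, the differentiated relations $\pi H[u|R_0|](z)=-z$ and $\pi H[v|R_0|](z)=2-4z^2$, where $H[f](z)=\frac1\pi\,\mathrm{p.v.}\!\int_\Gamma\frac{f(w)}{w-z}\,dw$ is the finite Hilbert transform on $\Gamma$; (ii) $\int_{\gamma_j}u\,dz=\int_{\gamma_j}v\,dz=0$ for $j=1,\dots,n+1$; (iii) $u\,dz=\frac{P(z)}{y}\,dz$ and $v\,dz=\frac{Q(z)}{y}\,dz$ are meromorphic differentials of the second kind (all residues vanish) on $\mathcal R_n$. The polynomials $P$ and $Q$ are uniquely determined by their degrees, (i), (iii)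 and the conditions (ii) for $j=1,\dots,n$ only. Moreover, $u$ and $v$ are real and $u>0$ on $\Gamma$: this holds at every point of $\Gamma\setminus\{a_0,\dots,a_{2n+1}\}$; at the points of $\Gamma\cap\{a_0,\dots,a_{2n+1}\}$ that are not branch points of $\mathcal R_n$ (the points $\pm1$ if they lie in $\Gamma$, and collapsed bands) it holds for the limits of $u$ and $v$ along $\Gamma\setminus\{a_0,\dots,a_{2n+1}\}$, which exist; and $u\to+\infty$ along $\Gamma\setminus\{a_0,\dots,a_{2n+1}\}$ at the branch points in $\Gamma$. -/

import Mathlib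

open MeasureTheory Filter Topology Set Polynomial

noncomputable section

namespace DefNLS

/-- Endpoints `-1 = a 0 ≤ a 1 < a 2 ≤ a 3 < a 4 ≤ ⋯ < a (2n) ≤ a (2n+1) = 1`: the `n` gaps
`[a (2j+1), a (2j+2)]` are genuine intervals, the `n + 1` bands `[a (2j), a (2j+1)]` may collapse
to a point (in particular `a 1 = -1` and `a (2n) = 1` are allowed). -/
structure IsEndpoints (n : ℕ) (a : ℕ → ℝ) : Prop where
  left : a 0 = -1
  right : a (2 * n + 1) = 1
  gap : ∀ j < n, a (2 * j + 1) < a (2 * j + 2)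
  band : ∀ j < n + 1, a (2 * j) ≤ a (2 * j + 1)

/-- The spectral support `Γ`, the union of the `n` gaps. -/
def support (n : ℕ) (a : ℕ → ℝ) : Set ℝ :=
  ⋃ j ∈ Finset.range n, Icc (a (2 * j + 1)) (a (2 * j + 2))

/-- The set of all endpoints `a 0, …, a (2n+1)`. -/
def endpoints (n : ℕ) (a : ℕ → ℝ) : Set ℝ :=
  {x | ∃ j ∈ Finset.range (2 * n + 2), a j = x}

/-- The branch points of the superband surface: the points which occur an odd number of times
among `a 0, …, a (2n+1)`. -/
def branchPoints (n : ℕ) (a : ℕ → ℝ) : Set ℝ :=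
  {x | Odd ((Finset.range (2 * n + 2)).filter (fun j => a j = x)).card}

/-- The principal square root. -/
def csqrt (z : ℂ) : ℂ := z ^ (1 / 2 : ℂ)

/-- `R₀(z) = √(z² - 1)`, holomorphic off `[-1, 1]` with `R₀(z) ∼ z` at infinity; on the cut it takes
the boundary value from the upper half plane, `R₀(x) = i √(1 - x²)`. -/
def R₀ (z : ℂ) : ℂ := csqrt (z - 1) * csqrt (z + 1)

/-- `R(z) = (∏_{j=1}^{2n} (z - a j))^{1/2}`, holomorphic off `Γ` with `R(z) ∼ zⁿ` at infinity; on
the cut `Γ` it takes the boundary value from the upper half plane. -/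
def R (n : ℕ) (a : ℕ → ℝ) (z : ℂ) : ℂ :=
  ∏ j ∈ Finset.range (2 * n), csqrt (z - a (j + 1))

/-- The function `P / (R R₀)` on the real line. -/
def density (n : ℕ) (a : ℕ → ℝ) (P : ℂ[X]) (x : ℝ) : ℂ :=
  P.eval (x : ℂ) / (R n a x * R₀ x)

/-- The kernel `ln |(R₀(z) R₀(w) + w z - 1) / (z - w)|` of the nonlinear dispersion relations. -/
def kernel (z w : ℝ) : ℝ :=
  Real.log ‖(R₀ z * R₀ w + (w : ℂ) * z - 1) / ((z : ℂ) - w)‖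

/-- `u` is an integrable density of finite energy on `Γ` which solves
`∫_Γ ln |(R₀(z) R₀(w) + w z - 1) / (z - w)| u(w) dw + σ(z) u(z) = g(z)` for all `z ∈ Γ`. -/
structure SolvesNDR (Γ : Set ℝ) (σ g u : ℝ → ℝ) : Prop where
  integrable : IntegrableOn u Γ
  energy : Integrable (fun p : ℝ × ℝ => kernel p.1 p.2 * u p.1 * u p.2)
    ((volume.restrict Γ).prod (volume.restrict Γ))
  integrable_kernel : ∀ z ∈ Γ, IntegrableOn (fun w => kernel z w * u w) Γ
  eqn : ∀ z ∈ Γ, (∫ w in Γ, kernel z w * u w) + σ z * u z = g z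

/-- The density of states of the soliton gas with spectral support `Γ` and spectral scaling
function `σ`: a solution of the first nonlinear dispersion relation. -/
def IsDOS (Γ : Set ℝ) (σ u : ℝ → ℝ) : Prop :=
  SolvesNDR Γ σ (fun z => ‖R₀ z‖) u

/-- The density of fluxes: a solution of the second nonlinear dispersion relation. -/
def IsDOF (Γ : Set ℝ) (σ v : ℝ → ℝ) : Prop :=
  SolvesNDR Γ σ (fun z => 2 * z * ‖R₀ z‖) v

/-- The finite Hilbert transform of `f` on `Γ` exists at `z` and has the value `L`:
`H[f](z) = (1/π) p.v. ∫_Γ f(w) / (w - z) dw`. -/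
def HasFHT (Γ : Set ℝ) (f : ℝ → ℂ) (z : ℝ) (L : ℂ) : Prop :=
  IntegrableOn f Γ ∧
  Tendsto (fun ε : ℝ => (1 / (Real.pi : ℂ)) *
    ∫ w in Γ ∩ {w : ℝ | ε < |w - z|}, f w / ((w : ℂ) - z)) (𝓝[>] 0) (𝓝 L)

/-- The differentiated dispersion relation `π H[u |R₀|](z) = g(z)` in the interior of `Γ`. -/
def SolvesFHT (Γ : Set ℝ) (u : ℝ → ℂ) (g : ℝ → ℝ) : Prop :=
  ∀ z ∈ interior Γ, ∃ L : ℂ, HasFHT Γ (fun w => u w * ‖R₀ w‖) z L ∧ Real.pi * L = g z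

/-- The integral of `u` over the first `m` bands `γ₁, …, γₘ` vanishes. -/
def BandVanishing (a : ℕ → ℝ) (m : ℕ) (u : ℝ → ℂ) : Prop :=
  ∀ j < m, IntervalIntegrable u volume (a (2 * j)) (a (2 * j + 1)) ∧
    ∫ x in (a (2 * j))..(a (2 * j + 1)), u x = 0

/-- `t ↦ (Z t, Y t)` parametrizes, near `t = 0`, a neighbourhood of a point of the superband
surface, i.e. of the smooth compact model of the curve `y² = ∏_{j=0}^{2n+1} (z - a j)`. The point may
be finite, a branch point, or one of the two points at infinity (then `Z` has a pole at `0`). -/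
structure IsLocalChart (n : ℕ) (a : ℕ → ℝ) (Z Y : ℂ → ℂ) : Prop where
  meromorphic_z : MeromorphicAt Z 0
  meromorphic_y : MeromorphicAt Y 0
  curve : ∀ᶠ t in 𝓝[≠] (0 : ℂ), Y t ^ 2 = ∏ j ∈ Finset.range (2 * n + 2), (Z t - a j)
  inj : ∃ U ∈ 𝓝[≠] (0 : ℂ), InjOn (fun t => (Z t, Y t)) U

/-- `h(z, y) dz` is a meromorphic differential of the second kind on the superband surface: in each
chart it is meromorphic, and its residue vanishes. -/
def IsSecondKind (n : ℕ) (a : ℕ → ℝ) (h : ℂ → ℂ → ℂ) : Prop :=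
  ∀ Z Y : ℂ → ℂ, IsLocalChart n a Z Y →
    MeromorphicAt (fun t => h (Z t) (Y t) * deriv Z t) 0 ∧
    ∀ᶠ r in 𝓝[>] (0 : ℝ),
      (2 * Real.pi * Complex.I : ℂ)⁻¹ * (∮ t in C(0, r), h (Z t) (Y t) * deriv Z t) = 0

/-- `P` is a polynomial of degree `d`, the function `P / (R R₀)` solves `π H[· |R₀|] = g` on `Γ` and
has vanishing integrals over the first `m` bands, and `P / (R R₀) dz` (with `y = R R₀`) is a
differential of the second kind on the superband surface. -/
structure IsCondensatePolynomial (n : ℕ) (a : ℕ → ℝ) (d : ℕ) (g : ℝ → ℝ) (m : ℕ)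
    (P : ℂ[X]) : Prop where
  degree : P.degree = d
  fht : SolvesFHT (support n a) (density n a P) g
  bands : BandVanishing a m (density n a P)
  secondKind : IsSecondKind n a (fun z y => P.eval z / y)

end DefNLS

end

noncomputable section

namespace DefNLS

open scoped ComplexConjugate

/-! ### The principal square root -/

/-! The Joukowski map z = (ζ + 1/ζ)/2 carries the punctured unit disc to the complement of [-1,1]. A
collapsed band contributes a perfect square to the radicand, so once `collapsePoly` is divided out a
density becomes U = P/∏(x-b)^{1/2}, where b runs over the 2m ends of the m bands of positive length.
U is real on Γ and imaginary on the open bands, so integrals over Γ may be read as integrals of Re U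
over (-1,1).

In the disc, the function P R₀/∏(z-b)^{1/2} equals αz² + βz + γ + h(ζ) with h holomorphic, h(0) = 0
and real Taylor coefficients. Such an h is recovered from Im h on the upper half circle, which is
-√(1-x²) Re U, by a sine kernel (`cauchy_sineKernel`). The θ-primitive of the real part of that
kernel is the Abel sum of Σ (2/k) sin kθ sin kφ = K(cos θ, cos φ). Letting r → 1 gives
`HasExpansion.integral_kernel`: ∫ K(cos θ, w) Re U(w) dw = π(∫_0^θ (α cos² + β cos + γ) + ∫_{cos
θ}^1 Im U). At θ = π the kernel vanishes, so the band integrals sum to -π(γ + α/2). If they all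
vanish, then γ = -α/2 and the potential on Γ is π(αz/2 + β)√(1-z²). The choice (α, β) = (0, 1/π)
gives the DOS and (4/π, 0) the DOF. The radial limit of Re h gives the Hilbert transform -(αx² + βx
+ γ) on the interior of Γ (`HasExpansion.tendsto_hilbert`).

Existence of P is linear algebra (`bandMap_surjective`): a vanishing band integral forces a root in
that band, so a polynomial of degree below m with m vanishing band integrals is zero. Uniqueness of
the densities is strict positivity of the energy, which is Σ (2/k) s_k² in the sine coefficients
(`ae_eq_zero_of_potential_eq_zero`).

Second kind: at finite points of the curve P/∏(z-b)^{1/2} dz is holomorphic. At infinity, γ = -α/2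
says precisely that U = ±(αz + β) + O(z^{-2}), an exact differential plus a holomorphic one.
Conversely, absence of residues over collapsed bands forces `collapsePoly` to divide the numerator.
For the difference of two candidates the Hilbert transform then kills α, β and γ, and the sum rule
supplies the missing last band condition.

Positivity: for α = 0, P is β times a product of X - r_k with one root r_k inside each open band,
and each factor has the sign of the corresponding pair of square roots on Γ. -/

lemma csqrt_mul_self (z : ℂ) : csqrt z * csqrt z = z := by
  have h := Complex.cpow_nat_inv_pow z (n := 2) two_ne_zero
  rw [sq] at h
  simpa [csqrt] using h

lemma csqrt_sq (z : ℂ) : csqrt z ^ 2 = z := by rw [sq, csqrt_mul_self]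

lemma csqrt_eq_zero {z : ℂ} : csqrt z = 0 ↔ z = 0 := by
  rw [← pow_eq_zero_iff (two_ne_zero), csqrt_sq]

lemma norm_csqrt (z : ℂ) : ‖csqrt z‖ = √‖z‖ := by
  rw [eq_comm, Real.sqrt_eq_iff_mul_self_eq (norm_nonneg _) (norm_nonneg _), ← norm_mul,
    csqrt_mul_self]

lemma csqrt_re_nonneg (z : ℂ) : 0 ≤ (csqrt z).re := by
  by_cases hz : z = 0
  · subst hz; simp [csqrt]
  · rw [csqrt, Complex.cpow_def_of_ne_zero hz, Complex.exp_re]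
    refine mul_nonneg (Real.exp_pos _).le (Real.cos_nonneg_of_mem_Icc ?_)
    have h1 := Complex.neg_pi_lt_arg z
    have h2 := Complex.arg_le_pi z
    have : (Complex.log z * (1 / 2)).im = z.arg / 2 := by
      rw [show (1 / 2 : ℂ) = ((1 / 2 : ℝ) : ℂ) by norm_num, Complex.im_mul_ofReal, Complex.log_im]
      ring
    rw [this]
    constructor <;> linarith

/-- Re(w²) = (Re w)² - (Im w)². The root lies in the sector |arg| ≤ π/4, so a product of two such
roots stays in the right half plane; `discRoot_exp` determines its sign from this. -/
lemma abs_csqrt_im_le {z : ℂ} (hz : 0 ≤ z.re) : |(csqrt z).im| ≤ (csqrt z).re := by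
  rw [← abs_of_nonneg (csqrt_re_nonneg z), ← sq_le_sq]
  have h := congrArg Complex.re (csqrt_mul_self z)
  rw [Complex.mul_re] at h
  nlinarith

lemma csqrt_conj {z : ℂ} (hz : 0 ≤ z.re) : csqrt (conj z) = conj (csqrt z) := by
  have : z.arg ≠ Real.pi := by
    intro h
    rw [Complex.arg_eq_pi_iff] at h
    linarith [h.1]
  rw [csqrt, csqrt, Complex.conj_cpow _ _ this]
  congr 1
  rw [show (1 / 2 : ℂ) = ((1 / 2 : ℝ) : ℂ) by norm_num, Complex.conj_ofReal]

lemma csqrt_ofReal_of_nonneg {x : ℝ} (hx : 0 ≤ x) : csqrt x = (√x : ℝ) := by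
  rw [csqrt, Real.sqrt_eq_rpow, Complex.ofReal_cpow hx]
  norm_num

lemma csqrt_ofReal_of_nonpos {x : ℝ} (hx : x ≤ 0) : csqrt x = Complex.I * (√(-x) : ℝ) := by
  rcases hx.eq_or_lt with rfl | hx
  · simp [csqrt]
  have h := Complex.ofReal_cpow_of_nonpos hx.le (1 / 2)
  rw [csqrt, h, mul_comm, Real.sqrt_eq_rpow, Complex.ofReal_cpow (by linarith)]
  congr 1
  · rw [show (Real.pi : ℂ) * Complex.I * (1 / 2) = Real.pi / 2 * Complex.I by ring,
      Complex.exp_pi_div_two_mul_I]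
  · norm_num

lemma mem_slitPlane_of_re_nonneg {z : ℂ} (hz : 0 ≤ z.re) (h0 : z ≠ 0) : z ∈ Complex.slitPlane := by
  rw [Complex.mem_slitPlane_iff]
  by_contra! h
  exact h0 (Complex.ext (le_antisymm h.1 hz) h.2)

lemma differentiableAt_csqrt {z : ℂ} (hz : z ∈ Complex.slitPlane) :
    DifferentiableAt ℂ csqrt z := by
  unfold csqrt
  exact DifferentiableAt.cpow_const differentiableAt_id hz

lemma continuousAt_csqrt {z : ℂ} (hz : 0 ≤ z.re) : ContinuousAt csqrt z := by
  by_cases h0 : z = 0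
  · subst h0
    rw [ContinuousAt, csqrt_eq_zero.2 rfl, tendsto_zero_iff_norm_tendsto_zero]
    simp_rw [norm_csqrt]
    have : Continuous fun z : ℂ => √‖z‖ := by fun_prop
    simpa using this.tendsto 0
  · exact (differentiableAt_csqrt (mem_slitPlane_of_re_nonneg hz h0)).continuousAt

lemma measurable_csqrt : Measurable csqrt := by
  unfold csqrt
  fun_prop

lemma R₀_ofReal {x : ℝ} (hx : x ∈ Icc (-1 : ℝ) 1) : R₀ x = Complex.I * (√(1 - x ^ 2) : ℝ) := by
  have h1 := csqrt_ofReal_of_nonpos (x := x - 1) (by linarith [hx.2])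
  have h2 := csqrt_ofReal_of_nonneg (x := x + 1) (by linarith [hx.1])
  push_cast at h1 h2
  rw [R₀, h1, h2, mul_assoc, ← Complex.ofReal_mul, ← Real.sqrt_mul (by linarith [hx.2])]
  ring_nf

lemma norm_R₀ {x : ℝ} (hx : x ∈ Icc (-1 : ℝ) 1) : ‖R₀ x‖ = √(1 - x ^ 2) := by
  rw [R₀_ofReal hx]
  simp [abs_of_nonneg]

/-! ### The root with respect to a finite set of branch points -/

/-- `∏_{b ∈ B} (x - b)^{1/2}` on the real line. -/
def rootProd (B : Finset ℝ) (x : ℝ) : ℂ := ∏ b ∈ B, csqrt ((x : ℂ) - b)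

lemma rootProd_ne_zero {B : Finset ℝ} {x : ℝ} (hx : x ∉ B) : rootProd B x ≠ 0 := by
  rw [rootProd, Finset.prod_ne_zero_iff]
  intro b hb h
  rw [csqrt_eq_zero, ← Complex.ofReal_sub, Complex.ofReal_eq_zero, sub_eq_zero] at h
  exact hx (h ▸ hb)

lemma norm_rootProd (B : Finset ℝ) (x : ℝ) : ‖rootProd B x‖ = ∏ b ∈ B, √|x - b| := by
  rw [rootProd, norm_prod]
  refine Finset.prod_congr rfl fun b _ => ?_
  rw [norm_csqrt, ← Complex.ofReal_sub, Complex.norm_real, Real.norm_eq_abs]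

lemma measurable_rootProd (B : Finset ℝ) : Measurable (rootProd B) := by
  unfold rootProd
  refine Finset.measurable_fun_prod _ fun b _ => measurable_csqrt.comp ?_
  fun_prop

lemma differentiableAt_csqrt_ofReal {x : ℝ} (hx : x ≠ 0) :
    DifferentiableAt ℝ (fun t : ℝ => csqrt t) x := by
  rcases hx.lt_or_gt with h | h
  · have : (fun t : ℝ => csqrt t) =ᶠ[𝓝 x] fun t => Complex.I * (√(-t) : ℝ) := by
      filter_upwards [Iio_mem_nhds h] with t ht using csqrt_ofReal_of_nonpos (le_of_lt ht)
    refine DifferentiableAt.congr_of_eventuallyEq ?_ this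
    exact (((differentiableAt_id.neg).sqrt
      (by simpa using h.ne)).hasDerivAt.ofReal_comp.differentiableAt).const_mul _
  · have : (fun t : ℝ => csqrt t) =ᶠ[𝓝 x] fun t => (√t : ℝ) := by
      filter_upwards [Ioi_mem_nhds h] with t ht using csqrt_ofReal_of_nonneg (le_of_lt ht)
    refine DifferentiableAt.congr_of_eventuallyEq ?_ this
    exact (differentiableAt_id.sqrt (by simpa using h.ne')).hasDerivAt.ofReal_comp.differentiableAt

lemma differentiableAt_rootProd {B : Finset ℝ} {x : ℝ} (hx : x ∉ B) :
    DifferentiableAt ℝ (rootProd B) x := by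
  unfold rootProd
  refine DifferentiableAt.fun_finsetProd fun b hb => ?_
  have h := differentiableAt_csqrt_ofReal (x := x - b)
    (sub_ne_zero.2 fun h => hx (h ▸ hb))
  have := h.comp x ((differentiableAt_id).sub_const b)
  simpa [Function.comp_def] using this

/-! ### The kernel and weakly singular weights on `[-1, 1]` -/

lemma kernel_eq {z w : ℝ} (hz : z ∈ Icc (-1 : ℝ) 1) (hw : w ∈ Icc (-1 : ℝ) 1) :
    kernel z w = Real.log ((1 - z * w + √(1 - z ^ 2) * √(1 - w ^ 2)) / |z - w|) := by
  have h1 : (1 - z * w + √(1 - z ^ 2) * √(1 - w ^ 2)) ≥ 0 := by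
    have : 0 ≤ √(1 - z ^ 2) * √(1 - w ^ 2) := by positivity
    nlinarith [hz.1, hz.2, hw.1, hw.2]
  rw [kernel, R₀_ofReal hz, R₀_ofReal hw, norm_div]
  congr 2
  · rw [show Complex.I * (√(1 - z ^ 2) : ℝ) * (Complex.I * (√(1 - w ^ 2) : ℝ)) + (w : ℂ) * z - 1
      = ((-(1 - z * w + √(1 - z ^ 2) * √(1 - w ^ 2)) : ℝ) : ℂ) by
        push_cast; linear_combination (√(1 - z ^ 2) : ℂ) * (√(1 - w ^ 2) : ℂ) * Complex.I_sq,
      Complex.norm_real, norm_neg, Real.norm_of_nonneg h1]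
  · rw [← Complex.ofReal_sub, Complex.norm_real, Real.norm_eq_abs]

lemma kernel_symm (z w : ℝ) : kernel z w = kernel w z := by
  rw [kernel, kernel, norm_div, norm_div, norm_sub_rev (z : ℂ), mul_comm (R₀ z), mul_comm (z : ℂ)]

lemma abs_sub_le_kernel_num {z w : ℝ} (hz : z ∈ Icc (-1 : ℝ) 1) (hw : w ∈ Icc (-1 : ℝ) 1) :
    |z - w| ≤ 1 - z * w + √(1 - z ^ 2) * √(1 - w ^ 2) := by
  have : 0 ≤ √(1 - z ^ 2) * √(1 - w ^ 2) := by positivity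
  rw [abs_le]
  constructor <;> nlinarith [hz.1, hz.2, hw.1, hw.2]

lemma kernel_nonneg {z w : ℝ} (hz : z ∈ Icc (-1 : ℝ) 1) (hw : w ∈ Icc (-1 : ℝ) 1) :
    0 ≤ kernel z w := by
  rw [kernel_eq hz hw]
  rcases eq_or_ne z w with rfl | h
  · simp
  · refine Real.log_nonneg ?_
    rw [one_le_div (abs_pos.2 (sub_ne_zero.2 h))]
    exact abs_sub_le_kernel_num hz hw

/-- The numerator is at most 3 and log x ≤ 4 x^{1/4}. The exponent 1/4 leaves room for an inverse
square root: the total singularity 3/4 is still integrable. -/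
lemma kernel_le {z w : ℝ} (hz : z ∈ Icc (-1 : ℝ) 1) (hw : w ∈ Icc (-1 : ℝ) 1) :
    kernel z w ≤ 12 * |w - z| ^ (-(1 / 4) : ℝ) := by
  rw [kernel_eq hz hw]
  rcases eq_or_ne z w with rfl | h
  · simp
  have hd : 0 < |w - z| := abs_pos.2 (sub_ne_zero.2 h.symm)
  rw [abs_sub_comm]
  have hnum : 1 - z * w + √(1 - z ^ 2) * √(1 - w ^ 2) ≤ 3 := by
    have h1 : √(1 - z ^ 2) ≤ 1 := Real.sqrt_le_one.2 (by nlinarith)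
    have h2 : √(1 - w ^ 2) ≤ 1 := Real.sqrt_le_one.2 (by nlinarith)
    have h3 := mul_le_mul h1 h2 (Real.sqrt_nonneg _) zero_le_one
    have h4 : -1 ≤ z * w := by nlinarith [hz.1, hz.2, hw.1, hw.2]
    linarith
  have hpos := (abs_pos.2 (sub_ne_zero.2 h)).trans_le (abs_sub_le_kernel_num hz hw)
  calc Real.log ((1 - z * w + √(1 - z ^ 2) * √(1 - w ^ 2)) / |w - z|)
      ≤ Real.log (3 / |w - z|) := Real.log_le_log (by positivity) (by gcongr)
    _ ≤ (3 / |w - z|) ^ (1 / 4 : ℝ) / (1 / 4) :=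
        Real.log_le_rpow_div (by positivity) (by norm_num)
    _ = 4 * 3 ^ (1 / 4 : ℝ) * |w - z| ^ (-(1 / 4) : ℝ) := by
        rw [Real.div_rpow (by norm_num) hd.le, Real.rpow_neg hd.le]; ring
    _ ≤ 12 * |w - z| ^ (-(1 / 4) : ℝ) := by
        have : (3 : ℝ) ^ (1 / 4 : ℝ) ≤ 3 ^ (1 : ℝ) :=
          Real.rpow_le_rpow_of_exponent_le (by norm_num) (by norm_num)
        rw [Real.rpow_one] at this
        gcongr
        linarith

lemma measurable_R₀ : Measurable fun x : ℝ => R₀ x := by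
  unfold R₀
  refine (measurable_csqrt.comp ?_).mul (measurable_csqrt.comp ?_) <;> fun_prop

lemma measurable_kernel : Measurable fun p : ℝ × ℝ => kernel p.1 p.2 := by
  unfold kernel
  have h1 : Measurable fun p : ℝ × ℝ => R₀ p.1 := measurable_R₀.comp measurable_fst
  have h2 : Measurable fun p : ℝ × ℝ => R₀ p.2 := measurable_R₀.comp measurable_snd
  fun_prop

/-- The weight `∑_{b ∈ B} |x - b|^{-1/2}`. -/
def weight (B : Finset ℝ) (x : ℝ) : ℝ := ∑ b ∈ B, (√|x - b|)⁻¹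

lemma weight_nonneg (B : Finset ℝ) (x : ℝ) : 0 ≤ weight B x :=
  Finset.sum_nonneg fun _ _ => by positivity

lemma measurable_weight (B : Finset ℝ) : Measurable (weight B) := by
  unfold weight
  fun_prop

/-- At most one of |x - b| and |x - c| can be smaller than |b - c|/2, so the other factor is
bounded. By induction a product of inverse square roots at distinct points is dominated by their
sum. -/
lemma inv_sqrt_mul_inv_sqrt_le {b c x : ℝ} (hbc : b ≠ c) :
    (√|x - b|)⁻¹ * (√|x - c|)⁻¹ ≤ (√(|b - c| / 2))⁻¹ * ((√|x - b|)⁻¹ + (√|x - c|)⁻¹) := by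
  have hd : 0 < |b - c| / 2 := by
    have := abs_pos.2 (sub_ne_zero.2 hbc); positivity
  have key : |b - c| ≤ |x - b| + |x - c| := by
    rw [abs_sub_comm x b]; simpa using abs_sub_le b x c
  have hp : 0 ≤ (√(|b - c| / 2))⁻¹ := by positivity
  have hb : 0 ≤ (√|x - b|)⁻¹ := by positivity
  have hc : 0 ≤ (√|x - c|)⁻¹ := by positivity
  rcases le_total (|b - c| / 2) |x - b| with h | h
  · have : (√|x - b|)⁻¹ ≤ (√(|b - c| / 2))⁻¹ := by gcongr
    nlinarith [mul_le_mul_of_nonneg_right this hc, mul_nonneg hp hb]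
  · have : (√|x - c|)⁻¹ ≤ (√(|b - c| / 2))⁻¹ := by
      gcongr; linarith
    nlinarith [mul_le_mul_of_nonneg_left this hb, mul_nonneg hp hc]

lemma exists_prod_inv_sqrt_le {B : Finset ℝ} (hB : B.Nonempty) :
    ∃ C, 0 ≤ C ∧ ∀ x, ∏ b ∈ B, (√|x - b|)⁻¹ ≤ C * weight B x := by
  induction hB using Finset.Nonempty.cons_induction with
  | singleton b => exact ⟨1, zero_le_one, fun x => by simp [weight]⟩
  | cons c B hc hB ih =>
    obtain ⟨C, hC, h⟩ := ih
    refine ⟨C * ∑ b ∈ B, (√(|b - c| / 2))⁻¹, by positivity, fun x => ?_⟩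
    rw [Finset.prod_cons]
    calc (√|x - c|)⁻¹ * ∏ b ∈ B, (√|x - b|)⁻¹ ≤ (√|x - c|)⁻¹ * (C * weight B x) := by
          gcongr; exact h x
      _ = C * ∑ b ∈ B, (√|x - b|)⁻¹ * (√|x - c|)⁻¹ := by
          rw [weight, Finset.mul_sum, Finset.mul_sum, Finset.mul_sum]
          exact Finset.sum_congr rfl fun b _ => by ring
      _ ≤ C * ∑ b ∈ B, (√(|b - c| / 2))⁻¹ * weight (Finset.cons c B hc) x := by
          refine mul_le_mul_of_nonneg_left (Finset.sum_le_sum fun b hb => ?_) hC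
          refine (inv_sqrt_mul_inv_sqrt_le (by rintro rfl; exact hc hb)).trans ?_
          refine mul_le_mul_of_nonneg_left ?_ (by positivity)
          rw [weight, Finset.sum_cons, add_comm]
          gcongr
          exact Finset.single_le_sum (f := fun b => (√|x - b|)⁻¹) (fun _ _ => by positivity) hb
      _ = _ := by rw [← Finset.sum_mul, mul_assoc]

lemma integrableOn_abs_rpow {r : ℝ} (hr : -1 < r) (c : ℝ) :
    IntegrableOn (fun t : ℝ => |t| ^ r) (Icc (-c) c) := by
  rcases lt_or_ge c 0 with hc | hc
  · simp [Icc_eq_empty (show ¬ -c ≤ c by linarith)]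
  have h1 : IntegrableOn (fun t : ℝ => |t| ^ r) (Ioc 0 c) := by
    have := (intervalIntegral.intervalIntegrable_rpow' (a := 0) (b := c) hr).1
    refine this.congr_fun (fun t ht => ?_) measurableSet_Ioc
    simp [abs_of_pos ht.1]
  have h2 : IntegrableOn (fun t : ℝ => |t| ^ r) (Ico (-c) 0) := by
    have := h1.comp_neg
    simpa using this
  have := (h2.union (integrableOn_singleton (x := (0 : ℝ)) (f := fun t : ℝ => |t| ^ r)
    (by simp) (by simp))).union h1
  refine this.mono_set fun t ht => ?_
  rcases lt_trichotomy t 0 with h | h | h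
  · exact Or.inl (Or.inl ⟨ht.1, h⟩)
  · exact Or.inl (Or.inr h)
  · exact Or.inr ⟨h, ht.2⟩

lemma integrableOn_abs_sub_rpow {r : ℝ} (hr : -1 < r) {b : ℝ} (hb : b ∈ Icc (-1 : ℝ) 1) :
    IntegrableOn (fun t : ℝ => |t - b| ^ r) (Icc (-1) 1) ∧
      ∫ t in Icc (-1 : ℝ) 1, |t - b| ^ r ≤ ∫ t in Icc (-2 : ℝ) 2, |t| ^ r := by
  have h := integrableOn_abs_rpow hr 2
  have h0 : IntegrableOn (fun t : ℝ => |t - b| ^ r) (Icc (-2 + b) (2 + b)) := by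
    rw [← intervalIntegrable_iff_integrableOn_Icc_of_le (by linarith)] at h ⊢
    exact h.comp_sub_right b
  have hsub : Icc (-1 : ℝ) 1 ⊆ Icc (-2 + b) (2 + b) :=
    Icc_subset_Icc (by linarith [hb.2]) (by linarith [hb.1])
  refine ⟨h0.mono_set hsub, ?_⟩
  refine (setIntegral_mono_set h0 (ae_of_all _ fun t => by positivity)
    hsub.eventuallyLE).trans_eq ?_
  rw [integral_Icc_eq_integral_Ioc, integral_Icc_eq_integral_Ioc,
    ← intervalIntegral.integral_of_le (by linarith), ← intervalIntegral.integral_of_le (by norm_num),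
    intervalIntegral.integral_comp_sub_right (fun t => |t| ^ r) b]
  simp

lemma inv_sqrt_eq_rpow (x : ℝ) : (√|x|)⁻¹ = |x| ^ (-(1 / 2) : ℝ) := by
  rw [Real.sqrt_eq_rpow, Real.rpow_neg (abs_nonneg _)]

lemma integrableOn_weight {B : Finset ℝ} (hB : ↑B ⊆ Icc (-1 : ℝ) 1) :
    IntegrableOn (weight B) (Icc (-1) 1) := by
  unfold weight
  refine integrable_finsetSum _ fun b hb => ?_
  simp_rw [inv_sqrt_eq_rpow]
  exact (integrableOn_abs_sub_rpow (by norm_num) (hB hb)).1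

/-- Replacing both bases by the smaller one only increases the product. -/
lemma rpow_mul_rpow_le {s t : ℝ} (hs : 0 < s) (ht : 0 < t) :
    s ^ (-(1 / 4) : ℝ) * t ^ (-(1 / 2) : ℝ) ≤ s ^ (-(3 / 4) : ℝ) + t ^ (-(3 / 4) : ℝ) := by
  have h1 : 0 ≤ s ^ (-(3 / 4) : ℝ) := by positivity
  have h2 : 0 ≤ t ^ (-(3 / 4) : ℝ) := by positivity
  rcases le_total s t with h | h
  · have := Real.rpow_le_rpow_of_nonpos hs h (z := -(1 / 2)) (by norm_num)
    calc s ^ (-(1 / 4) : ℝ) * t ^ (-(1 / 2) : ℝ) ≤ s ^ (-(1 / 4) : ℝ) * s ^ (-(1 / 2) : ℝ) := by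
          gcongr
      _ = s ^ (-(3 / 4) : ℝ) := by rw [← Real.rpow_add hs]; norm_num
      _ ≤ _ := by linarith
  · have := Real.rpow_le_rpow_of_nonpos ht h (z := -(1 / 4)) (by norm_num)
    calc s ^ (-(1 / 4) : ℝ) * t ^ (-(1 / 2) : ℝ) ≤ t ^ (-(1 / 4) : ℝ) * t ^ (-(1 / 2) : ℝ) := by
          gcongr
      _ = t ^ (-(3 / 4) : ℝ) := by rw [← Real.rpow_add ht]; norm_num
      _ ≤ _ := by linarith

lemma finset_ae_notMem (B : Finset ℝ) (s : Set ℝ) : ∀ᵐ x ∂volume.restrict s, x ∉ B :=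
  ae_restrict_of_ae (by
    rw [ae_iff]
    simpa using B.finite_toSet.measure_zero volume)

lemma kernel_mul_weight_le {B : Finset ℝ} {z w : ℝ} (hz : z ∈ Icc (-1 : ℝ) 1)
    (hw : w ∈ Icc (-1 : ℝ) 1) (hwz : w ≠ z) (hwB : w ∉ B) :
    kernel z w * weight B w ≤
      ∑ b ∈ B, 12 * (|w - z| ^ (-(3 / 4) : ℝ) + |w - b| ^ (-(3 / 4) : ℝ)) := by
  rw [weight, Finset.mul_sum]
  refine Finset.sum_le_sum fun b hb => ?_
  have h1 : 0 < |w - z| := abs_pos.2 (sub_ne_zero.2 hwz)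
  have h2 : 0 < |w - b| := abs_pos.2 (sub_ne_zero.2 fun h => hwB (h ▸ hb))
  calc kernel z w * (√|w - b|)⁻¹ ≤ (12 * |w - z| ^ (-(1 / 4) : ℝ)) * |w - b| ^ (-(1 / 2) : ℝ) := by
        rw [inv_sqrt_eq_rpow]
        gcongr
        exact kernel_le hz hw
    _ = 12 * (|w - z| ^ (-(1 / 4) : ℝ) * |w - b| ^ (-(1 / 2) : ℝ)) := by ring
    _ ≤ _ := by gcongr; exact rpow_mul_rpow_le h1 h2

/-- Every singular term is a translate of |t|^{-3/4}, whose integral over [-1,1] is at most that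
over [-2,2]. Hence the bound does not depend on z, as the energy estimates require. -/
lemma exists_kernel_mul_weight_bound {B : Finset ℝ} (hB : ↑B ⊆ Icc (-1 : ℝ) 1) :
    ∃ C, ∀ z ∈ Icc (-1 : ℝ) 1, IntegrableOn (fun w => kernel z w * weight B w) (Icc (-1) 1) ∧
      ∫ w in Icc (-1 : ℝ) 1, kernel z w * weight B w ≤ C := by
  set M := ∫ t in Icc (-2 : ℝ) 2, |t| ^ (-(3 / 4) : ℝ)
  refine ⟨∑ b ∈ B, 12 * (M + M), fun z hz => ?_⟩
  have hi : ∀ b ∈ Icc (-1 : ℝ) 1, _ := fun b hb =>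
    integrableOn_abs_sub_rpow (r := -(3 / 4)) (by norm_num) hb
  have hdom : IntegrableOn (fun w => ∑ b ∈ B,
      12 * (|w - z| ^ (-(3 / 4) : ℝ) + |w - b| ^ (-(3 / 4) : ℝ))) (Icc (-1) 1) :=
    integrable_finsetSum _ fun b hb => (((hi z hz).1.add (hi b (hB hb)).1).const_mul 12)
  have hle : ∀ᵐ w ∂volume.restrict (Icc (-1 : ℝ) 1), kernel z w * weight B w ≤
      ∑ b ∈ B, 12 * (|w - z| ^ (-(3 / 4) : ℝ) + |w - b| ^ (-(3 / 4) : ℝ)) := by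
    filter_upwards [finset_ae_notMem B _, finset_ae_notMem {z} _,
      ae_restrict_mem measurableSet_Icc] with w h1 h2 h3
    exact kernel_mul_weight_le hz h3 (by simpa using h2) h1
  have hint : IntegrableOn (fun w => kernel z w * weight B w) (Icc (-1) 1) := by
    refine Integrable.mono' hdom ?_ ?_
    · exact ((measurable_kernel.comp (measurable_const.prodMk measurable_id)).mul
        (measurable_weight B)).aestronglyMeasurable
    · filter_upwards [hle, ae_restrict_mem measurableSet_Icc] with w h1 h2
      rwa [Real.norm_of_nonneg (mul_nonneg (kernel_nonneg hz h2) (weight_nonneg _ _))]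
  refine ⟨hint, (integral_mono_ae hint hdom hle).trans ?_⟩
  rw [integral_finsetSum _ fun b hb => by
    exact (((hi z hz).1.add (hi b (hB hb)).1).const_mul 12)]
  refine Finset.sum_le_sum fun b hb => ?_
  rw [integral_const_mul, integral_add (hi z hz).1 (hi b (hB hb)).1]
  have := (hi z hz).2
  have := (hi b (hB hb)).2
  gcongr

/-! ### The square roots in the Joukowski variable -/

/-- The Joukowski map. -/
def joukowski (ζ : ℂ) : ℂ := (ζ + ζ⁻¹) / 2

/-- The point of the upper unit half circle above `c ∈ [-1, 1]`. -/
def circlePoint (c : ℝ) : ℂ := c + Complex.I * (√(1 - c ^ 2) : ℝ)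

/-- The holomorphic square root of `1 - 2 c ζ + ζ²` on the unit disc. -/
def discRoot (c : ℝ) (ζ : ℂ) : ℂ :=
  csqrt (1 - ζ * circlePoint c) * csqrt (1 - ζ * conj (circlePoint c))

section discRoot

variable {c : ℝ} {ζ : ℂ}

lemma normSq_circlePoint (hc : c ∈ Icc (-1 : ℝ) 1) : circlePoint c * conj (circlePoint c) = 1 := by
  have h : (√(1 - c ^ 2)) ^ 2 = 1 - c ^ 2 := Real.sq_sqrt (by nlinarith [hc.1, hc.2])
  have h' : ((√(1 - c ^ 2) : ℝ) : ℂ) ^ 2 = 1 - (c : ℂ) ^ 2 := by exact_mod_cast h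
  simp only [circlePoint, map_add, map_mul, Complex.conj_ofReal, Complex.conj_I]
  linear_combination h' - (√(1 - c ^ 2) : ℝ) ^ 2 * Complex.I_sq

lemma norm_circlePoint (hc : c ∈ Icc (-1 : ℝ) 1) : ‖circlePoint c‖ = 1 := by
  have := normSq_circlePoint hc
  rw [Complex.mul_conj] at this
  have h2 : Complex.normSq (circlePoint c) = 1 := by exact_mod_cast this
  rw [Complex.normSq_eq_norm_sq] at h2
  nlinarith [norm_nonneg (circlePoint c)]

lemma circlePoint_add_conj : circlePoint c + conj (circlePoint c) = 2 * c := by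
  simp only [circlePoint, map_add, map_mul, Complex.conj_ofReal, Complex.conj_I]
  ring

lemma discRoot_sq (hc : c ∈ Icc (-1 : ℝ) 1) : discRoot c ζ ^ 2 = 1 - 2 * c * ζ + ζ ^ 2 := by
  rw [discRoot, mul_pow, csqrt_sq, csqrt_sq]
  linear_combination ζ ^ 2 * normSq_circlePoint hc - ζ * circlePoint_add_conj (c := c)

lemma norm_discRoot (hc : c ∈ Icc (-1 : ℝ) 1) :
    ‖discRoot c ζ‖ = √‖1 - 2 * c * ζ + ζ ^ 2‖ := by
  rw [← discRoot_sq hc, norm_pow, Real.sqrt_sq (norm_nonneg _)]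

lemma re_one_sub_nonneg {w : ℂ} (hζ : ‖ζ‖ ≤ 1) (hw : ‖w‖ ≤ 1) : 0 ≤ (1 - ζ * w).re := by
  have h1 : ‖ζ * w‖ ≤ 1 := by
    rw [norm_mul]; exact mul_le_one₀ hζ (norm_nonneg _) hw
  have := Complex.re_le_norm (ζ * w)
  simp only [Complex.sub_re, Complex.one_re]
  linarith

lemma discRoot_re_nonneg (hc : c ∈ Icc (-1 : ℝ) 1) (hζ : ‖ζ‖ ≤ 1) : 0 ≤ (discRoot c ζ).re := by
  have h := norm_circlePoint hc
  have h1 := abs_csqrt_im_le (re_one_sub_nonneg hζ h.le)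
  have h2 := abs_csqrt_im_le (re_one_sub_nonneg (w := conj (circlePoint c)) hζ (by simp [h]))
  rw [discRoot, Complex.mul_re, sub_nonneg]
  refine (le_abs_self _).trans ?_
  rw [abs_mul]
  exact mul_le_mul h1 h2 (abs_nonneg _) ((abs_nonneg _).trans h1)

lemma discRoot_conj (hc : c ∈ Icc (-1 : ℝ) 1) (hζ : ‖ζ‖ ≤ 1) :
    discRoot c (conj ζ) = conj (discRoot c ζ) := by
  have h := norm_circlePoint hc
  rw [discRoot, discRoot, map_mul, mul_comm,
    ← csqrt_conj (re_one_sub_nonneg hζ h.le),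
    ← csqrt_conj (re_one_sub_nonneg (w := conj (circlePoint c)) hζ (by simp [h]))]
  simp

lemma continuousAt_discRoot (hc : c ∈ Icc (-1 : ℝ) 1) (hζ : ‖ζ‖ ≤ 1) :
    ContinuousAt (discRoot c) ζ := by
  have h := norm_circlePoint hc
  unfold discRoot
  refine ContinuousAt.mul ?_ ?_
  · exact ContinuousAt.comp (g := csqrt) (continuousAt_csqrt (re_one_sub_nonneg hζ h.le))
      (by fun_prop)
  · exact ContinuousAt.comp (g := csqrt)
      (continuousAt_csqrt (re_one_sub_nonneg hζ (by simp [h]))) (by fun_prop)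

lemma one_sub_mul_ne_zero {w : ℂ} (hζ : ‖ζ‖ < 1) (hw : ‖w‖ ≤ 1) : 1 - ζ * w ≠ 0 := by
  intro h
  have : ‖ζ * w‖ = 1 := by rw [← sub_eq_zero.1 h, norm_one]
  rw [norm_mul] at this
  nlinarith [norm_nonneg ζ, norm_nonneg w]

lemma discRoot_ne_zero (hc : c ∈ Icc (-1 : ℝ) 1) (hζ : ‖ζ‖ < 1) : discRoot c ζ ≠ 0 := by
  have h := norm_circlePoint hc
  rw [discRoot, mul_ne_zero_iff, Ne, Ne, csqrt_eq_zero, csqrt_eq_zero]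
  exact ⟨one_sub_mul_ne_zero hζ h.le, one_sub_mul_ne_zero hζ (by simp [h])⟩

lemma differentiableAt_discRoot (hc : c ∈ Icc (-1 : ℝ) 1) (hζ : ‖ζ‖ < 1) :
    DifferentiableAt ℂ (discRoot c) ζ := by
  have key : ∀ w : ℂ, ‖w‖ ≤ 1 → DifferentiableAt ℂ (fun ζ => csqrt (1 - ζ * w)) ζ := by
    intro w hw
    have h1 := differentiableAt_csqrt (mem_slitPlane_of_re_nonneg (re_one_sub_nonneg hζ.le hw)
      (one_sub_mul_ne_zero hζ hw))
    exact DifferentiableAt.comp (g := csqrt) ζ h1 (by fun_prop)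
  have h := norm_circlePoint hc
  exact (key _ h.le).mul (key _ (by simp [h]))

lemma discRoot_zero : discRoot c 0 = 1 := by simp [discRoot, csqrt]

lemma exp_add_inv (θ : ℝ) :
    Complex.exp (θ * Complex.I) + (Complex.exp (θ * Complex.I))⁻¹ = 2 * (Real.cos θ : ℝ) := by
  rw [← Complex.exp_neg, ← neg_mul, Complex.ofReal_cos, ← Complex.two_cos]

lemma one_sub_add_sq_exp (θ : ℝ) (c : ℂ) : 1 - 2 * c * Complex.exp (θ * Complex.I)
    + Complex.exp (θ * Complex.I) ^ 2 =
    2 * Complex.exp (θ * Complex.I) * ((Real.cos θ : ℝ) - c) := by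
  have h := exp_add_inv θ
  have h0 := Complex.exp_ne_zero (θ * Complex.I)
  field_simp at h
  linear_combination h

/-- Both sides have the same square, and the sign follows from `discRoot_re_nonneg`. The conjugate
appears because the upper half disc is mapped to the lower half plane, while `csqrt` takes its
boundary values from above. -/
lemma discRoot_exp (hc : c ∈ Icc (-1 : ℝ) 1) {θ : ℝ} (hθ : θ ∈ Ioo 0 Real.pi) :
    discRoot c (Complex.exp (θ * Complex.I)) =
      Complex.exp ((θ / 2 : ℝ) * Complex.I) * (√2 : ℝ) * conj (csqrt ((Real.cos θ : ℝ) - c)) := by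
  set e := Complex.exp ((θ / 2 : ℝ) * Complex.I)
  have he : e ^ 2 = Complex.exp (θ * Complex.I) := by
    rw [← Complex.exp_nat_mul]; congr 1; push_cast; ring
  have hn : ‖Complex.exp (θ * Complex.I)‖ ≤ 1 := (Complex.norm_exp_ofReal_mul_I θ).le
  have h2 : ((√2 : ℝ) : ℂ) ^ 2 = 2 := by
    rw [← Complex.ofReal_pow, Real.sq_sqrt zero_le_two]; simp
  have hsq : discRoot c (Complex.exp (θ * Complex.I)) ^ 2 =
      (e * (√2 : ℝ) * conj (csqrt ((Real.cos θ : ℝ) - c))) ^ 2 := by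
    rw [discRoot_sq hc, one_sub_add_sq_exp, mul_pow, mul_pow, ← map_pow, csqrt_sq, he, h2]
    simp only [map_sub, Complex.conj_ofReal]
    ring
  rcases sq_eq_sq_iff_eq_or_eq_neg.1 hsq with h | h
  · exact h
  rcases eq_or_ne (Real.cos θ) c with hcc | hcc
  · rw [h, hcc, sub_self, csqrt_eq_zero.2 rfl]; simp
  exfalso
  have hre := discRoot_re_nonneg hc hn
  rw [h, Complex.neg_re] at hre
  have hsin : 0 < Real.sin (θ / 2) :=
    Real.sin_pos_of_pos_of_lt_pi (by linarith [hθ.1]) (by linarith [hθ.1, hθ.2])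
  have hcos : 0 < Real.cos (θ / 2) :=
    Real.cos_pos_of_mem_Ioo ⟨by linarith [hθ.1, Real.pi_pos], by linarith [hθ.2]⟩
  have he1 : e.re = Real.cos (θ / 2) := Complex.exp_ofReal_mul_I_re _
  have he2 : e.im = Real.sin (θ / 2) := Complex.exp_ofReal_mul_I_im _
  have hpos : 0 < √(2 : ℝ) := by positivity
  rw [← Complex.ofReal_sub] at hre
  rcases hcc.lt_or_gt with hlt | hgt
  · rw [csqrt_ofReal_of_nonpos (by linarith)] at hre
    have h4 : 0 < √(-(Real.cos θ - c)) := Real.sqrt_pos.2 (by linarith)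
    simp only [map_mul, Complex.conj_I, Complex.conj_ofReal, Complex.mul_re, Complex.mul_im,
      Complex.ofReal_re, Complex.ofReal_im, Complex.neg_re, Complex.neg_im, Complex.I_re,
      Complex.I_im, he1, he2] at hre
    nlinarith [mul_pos (mul_pos hsin hpos) h4]
  · rw [csqrt_ofReal_of_nonneg (by linarith)] at hre
    have h4 : 0 < √(Real.cos θ - c) := Real.sqrt_pos.2 (by linarith)
    simp only [Complex.conj_ofReal, Complex.mul_re, Complex.mul_im,
      Complex.ofReal_re, Complex.ofReal_im, he1, he2] at hre
    nlinarith [mul_pos (mul_pos hcos hpos) h4]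

/-- The radial point is at distance 1 - r from its endpoint and at least 1 - r from every point of
the unit circle. -/
lemma norm_exp_sub_le {r : ℝ} (hr : r ∈ Icc (0 : ℝ) 1) (θ : ℝ) {w : ℂ} (hw : ‖w‖ = 1) :
    ‖Complex.exp (θ * Complex.I) - w‖ ≤ 2 * ‖r * Complex.exp (θ * Complex.I) - w‖ := by
  set e := Complex.exp (θ * Complex.I)
  have he : ‖e‖ = 1 := Complex.norm_exp_ofReal_mul_I θ
  have h1 : ‖e - r * e‖ = 1 - r := by
    rw [show e - r * e = ((1 - r : ℝ) : ℂ) * e by push_cast; ring, norm_mul, he, mul_one,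
      Complex.norm_real, Real.norm_of_nonneg (by linarith [hr.2])]
  have h2 : 1 - r ≤ ‖r * e - w‖ := by
    have := norm_sub_norm_le w (r * e)
    rwa [hw, norm_mul, he, mul_one, Complex.norm_real, Real.norm_of_nonneg hr.1, norm_sub_rev]
      at this
  calc ‖e - w‖ = ‖(e - r * e) + (r * e - w)‖ := by congr 1; ring
    _ ≤ ‖e - r * e‖ + ‖r * e - w‖ := norm_add_le _ _
    _ ≤ _ := by rw [h1]; linarith

/-- The quadratic factors over the two circle points above c, and `norm_exp_sub_le` loses a factor 2
on each against the boundary value 2|cos θ - c|. It serves twice: to dominate radial limits and to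
keep the radial path in a cone for the principal value. -/
lemma abs_cos_sub_le (hc : c ∈ Icc (-1 : ℝ) 1) {r : ℝ} (hr : r ∈ Icc (0 : ℝ) 1) (θ : ℝ) :
    |Real.cos θ - c| / 2 ≤ ‖1 - 2 * c * (r * Complex.exp (θ * Complex.I))
      + (r * Complex.exp (θ * Complex.I)) ^ 2‖ := by
  have hfac : ∀ ζ : ℂ, 1 - 2 * c * ζ + ζ ^ 2 = (ζ - circlePoint c) * (ζ - conj (circlePoint c)) :=
    fun ζ => by linear_combination ζ * circlePoint_add_conj (c := c) - normSq_circlePoint hc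
  have hw := norm_circlePoint hc
  have h1 := norm_exp_sub_le hr θ hw
  have h2 := norm_exp_sub_le hr θ (w := conj (circlePoint c)) (by simp [hw])
  have h3 : ‖1 - 2 * c * (Complex.exp (θ * Complex.I)) + (Complex.exp (θ * Complex.I)) ^ 2‖ =
      2 * |Real.cos θ - c| := by
    rw [one_sub_add_sq_exp, ← Complex.ofReal_sub, norm_mul, norm_mul,
      Complex.norm_exp_ofReal_mul_I, Complex.norm_real, Real.norm_eq_abs]
    simp
  rw [hfac, norm_mul] at h3 ⊢
  have := mul_le_mul h1 h2 (norm_nonneg _) (by positivity)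
  linarith

end discRoot

/-! ### The function `P R₀ / ∏ (z - b)^{1/2}` in the Joukowski variable -/

/-- The function `P(z) R₀(z) / ∏_{b ∈ B} (z - b)^{1/2}`, `z = (ζ + 1/ζ)/2`, for `2 m` points `b`. -/
def discFun (B : Finset ℝ) (m : ℕ) (P : ℝ[X]) (ζ : ℂ) : ℂ :=
  P.aeval (joukowski ζ) * ((1 - ζ ^ 2) / (2 * ζ)) * (2 * ζ) ^ m / ∏ b ∈ B, discRoot b ζ

section discFun

variable {B : Finset ℝ} {m : ℕ} {P : ℝ[X]}

lemma joukowski_conj (ζ : ℂ) : joukowski (conj ζ) = conj (joukowski ζ) := by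
  simp [joukowski, map_ofNat]

lemma aeval_conj (P : ℝ[X]) (z : ℂ) : P.aeval (conj z) = conj (P.aeval z) :=
  Polynomial.aeval_conj P z

lemma discFun_conj (hB : ↑B ⊆ Icc (-1 : ℝ) 1) {ζ : ℂ} (hζ : ‖ζ‖ ≤ 1) :
    discFun B m P (conj ζ) = conj (discFun B m P ζ) := by
  rw [discFun, discFun, joukowski_conj, aeval_conj,
    Finset.prod_congr rfl fun b hb => discRoot_conj (hB hb) hζ]
  simp [map_prod, map_ofNat]

lemma joukowski_exp (θ : ℝ) : joukowski (Complex.exp (θ * Complex.I)) = (Real.cos θ : ℝ) := by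
  rw [joukowski, exp_add_inv]; ring

lemma exp_sub_inv (θ : ℝ) :
    (Complex.exp (θ * Complex.I))⁻¹ - Complex.exp (θ * Complex.I) =
      -(2 * Complex.I * (Real.sin θ : ℝ)) := by
  rw [← Complex.exp_neg, ← neg_mul, Complex.ofReal_sin, Complex.sin]
  linear_combination (Complex.exp (-θ * Complex.I) - Complex.exp (θ * Complex.I)) * Complex.I_sq

lemma discFun_exp (hB : ↑B ⊆ Icc (-1 : ℝ) 1) (hm : B.card = 2 * m) {θ : ℝ}
    (hθ : θ ∈ Ioo 0 Real.pi) :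
    discFun B m P (Complex.exp (θ * Complex.I)) =
      conj ((P.eval (Real.cos θ) : ℝ) / rootProd B (Real.cos θ)) *
        (-Complex.I * (Real.sin θ : ℝ)) := by
  have h1 : ∏ b ∈ B, discRoot b (Complex.exp (θ * Complex.I)) =
      (2 * Complex.exp (θ * Complex.I)) ^ m * conj (rootProd B (Real.cos θ)) := by
    rw [Finset.prod_congr rfl fun b hb => discRoot_exp (hB hb) hθ, Finset.prod_mul_distrib,
      Finset.prod_const, hm, pow_mul, rootProd, map_prod]
    congr 2
    rw [mul_pow, ← Complex.exp_nat_mul, ← Complex.ofReal_pow, Real.sq_sqrt zero_le_two, mul_comm]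
    congr 2
    push_cast; ring
  have h0 := Complex.exp_ne_zero (θ * Complex.I)
  have h2 : (1 - Complex.exp (θ * Complex.I) ^ 2) / (2 * Complex.exp (θ * Complex.I)) =
      -Complex.I * (Real.sin θ : ℝ) := by
    have := exp_sub_inv θ
    field_simp at this ⊢
    linear_combination this
  rw [discFun, h1, h2, joukowski_exp]
  have h3 : P.aeval ((Real.cos θ : ℝ) : ℂ) = ((P.eval (Real.cos θ) : ℝ) : ℂ) := by
    exact Polynomial.aeval_algebraMap_apply_eq_algebraMap_eval _ P
  rw [h3]
  simp only [map_div₀, Complex.conj_ofReal]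
  field_simp

lemma continuousAt_joukowski {ζ : ℂ} (h0 : ζ ≠ 0) : ContinuousAt joukowski ζ := by
  unfold joukowski
  fun_prop (disch := assumption)

lemma continuousAt_discFun (hB : ↑B ⊆ Icc (-1 : ℝ) 1) {ζ : ℂ} (h0 : ζ ≠ 0) (hζ : ‖ζ‖ ≤ 1)
    (hne : ∀ b ∈ B, discRoot b ζ ≠ 0) : ContinuousAt (discFun B m P) ζ := by
  unfold discFun
  refine ContinuousAt.div ?_ ?_ (Finset.prod_ne_zero_iff.2 hne)
  · refine (ContinuousAt.mul (P.continuous_aeval.continuousAt.comp (continuousAt_joukowski h0)) ?_).mul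
      (by fun_prop)
    refine ContinuousAt.div (by fun_prop) (by fun_prop) (by simpa using h0)
  · exact tendsto_finsetProd _ fun b hb => continuousAt_discRoot (hB hb) hζ

lemma discRoot_exp_ne_zero {b θ : ℝ} (hb : b ∈ Icc (-1 : ℝ) 1) (h : Real.cos θ ≠ b) :
    discRoot b (Complex.exp (θ * Complex.I)) ≠ 0 := by
  rw [← norm_ne_zero_iff, norm_discRoot hb, one_sub_add_sq_exp, Real.sqrt_ne_zero (norm_nonneg _),
    norm_ne_zero_iff]
  refine mul_ne_zero (mul_ne_zero two_ne_zero (Complex.exp_ne_zero _)) ?_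
  rw [← Complex.ofReal_sub]
  exact_mod_cast sub_ne_zero.2 h

lemma norm_discRoot_le_two {c : ℝ} (hc : c ∈ Icc (-1 : ℝ) 1) {ζ : ℂ} (hζ : ‖ζ‖ ≤ 1) :
    ‖discRoot c ζ‖ ≤ 2 := by
  rw [norm_discRoot hc, Real.sqrt_le_iff]
  refine ⟨zero_le_two, ?_⟩
  have hc' : ‖(c : ℂ)‖ ≤ 1 := by
    rw [Complex.norm_real, Real.norm_eq_abs, abs_le]; exact hc
  calc ‖1 - 2 * c * ζ + ζ ^ 2‖ ≤ ‖(1 : ℂ)‖ + ‖2 * c * ζ‖ + ‖ζ ^ 2‖ :=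
        (norm_add_le _ _).trans (by gcongr; exact norm_sub_le _ _)
    _ = 1 + 2 * (‖(c : ℂ)‖ * ‖ζ‖) + ‖ζ‖ ^ 2 := by simp; ring
    _ ≤ 1 + 2 * (1 * 1) + 1 ^ 2 := by gcongr
    _ = 2 ^ 2 := by norm_num

lemma inv_norm_discRoot_le {b : ℝ} (hb : b ∈ Icc (-1 : ℝ) 1) {r : ℝ} (hr : r ∈ Icc (0 : ℝ) 1)
    {θ : ℝ} (h : Real.cos θ ≠ b) :
    ‖discRoot b (r * Complex.exp (θ * Complex.I))‖⁻¹ ≤ 2 * (√|Real.cos θ - b|)⁻¹ := by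
  have h0 : 0 < |Real.cos θ - b| := abs_pos.2 (sub_ne_zero.2 h)
  rw [norm_discRoot hb, show (2 : ℝ) * (√|Real.cos θ - b|)⁻¹ = (√(|Real.cos θ - b| / 4))⁻¹ by
    rw [Real.sqrt_div h0.le, show (4 : ℝ) = 2 ^ 2 by norm_num, Real.sqrt_sq zero_le_two]
    field_simp]
  gcongr
  exact le_trans (by linarith) (abs_cos_sub_le hb hr θ)

/-- Applied with T = {1, -1}, whose product of roots is |1 - ζ²|: the zeros of R₀ at ±1 cancel any
branch points there. -/
lemma prod_inv_mul_prod_le {B T : Finset ℝ} {g : ℝ → ℝ} (hg : ∀ b, 0 ≤ g b)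
    (hT : ∀ b ∈ T, g b ≤ 2) :
    (∏ b ∈ B, (g b)⁻¹) * ∏ b ∈ T, g b ≤ 2 ^ T.card * ∏ b ∈ B \ T, (g b)⁻¹ := by
  rw [← Finset.prod_inter_mul_prod_sdiff B T, ← Finset.prod_inter_mul_prod_sdiff T B,
    Finset.inter_comm T B]
  have h1 : (∏ b ∈ B ∩ T, (g b)⁻¹) * ∏ b ∈ B ∩ T, g b ≤ 1 := by
    rw [← Finset.prod_mul_distrib]
    exact Finset.prod_le_one (fun b _ => mul_nonneg (inv_nonneg.2 (hg b)) (hg b))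
      fun b _ => inv_mul_le_one
  have h2 : ∏ b ∈ T \ B, g b ≤ 2 ^ T.card :=
    ((Finset.prod_le_prod (fun b _ => hg b) fun b hb => hT b (Finset.mem_sdiff.1 hb).1).trans_eq
      (Finset.prod_const _)).trans (pow_le_pow_right₀ one_le_two (Finset.card_le_card Finset.sdiff_subset))
  have h3 : 0 ≤ ∏ b ∈ T \ B, g b := Finset.prod_nonneg fun b _ => hg b
  have h4 : 0 ≤ ∏ b ∈ B \ T, (g b)⁻¹ := Finset.prod_nonneg fun b _ => inv_nonneg.2 (hg b)
  calc _ = ((∏ b ∈ B ∩ T, (g b)⁻¹) * ∏ b ∈ B ∩ T, g b) *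
        ((∏ b ∈ T \ B, g b) * ∏ b ∈ B \ T, (g b)⁻¹) := by ring
    _ ≤ 1 * (2 ^ T.card * ∏ b ∈ B \ T, (g b)⁻¹) := by gcongr
    _ = _ := one_mul _

/-- The bound is uniform in r, and sin θ is the Jacobian of x = cos θ, so it is integrable in θ.
Adjoining ±1 to B allows sin θ = √|cos θ - 1| √|cos θ + 1| to be split off and makes the index set
nonempty for `exists_prod_inv_sqrt_le`. -/
lemma exists_norm_discFun_le (hB : ↑B ⊆ Icc (-1 : ℝ) 1) (m : ℕ) (P : ℝ[X]) :
    ∃ C, 0 ≤ C ∧ ∀ r ∈ Icc (1 / 2 : ℝ) 1, ∀ θ ∈ Ioo 0 Real.pi, Real.cos θ ∉ B →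
      ‖discFun B m P (r * Complex.exp (θ * Complex.I))‖ ≤
        C * (Real.sin θ * weight (B ∪ {1, -1}) (Real.cos θ)) := by
  obtain ⟨C₁, hC₁⟩ := (isCompact_closedBall (0 : ℂ) 2).exists_bound_of_continuousOn
    (f := fun z => P.aeval z) P.continuous_aeval.continuousOn
  have hC₁0 : 0 ≤ C₁ := (norm_nonneg _).trans (hC₁ 0 (by simp))
  obtain ⟨C₂, hC₂0, hC₂⟩ := exists_prod_inv_sqrt_le (B := B ∪ {1, -1}) (by simp)
  refine ⟨C₁ * 2 ^ m * (4 * 2 ^ (B \ {1, -1}).card * C₂), by positivity, fun r hr θ hθ hcos => ?_⟩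
  have hr' : r ∈ Icc (0 : ℝ) 1 := ⟨by linarith [hr.1], hr.2⟩
  set ζ : ℂ := r * Complex.exp (θ * Complex.I) with hζdef
  have hζ : ‖ζ‖ = r := by
    rw [hζdef, norm_mul, Complex.norm_exp_ofReal_mul_I, Complex.norm_real,
      Real.norm_of_nonneg hr'.1, mul_one]
  have hζ1 : ‖ζ‖ ≤ 1 := hζ ▸ hr.2
  have hJ : ‖joukowski ζ‖ ≤ 2 := by
    have h1 : ‖ζ⁻¹‖ ≤ 2 := by
      rw [norm_inv, hζ]
      exact inv_le_of_inv_le₀ two_pos (by linarith [hr.1])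
    rw [joukowski, norm_div]
    have := norm_add_le ζ ζ⁻¹
    simp only [Complex.norm_ofNat]
    linarith
  have hT : ∀ b ∈ ({1, -1} : Finset ℝ), b ∈ Icc (-1 : ℝ) 1 := by
    intro b hb
    simp only [Finset.mem_insert, Finset.mem_singleton] at hb
    rcases hb with rfl | rfl <;> norm_num
  have h1 : ‖1 - ζ ^ 2‖ = ∏ b ∈ ({1, -1} : Finset ℝ), ‖discRoot b ζ‖ := by
    rw [Finset.prod_pair (by norm_num), norm_discRoot (hT 1 (by simp)),
      norm_discRoot (hT (-1) (by simp)), ← Real.sqrt_mul (norm_nonneg _), ← norm_mul]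
    rw [show (1 - 2 * ((1 : ℝ) : ℂ) * ζ + ζ ^ 2) * (1 - 2 * ((-1 : ℝ) : ℂ) * ζ + ζ ^ 2) =
      (1 - ζ ^ 2) ^ 2 by push_cast; ring, norm_pow, Real.sqrt_sq (norm_nonneg _)]
  have hsin : Real.sin θ = ∏ b ∈ ({1, -1} : Finset ℝ), √|Real.cos θ - b| := by
    rw [Finset.prod_pair (by norm_num), ← Real.sqrt_mul (abs_nonneg _), ← abs_mul,
      show (Real.cos θ - 1) * (Real.cos θ - -1) = -Real.sin θ ^ 2 by
        linear_combination Real.sin_sq_add_cos_sq θ, abs_neg, abs_sq,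
      Real.sqrt_sq (Real.sin_pos_of_mem_Ioo hθ).le]
  have hsin0 : ∀ b ∈ ({1, -1} : Finset ℝ), √|Real.cos θ - b| ≠ 0 := by
    rw [← Finset.prod_ne_zero_iff, ← hsin]
    exact (Real.sin_pos_of_mem_Ioo hθ).ne'
  have h2 : (∏ b ∈ B, ‖discRoot b ζ‖⁻¹) * ‖1 - ζ ^ 2‖ ≤
      4 * (2 ^ (B \ {1, -1}).card * ∏ b ∈ B \ {1, -1}, (√|Real.cos θ - b|)⁻¹) := by
    rw [h1]
    refine (prod_inv_mul_prod_le (fun b => norm_nonneg _)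
      fun b hb => norm_discRoot_le_two (hT b hb) hζ1).trans ?_
    rw [Finset.card_pair (by norm_num)]
    norm_num1
    gcongr
    rw [← Finset.prod_const, ← Finset.prod_mul_distrib]
    refine Finset.prod_le_prod (fun b _ => by positivity) fun b hb => ?_
    have hb' := (Finset.mem_sdiff.1 hb).1
    exact inv_norm_discRoot_le (hB hb') hr' fun h => hcos (h ▸ hb')
  have h3 : ∏ b ∈ B \ {1, -1}, (√|Real.cos θ - b|)⁻¹ =
      Real.sin θ * ∏ b ∈ B ∪ {1, -1}, (√|Real.cos θ - b|)⁻¹ := by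
    rw [← Finset.sdiff_union_self_eq_union, Finset.prod_union Finset.sdiff_disjoint, hsin,
      mul_comm, mul_assoc, ← Finset.prod_mul_distrib,
      Finset.prod_congr rfl fun b hb => inv_mul_cancel₀ (hsin0 b hb)]
    simp
  have h4 : ‖(2 * ζ) ^ m‖ * ‖2 * ζ‖⁻¹ ≤ 2 ^ m := by
    have h5 : ‖2 * ζ‖ = 2 * r := by rw [norm_mul, hζ]; simp
    rw [norm_pow, h5]
    have : (2 * r)⁻¹ ≤ 1 := inv_le_one_of_one_le₀ (by linarith [hr.1])
    calc (2 * r) ^ m * (2 * r)⁻¹ ≤ (2 * 1) ^ m * 1 := by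
          have := hr.1; have := hr.2; gcongr
      _ = 2 ^ m := by ring
  rw [discFun, norm_div, norm_mul, norm_mul, norm_div, norm_prod, div_eq_mul_inv, div_eq_mul_inv,
    ← Finset.prod_inv_distrib]
  calc ‖P.aeval (joukowski ζ)‖ * (‖1 - ζ ^ 2‖ * ‖2 * ζ‖⁻¹) * ‖(2 * ζ) ^ m‖ *
        ∏ b ∈ B, ‖discRoot b ζ‖⁻¹
      = ‖P.aeval (joukowski ζ)‖ * (‖(2 * ζ) ^ m‖ * ‖2 * ζ‖⁻¹) *
        ((∏ b ∈ B, ‖discRoot b ζ‖⁻¹) * ‖1 - ζ ^ 2‖) := by ring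
    _ ≤ C₁ * 2 ^ m * (4 * (2 ^ (B \ {1, -1}).card *
        (Real.sin θ * (C₂ * weight (B ∪ {1, -1}) (Real.cos θ))))) := by
        have hs := (Real.sin_pos_of_mem_Ioo hθ).le
        have h6 := hC₁ (joukowski ζ) (by simpa using hJ)
        refine mul_le_mul (mul_le_mul h6 h4 (by positivity) hC₁0) (h2.trans ?_)
          (by positivity) (by positivity)
        rw [h3]
        gcongr
        exact hC₂ _
    _ = _ := by ring

end discFun

/-! ### The expansion at infinity -/

/-- `P R₀ / ∏ (z - b)^{1/2} = α z² + β z + γ + O(1/z)` at infinity. -/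
def HasExpansion (B : Finset ℝ) (m : ℕ) (P : ℝ[X]) (α β γ : ℝ) : Prop :=
  ∃ h : ℂ → ℂ, DifferentiableOn ℂ h (Metric.ball 0 1) ∧ h 0 = 0 ∧
    ∀ ζ ∈ Metric.ball (0 : ℂ) 1, ζ ≠ 0 →
      discFun B m P ζ = α * joukowski ζ ^ 2 + β * joukowski ζ + γ + h ζ

section expansion

variable {B : Finset ℝ} {m : ℕ} {P Q : ℝ[X]} {α β γ α' β' γ' : ℝ}

lemma HasExpansion.add (hP : HasExpansion B m P α β γ) (hQ : HasExpansion B m Q α' β' γ') :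
    HasExpansion B m (P + Q) (α + α') (β + β') (γ + γ') := by
  obtain ⟨h, h1, h2, h3⟩ := hP
  obtain ⟨k, k1, k2, k3⟩ := hQ
  refine ⟨fun ζ => h ζ + k ζ, h1.add k1, by simp [h2, k2], fun ζ hζ h0 => ?_⟩
  have : discFun B m (P + Q) ζ = discFun B m P ζ + discFun B m Q ζ := by
    simp only [discFun, map_add]; ring
  rw [this, h3 ζ hζ h0, k3 ζ hζ h0]
  push_cast; ring

lemma exists_eq_add_mul {g : ℂ → ℂ} (hg : DifferentiableOn ℂ g (Metric.ball 0 1)) :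
    ∃ k : ℂ → ℂ, DifferentiableOn ℂ k (Metric.ball 0 1) ∧ ∀ ζ, g ζ = g 0 + ζ * k ζ := by
  refine ⟨dslope g 0, (Complex.differentiableOn_dslope (Metric.ball_mem_nhds _ one_pos)).2 hg,
    fun ζ => ?_⟩
  have := sub_smul_dslope g 0 ζ
  simp only [sub_zero, smul_eq_mul] at this
  rw [this]; ring

/-- `discFun` commutes with conjugation, so averaging an expansion with its conjugate makes the
coefficients real. -/
lemma hasExpansion_of_complex (hB : ↑B ⊆ Icc (-1 : ℝ) 1) {β γ : ℂ} {h : ℂ → ℂ}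
    (h1 : DifferentiableOn ℂ h (Metric.ball 0 1)) (h2 : h 0 = 0)
    (h3 : ∀ ζ ∈ Metric.ball (0 : ℂ) 1, ζ ≠ 0 →
      discFun B m P ζ = α * joukowski ζ ^ 2 + β * joukowski ζ + γ + h ζ) :
    HasExpansion B m P α β.re γ.re := by
  refine ⟨fun ζ => (h ζ + conj (h (conj ζ))) / 2, ?_, by simp [h2], fun ζ hζ h0 => ?_⟩
  · refine (h1.add fun ζ hζ => ?_).div_const 2
    have hc : conj ζ ∈ Metric.ball (0 : ℂ) 1 := by simpa using hζ
    exact ((h1.differentiableAt (Metric.isOpen_ball.mem_nhds hc)).conj_conj.differentiableWithinAt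
      (s := Metric.ball 0 1) |> fun H => by simpa [Function.comp_def] using H)
  · have hc : conj ζ ∈ Metric.ball (0 : ℂ) 1 := by simpa using hζ
    have e1 := h3 ζ hζ h0
    have e2 := congrArg conj (h3 (conj ζ) hc (by simpa using h0))
    rw [discFun_conj hB (by simpa using (mem_ball_zero_iff.1 hζ).le), Complex.conj_conj,
      joukowski_conj] at e2
    simp only [map_add, map_mul, map_pow, Complex.conj_conj, Complex.conj_ofReal] at e2
    have e3 : ∀ z : ℂ, (z.re : ℂ) = (z + conj z) / 2 := fun z => by
      rw [Complex.add_conj]; push_cast; ring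
    rw [e3, e3]
    linear_combination (e1 + e2) / 2

/-- The polynomial `(2 ζ)^d P((ζ + 1/ζ)/2)`. -/
def discNum (d : ℕ) (P : ℝ[X]) (ζ : ℂ) : ℂ :=
  ∑ i ∈ Finset.range (d + 1), P.coeff i * ((1 + ζ ^ 2) ^ i * (2 * ζ) ^ (d - i))

lemma discNum_eq {d : ℕ} (hP : P.natDegree ≤ d) {ζ : ℂ} (h0 : ζ ≠ 0) :
    discNum d P ζ = (2 * ζ) ^ d * P.aeval (joukowski ζ) := by
  rw [Polynomial.aeval_eq_sum_range' (Nat.lt_succ_of_le hP), Finset.mul_sum, discNum]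
  refine Finset.sum_congr rfl fun i hi => ?_
  have hi' : i ≤ d := Nat.lt_succ_iff.1 (Finset.mem_range.1 hi)
  rw [Complex.real_smul, ← Nat.sub_add_cancel hi', pow_add, Nat.add_sub_cancel]
  have : (2 * ζ) * joukowski ζ = 1 + ζ ^ 2 := by
    rw [joukowski]; field_simp; ring
  rw [← this, mul_pow]
  ring

lemma discNum_zero (d : ℕ) (P : ℝ[X]) : discNum d P 0 = P.coeff d := by
  rw [discNum, Finset.sum_range_succ, Finset.sum_eq_zero]
  · simp
  · intro i hi
    have : d - i ≠ 0 := by have := Finset.mem_range.1 hi; omega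
    simp [this]

lemma differentiable_discNum (d : ℕ) (P : ℝ[X]) : Differentiable ℂ (discNum d P) := by
  unfold discNum; fun_prop

lemma differentiableOn_inv_prod_discRoot (hB : ↑B ⊆ Icc (-1 : ℝ) 1) :
    DifferentiableOn ℂ (fun ζ => (1 - ζ ^ 2) / ∏ b ∈ B, discRoot b ζ) (Metric.ball 0 1) := by
  intro ζ hζ
  rw [mem_ball_zero_iff] at hζ
  refine DifferentiableAt.differentiableWithinAt (DifferentiableAt.div (by fun_prop) ?_ ?_)
  · exact DifferentiableAt.fun_finsetProd fun b hb => differentiableAt_discRoot (hB hb) hζ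
  · exact Finset.prod_ne_zero_iff.2 fun b hb => discRoot_ne_zero (hB hb) hζ

/-- A Laurent tail `4 ζ² f = α + ζ k(ζ)` is an expansion. -/
lemma hasExpansion_of_tail (hB : ↑B ⊆ Icc (-1 : ℝ) 1) {k : ℂ → ℂ}
    (hk : DifferentiableOn ℂ k (Metric.ball 0 1))
    (h : ∀ ζ ∈ Metric.ball (0 : ℂ) 1, ζ ≠ 0 → 4 * ζ ^ 2 * discFun B m P ζ = α + ζ * k ζ) :
    ∃ γ : ℝ, HasExpansion B m P α (k 0 / 2).re γ := by
  obtain ⟨g, hg, hkg⟩ := exists_eq_add_mul hk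
  obtain ⟨l, hl, hgl⟩ := exists_eq_add_mul hg
  -- Since αJ² = α(ζ^{-2} + 2 + ζ²)/4, the constant term loses α/2 and the remainder loses αζ²/4;
  -- with β = k(0)/2, the term βJ takes k(0)ζ/4 out of the remainder.
  refine ⟨((g 0 - 2 * α) / 4).re, hasExpansion_of_complex hB
    (h := fun ζ => ζ * (l ζ - α * ζ - k 0) / 4) ?_ (by simp) fun ζ hζ h0 => ?_⟩
  · fun_prop
  · have e := h ζ hζ h0
    rw [hkg, hgl] at e
    rw [joukowski]
    field_simp
    linear_combination 4 * e

/-- β is identified only when the top coefficient vanishes. Otherwise it also involves the points of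
B; `IsEndpoints.exists_isBalanced` removes it afterwards instead of computing it. -/
lemma exists_hasExpansion (hB : ↑B ⊆ Icc (-1 : ℝ) 1) (hP : P.natDegree ≤ m + 1) :
    ∃ β γ : ℝ, HasExpansion B m P (P.coeff (m + 1)) β γ ∧
      (P.coeff (m + 1) = 0 → β = P.coeff m) := by
  by_cases hc : P.coeff (m + 1) = 0
  · have hP' : P.natDegree ≤ m := by
      rcases hP.lt_or_eq with h | h
      · omega
      · rw [← h, Polynomial.coeff_natDegree, Polynomial.leadingCoeff_eq_zero] at hc
        simp [hc]
    obtain ⟨γ, hγ⟩ := hasExpansion_of_tail (m := m) (P := P) (α := 0) hB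
      (k := fun ζ => 2 * discNum m P ζ * ((1 - ζ ^ 2) / ∏ b ∈ B, discRoot b ζ))
      ((((differentiable_discNum m P).const_mul 2).differentiableOn).mul
        (differentiableOn_inv_prod_discRoot hB))
      (fun ζ hζ h0 => by
        rw [discFun, discNum_eq hP' h0]; push_cast; field_simp; ring)
    exact ⟨_, γ, hc ▸ hγ, fun _ => by simp [discNum_zero, discRoot_zero]⟩
  · set G : ℂ → ℂ := fun ζ => discNum (m + 1) P ζ * ((1 - ζ ^ 2) / ∏ b ∈ B, discRoot b ζ)
      with hG
    have hGd : DifferentiableOn ℂ G (Metric.ball 0 1) :=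
      ((differentiable_discNum _ P).differentiableOn).mul (differentiableOn_inv_prod_discRoot hB)
    have hG0 : G 0 = P.coeff (m + 1) := by simp [hG, discNum_zero, discRoot_zero]
    have hfG : ∀ ζ : ℂ, ζ ≠ 0 → 4 * ζ ^ 2 * discFun B m P ζ = G ζ := by
      intro ζ h0
      rw [discFun, hG]
      simp only
      rw [discNum_eq hP h0]; field_simp; ring
    obtain ⟨k, hk, hGk⟩ := exists_eq_add_mul hGd
    obtain ⟨γ, hγ⟩ := hasExpansion_of_tail (m := m) (P := P) (α := P.coeff (m + 1)) hB
      hk (fun ζ hζ h0 => by rw [hfG ζ h0, hGk, hG0])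
    exact ⟨_, γ, hγ, fun h => absurd h hc⟩

end expansion

section

/-! ### The sine kernel and Cauchy's formula on the disc -/

/-- The kernel `2 ζ sin φ / (1 - 2 ζ cos φ + ζ²) = 2 ∑ ζ^k sin (k φ)`. -/
def sineKernel (ζ : ℂ) (φ : ℝ) : ℂ :=
  2 * ζ * (Real.sin φ : ℝ) / (1 - 2 * ζ * (Real.cos φ : ℝ) + ζ ^ 2)

lemma sineKernel_denom (ζ : ℂ) (φ : ℝ) : 1 - 2 * ζ * (Real.cos φ : ℝ) + ζ ^ 2 =
    (1 - ζ * Complex.exp (φ * Complex.I)) * (1 - ζ * (Complex.exp (φ * Complex.I))⁻¹) := by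
  have h := exp_add_inv φ
  have h0 := Complex.exp_ne_zero (φ * Complex.I)
  linear_combination ζ * h - ζ ^ 2 * mul_inv_cancel₀ h0

lemma norm_exp_inv (φ : ℝ) : ‖(Complex.exp (φ * Complex.I))⁻¹‖ = 1 := by
  rw [norm_inv, Complex.norm_exp_ofReal_mul_I, inv_one]

lemma sineKernel_denom_ne_zero {ζ : ℂ} (hζ : ‖ζ‖ < 1) (φ : ℝ) :
    1 - 2 * ζ * (Real.cos φ : ℝ) + ζ ^ 2 ≠ 0 := by
  rw [sineKernel_denom]
  exact mul_ne_zero (one_sub_mul_ne_zero hζ (Complex.norm_exp_ofReal_mul_I φ).le)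
    (one_sub_mul_ne_zero hζ (norm_exp_inv φ).le)

lemma norm_sineKernel_le {ζ : ℂ} (hζ : ‖ζ‖ < 1) (φ : ℝ) :
    ‖sineKernel ζ φ‖ ≤ 2 / (1 - ‖ζ‖) ^ 2 := by
  have key : ∀ w : ℂ, ‖w‖ = 1 → 1 - ‖ζ‖ ≤ ‖1 - ζ * w‖ := by
    intro w hw
    have := norm_sub_norm_le (1 : ℂ) (ζ * w)
    rwa [norm_mul, hw, mul_one, norm_one] at this
  have h0 : 0 < 1 - ‖ζ‖ := by linarith
  rw [sineKernel, sineKernel_denom, norm_div, norm_mul (1 - _)]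
  have h1 := key _ (Complex.norm_exp_ofReal_mul_I φ)
  have h2 := key _ (norm_exp_inv φ)
  have h3 : ‖2 * ζ * (Real.sin φ : ℝ)‖ ≤ 2 := by
    rw [norm_mul, norm_mul, Complex.norm_real, Real.norm_eq_abs]
    have := Real.abs_sin_le_one φ
    have := abs_nonneg (Real.sin φ)
    simp only [Complex.norm_ofNat]
    nlinarith [norm_nonneg ζ]
  rw [sq]
  gcongr

lemma continuous_sineKernel {ζ : ℂ} (hζ : ‖ζ‖ < 1) : Continuous (sineKernel ζ) := by
  unfold sineKernel
  exact Continuous.div (by fun_prop) (by fun_prop) (sineKernel_denom_ne_zero hζ)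

lemma sineKernel_neg (ζ : ℂ) (φ : ℝ) : sineKernel ζ (-φ) = -sineKernel ζ φ := by
  simp [sineKernel, neg_div]

/-- On the circle (s - ζ)(1 - ζs) = s(1 - 2ζ cos φ + ζ²) and 1 - s² = -2i s sin φ. -/
lemma circle_integrand_eq {ζ s : ℂ} {φ : ℝ} (hs : s = Complex.exp (φ * Complex.I))
    (hζ : ‖ζ‖ < 1) (G : ℂ) :
    s * Complex.I * ((s - ζ)⁻¹ * (G * (ζ * (1 - s ^ 2) / (1 - ζ * s)))) =
      s * G * sineKernel ζ φ := by
  have hs0 : s ≠ 0 := hs ▸ Complex.exp_ne_zero _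
  have hd := sineKernel_denom ζ φ
  have hd0 := sineKernel_denom_ne_zero hζ φ
  rw [← hs] at hd
  have e1 : s * (1 - ζ * s⁻¹) = s - ζ := by field_simp
  have h1 : 1 - ζ * s ≠ 0 := by
    intro h; rw [hd, h] at hd0; simp at hd0
  have h2 : s - ζ ≠ 0 := by
    intro h; rw [← e1, mul_eq_zero] at h
    rw [hd, h.resolve_left hs0] at hd0; simp at hd0
  have hsin := exp_sub_inv φ
  rw [← hs] at hsin
  have hsin' : 1 - s ^ 2 = -(2 * Complex.I * (Real.sin φ : ℝ)) * s := by
    rw [← hsin]; field_simp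
  have hd' : (s - ζ) * (1 - ζ * s) = s * (1 - 2 * ζ * (Real.cos φ : ℝ) + ζ ^ 2) := by
    rw [hd, ← e1]; ring
  have : (s - ζ)⁻¹ * (G * (ζ * (1 - s ^ 2) / (1 - ζ * s))) =
      G * ζ * (1 - s ^ 2) / ((s - ζ) * (1 - ζ * s)) := by field_simp
  rw [this, hd', hsin', sineKernel]
  generalize 1 - 2 * ζ * (Real.cos φ : ℝ) + ζ ^ 2 = D at hd0
  have e2 : s * Complex.I * (G * ζ * (-(2 * Complex.I * (Real.sin φ : ℝ)) * s) / (s * D)) =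
      s * G * (2 * ζ * (Real.sin φ : ℝ) / D) * -(Complex.I ^ 2) := by
    field_simp
  rw [e2, Complex.I_sq]
  ring

/-- Cauchy's formula for a holomorphic function with real Taylor coefficients. -/
lemma cauchy_sineKernel {h : ℂ → ℂ} (hd : DifferentiableOn ℂ h (Metric.ball 0 1)) (h0 : h 0 = 0)
    (hc : ∀ ζ ∈ Metric.ball (0 : ℂ) 1, h (conj ζ) = conj (h ζ)) {r : ℝ} (hr : r ∈ Ioo (0 : ℝ) 1)
    {ζ : ℂ} (hζ : ‖ζ‖ < 1) :
    Real.pi * h (r * ζ) = ∫ φ in (0 : ℝ)..Real.pi,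
      ((h (r * Complex.exp (φ * Complex.I))).im : ℂ) * sineKernel ζ φ := by
  obtain ⟨g, hg, hgh⟩ := exists_eq_add_mul hd
  have hmem : ∀ s : ℂ, ‖s‖ ≤ 1 → (r : ℂ) * s ∈ Metric.ball (0 : ℂ) 1 := by
    intro s hs
    rw [mem_ball_zero_iff, norm_mul, Complex.norm_real, Real.norm_of_nonneg hr.1.le]
    nlinarith [hr.1, hr.2, norm_nonneg s]
  -- The extra factor ζ(1 - s²)/(1 - ζs) equals ζ at s = ζ, so Cauchy's formula still returns h(rζ).
  -- On the circle it turns the Cauchy kernel into the sine kernel, which is odd in φ.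
  set H : ℂ → ℂ := fun s => (r * g (r * s)) * (ζ * (1 - s ^ 2) / (1 - ζ * s)) with hH
  have hHd : ∀ s : ℂ, ‖s‖ ≤ 1 → DifferentiableAt ℂ H s := by
    intro s hs
    have h1 : DifferentiableAt ℂ g (r * s) :=
      hg.differentiableAt (Metric.isOpen_ball.mem_nhds (hmem s hs))
    have h2 : DifferentiableAt ℂ (fun s => g (r * s)) s :=
      DifferentiableAt.comp (g := g) s h1 (by fun_prop)
    have h3 := one_sub_mul_ne_zero hζ hs
    refine DifferentiableAt.mul (h2.const_mul _) (DifferentiableAt.div (by fun_prop) (by fun_prop) h3)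
  have hcl : DiffContOnCl ℂ H (Metric.ball 0 1) := by
    refine DifferentiableOn.diffContOnCl fun s hs => ?_
    rw [closure_ball _ one_ne_zero] at hs
    exact (hHd s (by simpa using hs)).differentiableWithinAt
  have hC := hcl.circleIntegral_sub_inv_smul (w := ζ) (by simpa using hζ)
  have hHζ : H ζ = h (r * ζ) := by
    have : 1 - ζ * ζ ≠ 0 := one_sub_mul_ne_zero hζ hζ.le
    rw [hH]; simp only
    rw [hgh, h0, show ζ * (1 - ζ ^ 2) / (1 - ζ * ζ) = ζ by
      rw [sq, mul_div_cancel_right₀ _ this]]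
    ring
  set F : ℝ → ℂ := fun φ => h (r * Complex.exp (φ * Complex.I)) * sineKernel ζ φ with hF
  have hexp : ∀ φ : ℝ, (r : ℂ) * Complex.exp (φ * Complex.I) ∈ Metric.ball (0 : ℂ) 1 :=
    fun φ => hmem _ (Complex.norm_exp_ofReal_mul_I φ).le
  have hhc : Continuous fun φ : ℝ => h (r * Complex.exp (φ * Complex.I)) := by
    rw [continuous_iff_continuousAt]
    intro φ
    exact ContinuousAt.comp (g := h)
      (hd.differentiableAt (Metric.isOpen_ball.mem_nhds (hexp φ))).continuousAt (by fun_prop)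
  have hFc : Continuous F := hhc.mul (continuous_sineKernel hζ)
  have hint : (∮ s in C(0, 1), (s - ζ)⁻¹ • H s) = ∫ φ in (0 : ℝ)..2 * Real.pi, F φ := by
    rw [circleIntegral]
    refine intervalIntegral.integral_congr fun φ _ => ?_
    simp only [deriv_circleMap, smul_eq_mul, hH, hF]
    rw [show circleMap 0 1 φ = Complex.exp (φ * Complex.I) by simp [circleMap],
      circle_integrand_eq rfl hζ, hgh (r * Complex.exp (φ * Complex.I)), h0]
    ring
  have hper : Function.Periodic F (2 * Real.pi) := by
    intro φ
    have : Complex.exp (((φ + 2 * Real.pi : ℝ) : ℂ) * Complex.I) = Complex.exp (φ * Complex.I) := by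
      push_cast
      rw [add_mul, Complex.exp_add, Complex.exp_two_pi_mul_I, mul_one]
    simp only [hF, this, sineKernel, Real.sin_add_two_pi, Real.cos_add_two_pi]
  have hsplit : (∫ φ in (0 : ℝ)..2 * Real.pi, F φ) = ∫ φ in (0 : ℝ)..Real.pi, (F φ + F (-φ)) := by
    have e1 := hper.intervalIntegral_add_eq 0 (-Real.pi)
    rw [zero_add, show -Real.pi + 2 * Real.pi = Real.pi by ring] at e1
    have hFn : IntervalIntegrable (fun φ => F (-φ)) volume 0 Real.pi :=
      (hFc.comp continuous_neg).intervalIntegrable _ _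
    rw [e1, intervalIntegral.integral_add (hFc.intervalIntegrable _ _) hFn, intervalIntegral.integral_comp_neg,
      neg_zero, add_comm, intervalIntegral.integral_add_adjacent_intervals
        (hFc.intervalIntegrable _ _) (hFc.intervalIntegrable _ _)]
  -- Under φ ↦ -φ the function h is conjugated and the kernel changes sign, so only Im h survives
  -- the folding.
  have hpt : ∀ φ : ℝ, F φ + F (-φ) = 2 * Complex.I *
      (((h (r * Complex.exp (φ * Complex.I))).im : ℂ) * sineKernel ζ φ) := by
    intro φ
    have e1 : (r : ℂ) * Complex.exp ((-φ : ℝ) * Complex.I) =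
        conj ((r : ℂ) * Complex.exp (φ * Complex.I)) := by
      rw [map_mul, Complex.conj_ofReal, ← Complex.exp_conj]
      simp
    simp only [hF]
    rw [e1, hc _ (hexp φ), sineKernel_neg]
    have := Complex.sub_conj (h (r * Complex.exp (φ * Complex.I)))
    push_cast at this
    linear_combination sineKernel ζ φ * this
  rw [hint, hsplit, hHζ] at hC
  simp_rw [hpt] at hC
  rw [intervalIntegral.integral_const_mul, smul_eq_mul] at hC
  have h2i : (2 * Complex.I : ℂ) ≠ 0 := by simp
  apply mul_left_cancel₀ h2i
  rw [hC]
  ring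

/-! ### The substitution `x = cos φ` -/

lemma cos_image_Ioo {θ : ℝ} (h0 : 0 ≤ θ) (hθ : θ ≤ Real.pi) :
    Real.cos '' Ioo 0 θ = Ioo (Real.cos θ) 1 := by
  ext x
  constructor
  · rintro ⟨φ, hφ, rfl⟩
    constructor
    · exact Real.cos_lt_cos_of_nonneg_of_le_pi hφ.1.le hθ hφ.2
    · have := Real.cos_lt_cos_of_nonneg_of_le_pi le_rfl (hφ.2.le.trans hθ) hφ.1
      rwa [Real.cos_zero] at this
  · intro hx
    have hx1 : -1 ≤ x := (Real.neg_one_le_cos θ).trans hx.1.le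
    refine ⟨Real.arccos x, ⟨Real.arccos_pos.2 hx.2, ?_⟩, Real.cos_arccos hx1 hx.2.le⟩
    rw [← Real.arccos_cos h0 hθ]
    exact Real.arccos_lt_arccos (Real.neg_one_le_cos θ) hx.1 hx.2.le

lemma injOn_cos_Ioo {θ : ℝ} (hθ : θ ≤ Real.pi) : InjOn Real.cos (Ioo 0 θ) :=
  Real.injOn_cos.mono (Ioo_subset_Icc_self.trans (Icc_subset_Icc le_rfl hθ))

lemma abs_neg_sin_of_mem {θ φ : ℝ} (hθ : θ ≤ Real.pi) (hφ : φ ∈ Ioo 0 θ) :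
    |-Real.sin φ| = Real.sin φ := by
  rw [abs_neg, abs_of_pos (Real.sin_pos_of_pos_of_lt_pi hφ.1 (hφ.2.trans_le hθ))]

variable {E : Type*} [NormedAddCommGroup E] [NormedSpace ℝ E]

lemma integral_comp_cos {θ : ℝ} (h0 : 0 ≤ θ) (hθ : θ ≤ Real.pi) (g : ℝ → E) :
    ∫ φ in Ioo 0 θ, Real.sin φ • g (Real.cos φ) = ∫ x in Ioo (Real.cos θ) 1, g x := by
  rw [← cos_image_Ioo h0 hθ, integral_image_eq_integral_abs_deriv_smul measurableSet_Ioo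
    (fun φ _ => (Real.hasDerivAt_cos φ).hasDerivWithinAt) (injOn_cos_Ioo hθ)]
  refine setIntegral_congr_fun measurableSet_Ioo fun φ hφ => ?_
  simp only [abs_neg_sin_of_mem hθ hφ]

lemma integrableOn_comp_cos {θ : ℝ} (h0 : 0 ≤ θ) (hθ : θ ≤ Real.pi) (g : ℝ → E) :
    IntegrableOn (fun φ => Real.sin φ • g (Real.cos φ)) (Ioo 0 θ) ↔
      IntegrableOn g (Ioo (Real.cos θ) 1) := by
  rw [← cos_image_Ioo h0 hθ, integrableOn_image_iff_integrableOn_abs_deriv_smul measurableSet_Ioo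
    (fun φ _ => (Real.hasDerivAt_cos φ).hasDerivWithinAt) (injOn_cos_Ioo hθ)]
  refine integrableOn_congr_fun (fun φ hφ => ?_) measurableSet_Ioo
  simp only [abs_neg_sin_of_mem hθ hφ]

lemma ae_cos_notMem (B : Finset ℝ) {θ : ℝ} (hθ : θ ≤ Real.pi) :
    ∀ᵐ φ ∂volume.restrict (Ioo 0 θ), Real.cos φ ∉ B := by
  have : {φ | φ ∈ Ioo 0 θ ∧ Real.cos φ ∈ B}.Finite :=
    Set.Finite.of_finite_image (f := Real.cos)
      (B.finite_toSet.subset (by rintro _ ⟨φ, hφ, rfl⟩; exact hφ.2))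
      ((injOn_cos_Ioo hθ).mono fun φ hφ => hφ.1)
  rw [ae_restrict_iff' measurableSet_Ioo, ae_iff]
  convert this.measure_zero volume using 2
  ext φ
  simp [and_assoc]

end

section

/-! ### Boundary values -/

/-- The function `P / ∏_{b ∈ B} (x - b)^{1/2}` on the real line. -/
def rootQuot (B : Finset ℝ) (P : ℝ[X]) (x : ℝ) : ℂ := (P.eval x : ℝ) / rootProd B x

lemma measurable_rootQuot (B : Finset ℝ) (P : ℝ[X]) : Measurable (rootQuot B P) := by
  unfold rootQuot
  exact (Complex.measurable_ofReal.comp P.continuous.measurable).div (measurable_rootProd B)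

lemma norm_joukowski_le {ζ : ℂ} (h1 : 1 / 2 ≤ ‖ζ‖) (h2 : ‖ζ‖ ≤ 1) : ‖joukowski ζ‖ ≤ 2 := by
  have h3 : ‖ζ⁻¹‖ ≤ 2 := by
    rw [norm_inv]
    exact inv_le_of_inv_le₀ two_pos (by linarith)
  rw [joukowski, norm_div]
  have := norm_add_le ζ ζ⁻¹
  simp only [Complex.norm_ofNat]
  linarith

lemma norm_ofReal_mul_exp {r : ℝ} (hr : 0 ≤ r) (φ : ℝ) :
    ‖(r : ℂ) * Complex.exp (φ * Complex.I)‖ = r := by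
  rw [norm_mul, Complex.norm_exp_ofReal_mul_I, Complex.norm_real, Real.norm_of_nonneg hr, mul_one]

variable {B : Finset ℝ} {m : ℕ} {P : ℝ[X]} {α β γ : ℝ}

lemma subset_union_pm (hB : ↑B ⊆ Icc (-1 : ℝ) 1) : ↑(B ∪ {1, -1}) ⊆ Icc (-1 : ℝ) 1 := by
  intro b hb
  simp only [Finset.coe_union, Finset.coe_insert, Finset.coe_singleton, mem_union,
    mem_insert_iff, mem_singleton_iff] at hb
  rcases hb with hb | rfl | rfl
  · exact hB hb
  · norm_num
  · norm_num

/-- The case r = 1 of `exists_norm_discFun_le`, with sin φ cancelled. -/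
lemma exists_norm_rootQuot_le (hB : ↑B ⊆ Icc (-1 : ℝ) 1) (hm : B.card = 2 * m) (P : ℝ[X]) :
    ∃ C, 0 ≤ C ∧ ∀ x ∈ Ioo (-1 : ℝ) 1, x ∉ B →
      ‖rootQuot B P x‖ ≤ C * weight (B ∪ {1, -1}) x := by
  obtain ⟨C, hC, h⟩ := exists_norm_discFun_le hB m P
  refine ⟨C, hC, fun x hx hxB => ?_⟩
  obtain ⟨φ, hφ, rfl⟩ : x ∈ Real.cos '' Ioo 0 Real.pi := by
    rw [cos_image_Ioo Real.pi_pos.le le_rfl, Real.cos_pi]; exact hx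
  have := h 1 (by norm_num) φ hφ hxB
  have hs := Real.sin_pos_of_mem_Ioo hφ
  rw [Complex.ofReal_one, one_mul, discFun_exp hB hm hφ, norm_mul, norm_mul, norm_neg,
    Complex.norm_I, one_mul, Complex.norm_real, Real.norm_of_nonneg hs.le, RCLike.norm_conj] at this
  rw [rootQuot]
  nlinarith

lemma integrableOn_rootQuot (hB : ↑B ⊆ Icc (-1 : ℝ) 1) (hm : B.card = 2 * m) (P : ℝ[X]) :
    IntegrableOn (rootQuot B P) (Ioo (-1) 1) := by
  obtain ⟨C, hC, h⟩ := exists_norm_rootQuot_le hB hm P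
  refine Integrable.mono' (((integrableOn_weight (subset_union_pm hB)).mono_set
    Ioo_subset_Icc_self).const_mul C) (measurable_rootQuot B P).aestronglyMeasurable ?_
  filter_upwards [finset_ae_notMem B _, ae_restrict_mem measurableSet_Ioo] with x h1 h2
  exact h x h2 h1

/-- The boundary values of the imaginary part of `discFun` on the upper half circle. -/
def boundaryIm (B : Finset ℝ) (P : ℝ[X]) (φ : ℝ) : ℝ :=
  -(Real.sin φ * (rootQuot B P (Real.cos φ)).re)

lemma measurable_boundaryIm (B : Finset ℝ) (P : ℝ[X]) : Measurable (boundaryIm B P) := by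
  unfold boundaryIm
  exact (Real.measurable_sin.mul (Complex.measurable_re.comp
    ((measurable_rootQuot B P).comp Real.measurable_cos))).neg

lemma integrableOn_boundaryIm (hB : ↑B ⊆ Icc (-1 : ℝ) 1) (hm : B.card = 2 * m) (P : ℝ[X]) :
    IntegrableOn (boundaryIm B P) (Ioo 0 Real.pi) := by
  have h : IntegrableOn (fun x => (rootQuot B P x).re) (Ioo (Real.cos Real.pi) 1) := by
    rw [Real.cos_pi]
    exact (integrableOn_rootQuot hB hm P).re
  exact ((integrableOn_comp_cos Real.pi_pos.le le_rfl _).2 h).neg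

/-- The data of an expansion: the holomorphic remainder `h`, its boundary values and a bound. -/
structure IsRemainder (B : Finset ℝ) (P : ℝ[X]) (α β γ : ℝ) (h : ℂ → ℂ) : Prop where
  diff : DifferentiableOn ℂ h (Metric.ball 0 1)
  zero : h 0 = 0
  map_conj : ∀ ζ ∈ Metric.ball (0 : ℂ) 1, h (conj ζ) = conj (h ζ)
  bound : ∃ C, 0 ≤ C ∧ ∀ r ∈ Ioo (1 / 2 : ℝ) 1, ∀ φ ∈ Ioo 0 Real.pi, Real.cos φ ∉ B →
    ‖h (r * Complex.exp (φ * Complex.I))‖ ≤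
      C * (1 + Real.sin φ * weight (B ∪ {1, -1}) (Real.cos φ))
  tendsto : ∀ φ ∈ Ioo 0 Real.pi, Real.cos φ ∉ B →
    Tendsto (fun r : ℝ => h (r * Complex.exp (φ * Complex.I))) (𝓝[<] 1)
      (𝓝 (conj (rootQuot B P (Real.cos φ)) * (-Complex.I * (Real.sin φ : ℝ)) -
        (α * (Real.cos φ : ℝ) ^ 2 + β * (Real.cos φ : ℝ) + γ)))

lemma eventually_mem_Ioo_half : ∀ᶠ r : ℝ in 𝓝[<] 1, r ∈ Ioo (1 / 2 : ℝ) 1 :=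
  Ioo_mem_nhdsLT (by norm_num)

lemma HasExpansion.exists_isRemainder (hB : ↑B ⊆ Icc (-1 : ℝ) 1) (hm : B.card = 2 * m)
    (hP : HasExpansion B m P α β γ) : ∃ h, IsRemainder B P α β γ h := by
  obtain ⟨h, h1, h2, h3⟩ := hP
  have hmem : ∀ r ∈ Ioo (1 / 2 : ℝ) 1, ∀ φ : ℝ,
      (r : ℂ) * Complex.exp (φ * Complex.I) ∈ Metric.ball (0 : ℂ) 1 := fun r hr φ => by
    rw [mem_ball_zero_iff, norm_ofReal_mul_exp (by linarith [hr.1])]; exact hr.2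
  have hne : ∀ r ∈ Ioo (1 / 2 : ℝ) 1, ∀ φ : ℝ, (r : ℂ) * Complex.exp (φ * Complex.I) ≠ 0 :=
    fun r hr φ => by
      rw [← norm_ne_zero_iff, norm_ofReal_mul_exp (by linarith [hr.1])]; linarith [hr.1]
  refine ⟨h, h1, h2, fun ζ hζ => ?_, ?_, fun φ hφ hφB => ?_⟩
  · rcases eq_or_ne ζ 0 with rfl | h0
    · simp [h2]
    · have e1 := h3 ζ hζ h0
      have e2 := h3 (conj ζ) (by simpa using hζ) (by simpa using h0)
      rw [discFun_conj hB (mem_ball_zero_iff.1 hζ).le, e1, joukowski_conj] at e2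
      simp only [map_add, map_mul, map_pow, Complex.conj_ofReal] at e2
      linear_combination -e2
  · obtain ⟨C, hC, hb⟩ := exists_norm_discFun_le hB m P
    -- The polynomial part is bounded through |J| ≤ 2, valid for 1/2 ≤ |ζ| ≤ 1; this is why r is
    -- kept above 1/2 throughout.
    refine ⟨C + (|α| * 4 + |β| * 2 + |γ|), by positivity, fun r hr φ hφ hφB => ?_⟩
    have hw := mul_nonneg (Real.sin_pos_of_mem_Ioo hφ).le (weight_nonneg (B ∪ {1, -1}) (Real.cos φ))
    have hf := hb r ⟨hr.1.le, hr.2.le⟩ φ hφ hφB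
    set ζ : ℂ := r * Complex.exp (φ * Complex.I) with hζ
    have hJ : ‖joukowski ζ‖ ≤ 2 := norm_joukowski_le
      (by rw [hζ, norm_ofReal_mul_exp (by linarith [hr.1])]; exact hr.1.le)
      (mem_ball_zero_iff.1 (hmem r hr φ)).le
    have e := h3 ζ (hmem r hr φ) (hne r hr φ)
    have e' : h ζ = discFun B m P ζ - (α * joukowski ζ ^ 2 + β * joukowski ζ + γ) := by
      rw [e]; ring
    have h4 : ‖(α : ℂ) * joukowski ζ ^ 2 + β * joukowski ζ + γ‖ ≤ |α| * 4 + |β| * 2 + |γ| := by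
      refine (norm_add_le _ _).trans (add_le_add ((norm_add_le _ _).trans (add_le_add ?_ ?_)) ?_)
      · rw [norm_mul, norm_pow, Complex.norm_real, Real.norm_eq_abs]
        gcongr
        nlinarith [norm_nonneg (joukowski ζ)]
      · rw [norm_mul, Complex.norm_real, Real.norm_eq_abs]
        gcongr
      · rw [Complex.norm_real, Real.norm_eq_abs]
    rw [e']
    refine (norm_sub_le _ _).trans ((add_le_add hf h4).trans ?_)
    have : 0 ≤ |α| * 4 + |β| * 2 + |γ| := by positivity
    nlinarith [mul_nonneg this hw]
  · set e := Complex.exp (φ * Complex.I) with he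
    have hc1 : ContinuousAt (discFun B m P) e := continuousAt_discFun hB (Complex.exp_ne_zero _)
      (Complex.norm_exp_ofReal_mul_I φ).le
      fun b hb => discRoot_exp_ne_zero (hB hb) fun h => hφB (h ▸ hb)
    have hc2 := continuousAt_joukowski (Complex.exp_ne_zero (φ * Complex.I))
    have hc : ContinuousAt (fun ζ => discFun B m P ζ -
        (α * joukowski ζ ^ 2 + β * joukowski ζ + γ)) e := by
      refine hc1.sub ?_
      exact (((hc2.pow 2).const_mul _).add (hc2.const_mul _)).add continuousAt_const
    have ht : Tendsto (fun r : ℝ => (r : ℂ) * e) (𝓝[<] 1) (𝓝 e) := by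
      have : Continuous fun r : ℝ => (r : ℂ) * e := by fun_prop
      have := this.tendsto 1
      simp only [Complex.ofReal_one, one_mul] at this
      exact this.mono_left nhdsWithin_le_nhds
    have := hc.tendsto.comp ht
    rw [he, discFun_exp hB hm hφ, joukowski_exp] at this
    refine this.congr' ?_
    filter_upwards [eventually_mem_Ioo_half] with r hr
    simp only [Function.comp]
    rw [h3 _ (hmem r hr φ) (hne r hr φ)]
    ring

lemma integrableOn_one_add_sin_mul_weight (hB : ↑B ⊆ Icc (-1 : ℝ) 1) {θ : ℝ} (hθ : θ ≤ Real.pi) :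
    IntegrableOn (fun φ => 1 + Real.sin φ * weight (B ∪ {1, -1}) (Real.cos φ)) (Ioo 0 θ) := by
  have h : IntegrableOn (weight (B ∪ {1, -1})) (Ioo (Real.cos Real.pi) 1) := by
    rw [Real.cos_pi]
    exact (integrableOn_weight (subset_union_pm hB)).mono_set Ioo_subset_Icc_self
  have := (integrableOn_comp_cos Real.pi_pos.le le_rfl _).2 h
  refine IntegrableOn.mono_set ?_ (Ioo_subset_Ioo_right hθ)
  exact (integrableOn_const (by simp)).add this

lemma IsRemainder.continuous_circle {h : ℂ → ℂ} (H : IsRemainder B P α β γ h) {r : ℝ}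
    (hr : r ∈ Ioo (0 : ℝ) 1) : Continuous fun φ : ℝ => h (r * Complex.exp (φ * Complex.I)) := by
  rw [continuous_iff_continuousAt]
  intro φ
  have hm : (r : ℂ) * Complex.exp (φ * Complex.I) ∈ Metric.ball (0 : ℂ) 1 := by
    rw [mem_ball_zero_iff, norm_ofReal_mul_exp hr.1.le]; exact hr.2
  exact ContinuousAt.comp (g := h)
    (H.diff.differentiableAt (Metric.isOpen_ball.mem_nhds hm)).continuousAt (by fun_prop)

lemma IsRemainder.tendsto_im {h : ℂ → ℂ} (H : IsRemainder B P α β γ h) {φ : ℝ}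
    (hφ : φ ∈ Ioo 0 Real.pi) (hφB : Real.cos φ ∉ B) :
    Tendsto (fun r : ℝ => (h (r * Complex.exp (φ * Complex.I))).im) (𝓝[<] 1)
      (𝓝 (boundaryIm B P φ)) := by
  have := (Complex.continuous_im.tendsto _).comp (H.tendsto φ hφ hφB)
  have e : (α * (Real.cos φ : ℝ) ^ 2 + β * (Real.cos φ : ℝ) + γ : ℂ) =
    ((α * Real.cos φ ^ 2 + β * Real.cos φ + γ : ℝ) : ℂ) := by push_cast; rfl
  rw [e, Complex.sub_im, Complex.ofReal_im, Complex.mul_im, Complex.re_mul_ofReal,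
    Complex.im_mul_ofReal] at this
  convert this using 2 <;> simp [boundaryIm, mul_comm]

lemma IsRemainder.tendsto_re {h : ℂ → ℂ} (H : IsRemainder B P α β γ h) {φ : ℝ}
    (hφ : φ ∈ Ioo 0 Real.pi) (hφB : Real.cos φ ∉ B) :
    Tendsto (fun r : ℝ => (h (r * Complex.exp (φ * Complex.I))).re) (𝓝[<] 1)
      (𝓝 (-(Real.sin φ * (rootQuot B P (Real.cos φ)).im) -
        (α * Real.cos φ ^ 2 + β * Real.cos φ + γ))) := by
  have := (Complex.continuous_re.tendsto _).comp (H.tendsto φ hφ hφB)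
  have e : (α * (Real.cos φ : ℝ) ^ 2 + β * (Real.cos φ : ℝ) + γ : ℂ) =
    ((α * Real.cos φ ^ 2 + β * Real.cos φ + γ : ℝ) : ℂ) := by push_cast; rfl
  rw [e, Complex.sub_re, Complex.ofReal_re, Complex.mul_re, Complex.re_mul_ofReal,
    Complex.im_mul_ofReal] at this
  convert this using 2 <;> simp [mul_comm]

/-- Recovery of the remainder from the boundary values of its imaginary part. -/
lemma IsRemainder.eq_integral (hB : ↑B ⊆ Icc (-1 : ℝ) 1) {h : ℂ → ℂ}
    (H : IsRemainder B P α β γ h) {ζ : ℂ} (hζ : ‖ζ‖ < 1) :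
    Real.pi * h ζ = ∫ φ in Ioo 0 Real.pi, (boundaryIm B P φ : ℂ) * sineKernel ζ φ := by
  have h1 : Tendsto (fun r : ℝ => Real.pi * h (r * ζ)) (𝓝[<] 1) (𝓝 (Real.pi * h ζ)) := by
    refine Tendsto.const_mul _ ?_
    have hc := (H.diff.differentiableAt
      (Metric.isOpen_ball.mem_nhds (mem_ball_zero_iff.2 hζ))).continuousAt
    have : Continuous fun r : ℝ => (r : ℂ) * ζ := by fun_prop
    have := this.tendsto 1
    simp only [Complex.ofReal_one, one_mul] at this
    exact hc.tendsto.comp (this.mono_left nhdsWithin_le_nhds)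
  refine tendsto_nhds_unique h1 ?_
  have h2 : (fun r : ℝ => ∫ φ in Ioo 0 Real.pi,
      ((h (r * Complex.exp (φ * Complex.I))).im : ℂ) * sineKernel ζ φ) =ᶠ[𝓝[<] 1]
      fun r : ℝ => Real.pi * h (r * ζ) := by
    filter_upwards [eventually_mem_Ioo_half] with r hr
    rw [cauchy_sineKernel H.diff H.zero H.map_conj ⟨by linarith [hr.1], hr.2⟩ hζ,
      intervalIntegral.integral_of_le Real.pi_pos.le, integral_Ioc_eq_integral_Ioo]
  refine Tendsto.congr' h2 ?_
  obtain ⟨C, hC, hb⟩ := H.bound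
  refine tendsto_integral_filter_of_dominated_convergence
    (fun φ => C * (1 + Real.sin φ * weight (B ∪ {1, -1}) (Real.cos φ)) * (2 / (1 - ‖ζ‖) ^ 2))
    ?_ ?_ ?_ ?_
  · filter_upwards [eventually_mem_Ioo_half] with r hr
    have := H.continuous_circle (r := r) ⟨by linarith [hr.1], hr.2⟩
    exact ((Complex.continuous_ofReal.comp (Complex.continuous_im.comp this)).mul
      (continuous_sineKernel hζ)).aestronglyMeasurable
  · filter_upwards [eventually_mem_Ioo_half] with r hr
    filter_upwards [ae_cos_notMem B le_rfl, ae_restrict_mem measurableSet_Ioo] with φ h3 h4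
    rw [norm_mul, Complex.norm_real, Real.norm_eq_abs]
    exact mul_le_mul ((Complex.abs_im_le_norm _).trans (hb r hr φ h4 h3)) (norm_sineKernel_le hζ φ)
      (norm_nonneg _) ((norm_nonneg _).trans (hb r hr φ h4 h3))
  · exact ((integrableOn_one_add_sin_mul_weight hB le_rfl).const_mul C).mul_const _
  · filter_upwards [ae_cos_notMem B le_rfl, ae_restrict_mem measurableSet_Ioo] with φ h3 h4
    exact ((Complex.continuous_ofReal.tendsto _).comp (H.tendsto_im h4 h3)).mul_const _

end

section

/-! ### The Abel regularization of the kernel -/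

/-- `1 - 2 r cos s + r² = |1 - r e^{is}|²`. -/
def abelDenom (r s : ℝ) : ℝ := 1 - 2 * r * Real.cos s + r ^ 2

/-- `∑ (2/k) r^k sin (k θ) sin (k φ)`, which is the kernel for `r = 1`. -/
def abelKernel (r θ φ : ℝ) : ℝ :=
  (Real.log (abelDenom r (θ + φ)) - Real.log (abelDenom r (θ - φ))) / 2

lemma abelDenom_ge {r : ℝ} (hr : 0 ≤ r) (s : ℝ) : (1 - r) ^ 2 ≤ abelDenom r s := by
  rw [abelDenom]
  nlinarith [Real.cos_le_one s]

lemma abelDenom_pos {r : ℝ} (hr : r ∈ Ico (0 : ℝ) 1) (s : ℝ) : 0 < abelDenom r s :=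
  lt_of_lt_of_le (by have := hr.2; have : 0 < 1 - r := by linarith
                     positivity) (abelDenom_ge hr.1 s)

lemma abelKernel_zero_left (r φ : ℝ) : abelKernel r 0 φ = 0 := by
  simp [abelKernel, abelDenom]

/-- With A = 1 - cos(θ+φ) and D = 1 - cos(θ-φ) one has AD = (cos θ - cos φ)², so the argument of the
logarithm is √(A/D). -/
lemma kernel_cos {θ φ : ℝ} (hθ : θ ∈ Icc 0 Real.pi) (hφ : φ ∈ Icc 0 Real.pi) (hne : θ ≠ φ) :
    kernel (Real.cos θ) (Real.cos φ) = abelKernel 1 θ φ := by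
  have hsin : ∀ t ∈ Icc 0 Real.pi, √(1 - Real.cos t ^ 2) = Real.sin t := fun t ht => by
    rw [← Real.sin_sq, Real.sqrt_sq (Real.sin_nonneg_of_mem_Icc ht)]
  have hcne : Real.cos θ - Real.cos φ ≠ 0 := sub_ne_zero.2 fun h => hne (Real.injOn_cos hθ hφ h)
  rw [kernel_eq ⟨Real.neg_one_le_cos _, Real.cos_le_one _⟩
    ⟨Real.neg_one_le_cos _, Real.cos_le_one _⟩, hsin θ hθ, hsin φ hφ, abelKernel, abelDenom,
    abelDenom, Real.cos_add, Real.cos_sub]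
  set A := 1 - Real.cos θ * Real.cos φ + Real.sin θ * Real.sin φ with hA
  set D := 1 - Real.cos θ * Real.cos φ - Real.sin θ * Real.sin φ with hD
  have hAD : A * D = |Real.cos θ - Real.cos φ| ^ 2 := by
    rw [sq_abs, hA, hD]
    have h1 := Real.sin_sq_add_cos_sq θ
    have h2 := Real.sin_sq_add_cos_sq φ
    linear_combination (-Real.sin φ ^ 2) * h1 + (Real.cos θ ^ 2 - 1) * h2
  have hpos : 0 < |Real.cos θ - Real.cos φ| := abs_pos.2 hcne
  have hAD0 : A * D ≠ 0 := by rw [hAD]; positivity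
  have hA0 : A ≠ 0 := left_ne_zero_of_mul hAD0
  have hD0 : D ≠ 0 := right_ne_zero_of_mul hAD0
  have h3 : Real.log A + Real.log D = 2 * Real.log |Real.cos θ - Real.cos φ| := by
    rw [← Real.log_mul hA0 hD0, hAD, Real.log_pow]; norm_num
  rw [show 1 - 2 * 1 * (Real.cos θ * Real.cos φ - Real.sin θ * Real.sin φ) + 1 ^ 2 = 2 * A by
    rw [hA]; ring, show 1 - 2 * 1 * (Real.cos θ * Real.cos φ + Real.sin θ * Real.sin φ) + 1 ^ 2 =
    2 * D by rw [hD]; ring, Real.log_mul two_ne_zero hA0, Real.log_mul two_ne_zero hD0,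
    Real.log_div hA0 hpos.ne']
  linarith

lemma abelDenom_one_pos {θ φ : ℝ} (hθ : θ ∈ Icc 0 Real.pi) (hφ : φ ∈ Icc 0 Real.pi) (hne : θ ≠ φ) :
    0 < abelDenom 1 (θ + φ) ∧ 0 < abelDenom 1 (θ - φ) := by
  have key : ∀ s : ℝ, -(2 * Real.pi) < s → s < 2 * Real.pi → s ≠ 0 → 0 < abelDenom 1 s := by
    intro s h1 h2 h0
    have : Real.cos s ≠ 1 := fun h => h0 ((Real.cos_eq_one_iff_of_lt_of_lt h1 h2).1 h)
    have := lt_of_le_of_ne (Real.cos_le_one s) this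
    rw [abelDenom]; linarith
  obtain ⟨h1, h2⟩ := hθ
  obtain ⟨h3, h4⟩ := hφ
  have hpi := Real.pi_pos
  constructor
  · refine key _ (by linarith) ?_ ?_
    · rcases hne.lt_or_gt with h | h <;> linarith
    · rcases hne.lt_or_gt with h | h <;> intro h' <;> linarith
  · refine key _ ?_ ?_ (sub_ne_zero.2 hne) <;> linarith

lemma cos_add_le_cos_sub {θ φ : ℝ} (hθ : θ ∈ Icc 0 Real.pi) (hφ : φ ∈ Icc 0 Real.pi) :
    Real.cos (θ + φ) ≤ Real.cos (θ - φ) := by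
  rw [Real.cos_add, Real.cos_sub]
  have := mul_nonneg (Real.sin_nonneg_of_mem_Icc hθ) (Real.sin_nonneg_of_mem_Icc hφ)
  linarith

lemma abelKernel_nonneg {θ φ : ℝ} (hθ : θ ∈ Icc 0 Real.pi) (hφ : φ ∈ Icc 0 Real.pi) {r : ℝ}
    (hr : r ∈ Ico (0 : ℝ) 1) : 0 ≤ abelKernel r θ φ := by
  have h := cos_add_le_cos_sub hθ hφ
  have : Real.log (abelDenom r (θ - φ)) ≤ Real.log (abelDenom r (θ + φ)) := by
    refine Real.log_le_log (abelDenom_pos hr _) ?_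
    rw [abelDenom, abelDenom]
    nlinarith [hr.1]
  rw [abelKernel]; linarith

/-- After clearing denominators the difference is 2(1-r)²(cos(θ-φ) - cos(θ+φ)) ≥ 0. The kernel
itself is thus a majorant of its Abel means for every r < 1. -/
lemma abelKernel_le_kernel {θ φ : ℝ} (hθ : θ ∈ Icc 0 Real.pi) (hφ : φ ∈ Icc 0 Real.pi)
    (hne : θ ≠ φ) {r : ℝ} (hr : r ∈ Ico (0 : ℝ) 1) :
    abelKernel r θ φ ≤ kernel (Real.cos θ) (Real.cos φ) := by
  have h := cos_add_le_cos_sub hθ hφ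
  obtain ⟨h1, h2⟩ := abelDenom_one_pos hθ hφ hne
  have h3 := abelDenom_pos hr (θ + φ)
  have h4 := abelDenom_pos hr (θ - φ)
  rw [kernel_cos hθ hφ hne, abelKernel, abelKernel, ← Real.log_div h3.ne' h4.ne',
    ← Real.log_div h1.ne' h2.ne']
  have : Real.log (abelDenom r (θ + φ) / abelDenom r (θ - φ)) ≤
      Real.log (abelDenom 1 (θ + φ) / abelDenom 1 (θ - φ)) := by
    refine Real.log_le_log (by positivity) ?_
    rw [div_le_div_iff₀ h4 h2]
    simp only [abelDenom]
    nlinarith [mul_nonneg (sq_nonneg (1 - r)) (sub_nonneg.2 h)]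
  linarith

lemma tendsto_abelKernel {θ φ : ℝ} (hθ : θ ∈ Icc 0 Real.pi) (hφ : φ ∈ Icc 0 Real.pi)
    (hne : θ ≠ φ) :
    Tendsto (fun r => abelKernel r θ φ) (𝓝[<] 1) (𝓝 (kernel (Real.cos θ) (Real.cos φ))) := by
  obtain ⟨h1, h2⟩ := abelDenom_one_pos hθ hφ hne
  rw [kernel_cos hθ hφ hne]
  refine Tendsto.mono_left ?_ nhdsWithin_le_nhds
  have hc : ∀ s, Continuous fun r => abelDenom r s := fun s => by unfold abelDenom; fun_prop
  unfold abelKernel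
  exact ((((hc _).tendsto 1).log h1.ne').sub (((hc _).tendsto 1).log h2.ne')).div_const 2

lemma continuous_abelKernel {r : ℝ} (hr : r ∈ Ico (0 : ℝ) 1) :
    Continuous fun p : ℝ × ℝ => abelKernel r p.1 p.2 := by
  have : Continuous (abelDenom r) := by unfold abelDenom; fun_prop
  unfold abelKernel
  refine ((Continuous.log (by fun_prop) fun p => (abelDenom_pos hr _).ne').sub
    (Continuous.log (by fun_prop) fun p => (abelDenom_pos hr _).ne')).div_const 2

lemma sineKernel_re {r : ℝ} (hr : r ∈ Ico (0 : ℝ) 1) (θ φ : ℝ) :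
    (sineKernel (r * Complex.exp (θ * Complex.I)) φ).re =
      r * Real.sin (θ + φ) / abelDenom r (θ + φ) - r * Real.sin (θ - φ) / abelDenom r (θ - φ) := by
  have hζ : ‖(r : ℂ) * Complex.exp (θ * Complex.I)‖ < 1 := by
    rw [norm_ofReal_mul_exp hr.1]; exact hr.2
  have key : ∀ s : ℝ, (1 - (r : ℂ) * Complex.exp (s * Complex.I))⁻¹.im =
      r * Real.sin s / abelDenom r s := by
    intro s
    rw [Complex.inv_im]
    have hre : (1 - (r : ℂ) * Complex.exp (s * Complex.I)).re = 1 - r * Real.cos s := by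
      rw [Complex.sub_re, Complex.re_ofReal_mul, Complex.exp_ofReal_mul_I_re, Complex.one_re]
    have him : (1 - (r : ℂ) * Complex.exp (s * Complex.I)).im = -(r * Real.sin s) := by
      rw [Complex.sub_im, Complex.im_ofReal_mul, Complex.exp_ofReal_mul_I_im, Complex.one_im]
      ring
    rw [Complex.normSq_apply, hre, him, neg_neg, abelDenom]
    congr 1
    linear_combination r ^ 2 * Real.sin_sq_add_cos_sq s
  have h1 : (r : ℂ) * Complex.exp (θ * Complex.I) * Complex.exp (φ * Complex.I) =
      r * Complex.exp ((θ + φ : ℝ) * Complex.I) := by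
    rw [mul_assoc, ← Complex.exp_add]; push_cast; ring_nf
  have h2 : (r : ℂ) * Complex.exp (θ * Complex.I) * (Complex.exp (φ * Complex.I))⁻¹ =
      r * Complex.exp ((θ - φ : ℝ) * Complex.I) := by
    rw [mul_assoc, ← Complex.exp_neg, ← Complex.exp_add]; push_cast; ring_nf
  have hn1 := one_sub_mul_ne_zero hζ (Complex.norm_exp_ofReal_mul_I φ).le
  have hn2 := one_sub_mul_ne_zero hζ (norm_exp_inv φ).le
  have hs := exp_sub_inv φ
  have h3 : sineKernel (r * Complex.exp (θ * Complex.I)) φ =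
      -Complex.I * ((1 - (r : ℂ) * Complex.exp ((θ + φ : ℝ) * Complex.I))⁻¹ -
        (1 - (r : ℂ) * Complex.exp ((θ - φ : ℝ) * Complex.I))⁻¹) := by
    rw [sineKernel, sineKernel_denom, ← h1, ← h2]
    generalize (r : ℂ) * Complex.exp (θ * Complex.I) = ζ at *
    generalize Complex.exp (φ * Complex.I) = e at *
    rw [inv_sub_inv hn1 hn2, ← mul_div_assoc]
    congr 1
    linear_combination -Complex.I * ζ * hs + 2 * ζ * (Real.sin φ : ℝ) * Complex.I_sq
  rw [h3, ← key, ← key, ← Complex.sub_im]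
  simp

lemma hasDerivAt_abelKernel {r : ℝ} (hr : r ∈ Ico (0 : ℝ) 1) (θ φ : ℝ) :
    HasDerivAt (fun θ => abelKernel r θ φ)
      (sineKernel (r * Complex.exp (θ * Complex.I)) φ).re θ := by
  have key : ∀ s, HasDerivAt (fun s => Real.log (abelDenom r s))
      (2 * r * Real.sin s / abelDenom r s) s := by
    intro s
    have h1 : HasDerivAt (abelDenom r) (2 * r * Real.sin s) s := by
      unfold abelDenom
      have := (((Real.hasDerivAt_cos s).const_mul (2 * r)).const_sub 1).add_const (r ^ 2)
      exact this.congr_deriv (by ring)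
    exact h1.log (abelDenom_pos hr s).ne'
  have h1 := (key (θ + φ)).comp_add_const θ φ
  have h2 := (key (θ - φ)).comp_sub_const θ φ
  rw [sineKernel_re hr]
  exact ((h1.fun_sub h2).div_const 2).congr_deriv (by ring)

variable {B : Finset ℝ} {m : ℕ} {P : ℝ[X]} {α β γ : ℝ}

lemma continuous_sineKernel_circle {r : ℝ} (hr : r ∈ Ico (0 : ℝ) 1) :
    Continuous fun p : ℝ × ℝ => sineKernel (r * Complex.exp (p.1 * Complex.I)) p.2 := by
  unfold sineKernel
  refine Continuous.div (by fun_prop) (by fun_prop) fun p => sineKernel_denom_ne_zero ?_ _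
  rw [norm_ofReal_mul_exp hr.1]; exact hr.2

lemma integral_re_sineKernel {r : ℝ} (hr : r ∈ Ico (0 : ℝ) 1) {θ : ℝ} (hθ : 0 ≤ θ) (φ : ℝ) :
    ∫ t in Ioo 0 θ, (sineKernel (r * Complex.exp (t * Complex.I)) φ).re = abelKernel r θ φ := by
  have hc : Continuous fun t : ℝ => (sineKernel (r * Complex.exp (t * Complex.I)) φ).re := by
    have h := Complex.continuous_re.comp ((continuous_sineKernel_circle hr).comp
      (continuous_id.prodMk (continuous_const (y := φ))))
    simpa only [Function.comp_def, id] using h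
  have := intervalIntegral.integral_eq_sub_of_hasDerivAt
    (fun t (_ : t ∈ uIcc 0 θ) => hasDerivAt_abelKernel hr t φ) (hc.intervalIntegrable _ _)
  rw [abelKernel_zero_left, sub_zero] at this
  rw [← this, intervalIntegral.integral_of_le hθ, integral_Ioc_eq_integral_Ioo]

/-- Integrating the sine kernel formula in t gives this by Fubini: the primitive of Re `sineKernel`
that vanishes at θ = 0 is `abelKernel`. For fixed r < 1 the kernel is bounded by 2/(1-r)², so only
integrability of the boundary values is needed. -/
lemma IsRemainder.integral_re (hB : ↑B ⊆ Icc (-1 : ℝ) 1) (hm : B.card = 2 * m) {h : ℂ → ℂ}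
    (H : IsRemainder B P α β γ h) {r : ℝ} (hr : r ∈ Ioo (0 : ℝ) 1) {θ : ℝ} (hθ0 : 0 ≤ θ) :
    Real.pi * ∫ t in Ioo 0 θ, (h (r * Complex.exp (t * Complex.I))).re =
      ∫ φ in Ioo 0 Real.pi, boundaryIm B P φ * abelKernel r θ φ := by
  have hr' : r ∈ Ico (0 : ℝ) 1 := ⟨hr.1.le, hr.2⟩
  have hn : ∀ t : ℝ, ‖(r : ℂ) * Complex.exp (t * Complex.I)‖ < 1 := fun t => by
    rw [norm_ofReal_mul_exp hr.1.le]; exact hr.2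
  have hbi := integrableOn_boundaryIm hB hm P
  have h1 : ∀ t : ℝ, Real.pi * (h (r * Complex.exp (t * Complex.I))).re =
      ∫ φ in Ioo 0 Real.pi,
        boundaryIm B P φ * (sineKernel (r * Complex.exp (t * Complex.I)) φ).re := by
    intro t
    have e := congrArg Complex.re (H.eq_integral hB (hn t))
    rw [Complex.re_ofReal_mul] at e
    have hi : IntegrableOn (fun φ => (boundaryIm B P φ : ℂ) *
        sineKernel (r * Complex.exp (t * Complex.I)) φ) (Ioo 0 Real.pi) := by
      refine Integrable.mul_bdd (c := 2 / (1 - r) ^ 2) hbi.ofReal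
        (continuous_sineKernel (hn t)).aestronglyMeasurable (ae_of_all _ fun φ => ?_)
      have := norm_sineKernel_le (hn t) φ
      rwa [norm_ofReal_mul_exp hr.1.le] at this
    rw [e, ← Complex.reCLM_apply, ← Complex.reCLM.integral_comp_comm hi]
    simp only [Complex.reCLM_apply, Complex.re_ofReal_mul]
  rw [← integral_const_mul]
  simp_rw [h1]
  rw [integral_integral_swap]
  · refine setIntegral_congr_fun measurableSet_Ioo fun φ _ => ?_
    rw [integral_const_mul, integral_re_sineKernel hr' hθ0]
  · have hsnd : Integrable (fun p : ℝ × ℝ => boundaryIm B P p.2)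
        ((volume.restrict (Ioo 0 θ)).prod (volume.restrict (Ioo 0 Real.pi))) :=
      Integrable.comp_snd hbi _
    refine Integrable.mul_bdd (c := 2 / (1 - r) ^ 2) hsnd
      (Complex.continuous_re.comp (continuous_sineKernel_circle hr')).aestronglyMeasurable
      (ae_of_all _ fun p => ?_)
    have := norm_sineKernel_le (hn p.1) p.2
    rw [norm_ofReal_mul_exp hr.1.le] at this
    exact (Complex.abs_re_le_norm _).trans this

lemma measurable_kernel_left (z : ℝ) : Measurable (kernel z) := by
  have h : Measurable (Function.uncurry kernel) := measurable_kernel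
  exact h.of_uncurry_left

lemma integrableOn_kernel_mul_rootQuot (hB : ↑B ⊆ Icc (-1 : ℝ) 1) (hm : B.card = 2 * m)
    (P : ℝ[X]) : ∃ C, ∀ z ∈ Icc (-1 : ℝ) 1,
      IntegrableOn (fun w => kernel z w * ‖rootQuot B P w‖) (Ioo (-1) 1) ∧
      ∫ w in Ioo (-1 : ℝ) 1, kernel z w * ‖rootQuot B P w‖ ≤ C := by
  obtain ⟨C, hC, h⟩ := exists_norm_rootQuot_le hB hm P
  obtain ⟨C', h'⟩ := exists_kernel_mul_weight_bound (subset_union_pm hB)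
  refine ⟨C * C', fun z hz => ?_⟩
  have hk := measurable_kernel_left z
  have hle : ∀ᵐ w ∂volume.restrict (Ioo (-1 : ℝ) 1),
      kernel z w * ‖rootQuot B P w‖ ≤ C * (kernel z w * weight (B ∪ {1, -1}) w) := by
    filter_upwards [finset_ae_notMem B _, ae_restrict_mem measurableSet_Ioo] with w h1 h2
    have := mul_le_mul_of_nonneg_left (h w h2 h1) (kernel_nonneg hz (Ioo_subset_Icc_self h2))
    linarith
  have hdom := ((h' z hz).1.mono_set Ioo_subset_Icc_self).const_mul C
  have hi : IntegrableOn (fun w => kernel z w * ‖rootQuot B P w‖) (Ioo (-1) 1) := by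
    refine Integrable.mono' hdom (hk.mul (measurable_rootQuot B P).norm).aestronglyMeasurable ?_
    filter_upwards [hle, ae_restrict_mem measurableSet_Ioo] with w h1 h2
    rwa [Real.norm_of_nonneg (mul_nonneg (kernel_nonneg hz (Ioo_subset_Icc_self h2))
      (norm_nonneg _))]
  refine ⟨hi, (integral_mono_ae hi hdom hle).trans ?_⟩
  rw [integral_const_mul]
  refine mul_le_mul_of_nonneg_left (le_trans ?_ (h' z hz).2) hC
  refine setIntegral_mono_set (h' z hz).1 ?_ Ioo_subset_Icc_self.eventuallyLE
  filter_upwards [ae_restrict_mem measurableSet_Icc] with w hw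
  exact mul_nonneg (kernel_nonneg hz hw) (weight_nonneg _ _)

lemma integrableOn_kernel_mul_re (hB : ↑B ⊆ Icc (-1 : ℝ) 1) (hm : B.card = 2 * m)
    (P : ℝ[X]) {z : ℝ} (hz : z ∈ Icc (-1 : ℝ) 1) :
    IntegrableOn (fun w => kernel z w * (rootQuot B P w).re) (Ioo (-1) 1) := by
  obtain ⟨C, hC⟩ := integrableOn_kernel_mul_rootQuot hB hm P
  have hk := measurable_kernel_left z
  refine Integrable.mono (hC z hz).1 (hk.mul
    (Complex.measurable_re.comp (measurable_rootQuot B P))).aestronglyMeasurable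
    (ae_of_all _ fun w => ?_)
  rw [norm_mul, norm_mul, norm_norm]
  gcongr
  exact Complex.abs_re_le_norm _

/-- The logarithmic potential of `P / ∏ (x - b)^{1/2}`. -/
theorem HasExpansion.integral_kernel (hB : ↑B ⊆ Icc (-1 : ℝ) 1) (hm : B.card = 2 * m)
    (hP : HasExpansion B m P α β γ) {θ : ℝ} (hθ : θ ∈ Icc 0 Real.pi) :
    ∫ w in Ioo (-1 : ℝ) 1, kernel (Real.cos θ) w * (rootQuot B P w).re =
      Real.pi * ((∫ t in Ioo 0 θ, (α * Real.cos t ^ 2 + β * Real.cos t + γ)) +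
        ∫ x in Ioo (Real.cos θ) 1, (rootQuot B P x).im) := by
  obtain ⟨h, H⟩ := hP.exists_isRemainder hB hm
  have hz : Real.cos θ ∈ Icc (-1 : ℝ) 1 := ⟨Real.neg_one_le_cos _, Real.cos_le_one _⟩
  -- the left-hand side, as a limit
  have hLeq : ∫ w in Ioo (-1 : ℝ) 1, kernel (Real.cos θ) w * (rootQuot B P w).re =
      -∫ φ in Ioo 0 Real.pi, boundaryIm B P φ * kernel (Real.cos θ) (Real.cos φ) := by
    have := integral_comp_cos Real.pi_pos.le le_rfl
      (fun w => kernel (Real.cos θ) w * (rootQuot B P w).re)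
    rw [Real.cos_pi] at this
    rw [← this, ← integral_neg]
    refine integral_congr_ae (ae_of_all _ fun φ => ?_)
    simp only [boundaryIm, smul_eq_mul]; ring
  have hLint : IntegrableOn (fun φ => boundaryIm B P φ * kernel (Real.cos θ) (Real.cos φ))
      (Ioo 0 Real.pi) := by
    have h1 := integrableOn_kernel_mul_re hB hm P hz
    rw [← Real.cos_pi] at h1
    have := ((integrableOn_comp_cos Real.pi_pos.le le_rfl _).2 h1).neg
    refine this.congr (ae_of_all _ fun φ => ?_)
    simp only [boundaryIm, smul_eq_mul, Pi.neg_apply]; ring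
  have hL : Tendsto (fun r => ∫ φ in Ioo 0 Real.pi, boundaryIm B P φ * abelKernel r θ φ) (𝓝[<] 1)
      (𝓝 (∫ φ in Ioo 0 Real.pi, boundaryIm B P φ * kernel (Real.cos θ) (Real.cos φ))) := by
    refine tendsto_integral_filter_of_dominated_convergence
      (fun φ => ‖boundaryIm B P φ * kernel (Real.cos θ) (Real.cos φ)‖) ?_ ?_ hLint.norm ?_
    · filter_upwards [eventually_mem_Ioo_half] with r hr
      have hc := continuous_abelKernel (r := r) ⟨by linarith [hr.1], hr.2⟩
      exact ((measurable_boundaryIm B P).mul (hc.comp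
        (continuous_const.prodMk continuous_id)).measurable).aestronglyMeasurable
    · filter_upwards [eventually_mem_Ioo_half] with r hr
      filter_upwards [finset_ae_notMem {θ} _, ae_restrict_mem measurableSet_Ioo] with φ h1 h2
      have h3 : θ ≠ φ := fun h => h1 (by simp [h])
      have hr' : r ∈ Ico (0 : ℝ) 1 := ⟨by linarith [hr.1], hr.2⟩
      have h2' := Ioo_subset_Icc_self h2
      have h4 := abelKernel_nonneg hθ h2' hr'
      have h5 := abelKernel_le_kernel hθ h2' h3 hr'
      rw [norm_mul, norm_mul, Real.norm_of_nonneg h4, Real.norm_of_nonneg (h4.trans h5)]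
      gcongr
    · filter_upwards [finset_ae_notMem {θ} _, ae_restrict_mem measurableSet_Ioo] with φ h1 h2
      exact (tendsto_abelKernel hθ (Ioo_subset_Icc_self h2) fun h => h1 (by simp [h])).const_mul _
  -- the right-hand side, as a limit
  obtain ⟨C, hC, hb⟩ := H.bound
  have hR : Tendsto (fun r : ℝ => ∫ t in Ioo 0 θ, (h (r * Complex.exp (t * Complex.I))).re)
      (𝓝[<] 1) (𝓝 (∫ t in Ioo 0 θ, (-(Real.sin t * (rootQuot B P (Real.cos t)).im) -
        (α * Real.cos t ^ 2 + β * Real.cos t + γ)))) := by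
    refine tendsto_integral_filter_of_dominated_convergence
      (fun φ => C * (1 + Real.sin φ * weight (B ∪ {1, -1}) (Real.cos φ))) ?_ ?_
      ((integrableOn_one_add_sin_mul_weight hB hθ.2).const_mul C) ?_
    · filter_upwards [eventually_mem_Ioo_half] with r hr
      exact (Complex.continuous_re.comp
        (H.continuous_circle ⟨by linarith [hr.1], hr.2⟩)).aestronglyMeasurable
    · filter_upwards [eventually_mem_Ioo_half] with r hr
      filter_upwards [ae_cos_notMem B hθ.2, ae_restrict_mem measurableSet_Ioo] with φ h3 h4
      exact (Complex.abs_re_le_norm _).trans (hb r hr φ ⟨h4.1, h4.2.trans_le hθ.2⟩ h3)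
    · filter_upwards [ae_cos_notMem B hθ.2, ae_restrict_mem measurableSet_Ioo] with φ h3 h4
      exact H.tendsto_re ⟨h4.1, h4.2.trans_le hθ.2⟩ h3
  have hlim : ∫ φ in Ioo 0 Real.pi, boundaryIm B P φ * kernel (Real.cos θ) (Real.cos φ) =
      Real.pi * ∫ t in Ioo 0 θ, (-(Real.sin t * (rootQuot B P (Real.cos t)).im) -
        (α * Real.cos t ^ 2 + β * Real.cos t + γ)) := by
    refine tendsto_nhds_unique hL ((hR.const_mul Real.pi).congr' ?_)
    filter_upwards [eventually_mem_Ioo_half] with r hr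
    exact H.integral_re hB hm ⟨by linarith [hr.1], hr.2⟩ hθ.1
  have him : IntegrableOn (fun x => (rootQuot B P x).im) (Ioo (Real.cos θ) 1) :=
    ((integrableOn_rootQuot hB hm P).mono_set (Ioo_subset_Ioo_left hz.1)).im
  have hI1 := (integrableOn_comp_cos hθ.1 hθ.2 _).2 him
  have hI2 : IntegrableOn (fun t => α * Real.cos t ^ 2 + β * Real.cos t + γ) (Ioo 0 θ) := by
    have : Continuous fun t => α * Real.cos t ^ 2 + β * Real.cos t + γ := by fun_prop
    exact this.integrableOn_Icc.mono_set Ioo_subset_Icc_self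
  have := integral_comp_cos hθ.1 hθ.2 fun x => (rootQuot B P x).im
  simp only [smul_eq_mul] at this hI1
  have hsub : ∫ t in Ioo 0 θ, (-(Real.sin t * (rootQuot B P (Real.cos t)).im) -
      (α * Real.cos t ^ 2 + β * Real.cos t + γ)) =
      -(∫ t in Ioo 0 θ, Real.sin t * (rootQuot B P (Real.cos t)).im) -
      ∫ t in Ioo 0 θ, (α * Real.cos t ^ 2 + β * Real.cos t + γ) := by
    rw [← integral_neg]
    exact integral_sub hI1.neg hI2
  rw [hLeq, hlim, ← this, hsub]
  ring

end

section

/-! ### Strict positivity of the energy -/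

lemma norm_sq_one_sub {r : ℝ} (s : ℝ) :
    ‖1 - (r : ℂ) * Complex.exp (s * Complex.I)‖ ^ 2 = abelDenom r s := by
  rw [← Complex.normSq_eq_norm_sq, Complex.normSq_apply, Complex.sub_re, Complex.sub_im,
    Complex.re_ofReal_mul, Complex.im_ofReal_mul, Complex.exp_ofReal_mul_I_re,
    Complex.exp_ofReal_mul_I_im, Complex.one_re, Complex.one_im, abelDenom]
  linear_combination r ^ 2 * Real.sin_sq_add_cos_sq s

/-- Real part of the Taylor series of -log(1 - r e^{is}). The term n = 0 is zero because division by
zero gives zero. -/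
lemma hasSum_log_abelDenom {r : ℝ} (hr : r ∈ Ico (0 : ℝ) 1) (s : ℝ) :
    HasSum (fun n : ℕ => r ^ n / n * Real.cos (n * s)) (-(Real.log (abelDenom r s) / 2)) := by
  have hn : ‖(r : ℂ) * Complex.exp (s * Complex.I)‖ < 1 := by
    rw [norm_ofReal_mul_exp hr.1]; exact hr.2
  have h := Complex.hasSum_re (Complex.hasSum_taylorSeries_neg_log hn)
  rw [Complex.neg_re, Complex.log_re] at h
  rw [← norm_sq_one_sub, Real.log_pow]
  convert h using 1
  · ext n
    rw [mul_pow, ← Complex.exp_nat_mul, ← Complex.ofReal_pow, ← Complex.ofReal_natCast,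
      mul_div_right_comm, ← Complex.ofReal_div, Complex.re_ofReal_mul, ← mul_assoc,
      ← Complex.ofReal_mul, Complex.exp_ofReal_mul_I_re]
  · push_cast; ring

lemma hasSum_abelKernel {r : ℝ} (hr : r ∈ Ico (0 : ℝ) 1) (θ φ : ℝ) :
    HasSum (fun n : ℕ => 2 * r ^ n / n * (Real.sin (n * θ) * Real.sin (n * φ)))
      (abelKernel r θ φ) := by
  have h := (hasSum_log_abelDenom hr (θ - φ)).sub (hasSum_log_abelDenom hr (θ + φ))
  have e1 : abelKernel r θ φ = -(Real.log (abelDenom r (θ - φ)) / 2) -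
      -(Real.log (abelDenom r (θ + φ)) / 2) := by rw [abelKernel]; ring
  rw [e1]
  refine h.congr_fun fun n => ?_
  rw [mul_sub, mul_add, Real.cos_sub, Real.cos_add]; ring

lemma abs_abelCoeff_le {r : ℝ} (hr : r ∈ Ico (0 : ℝ) 1) (n : ℕ) :
    0 ≤ 2 * r ^ n / n ∧ 2 * r ^ n / n ≤ 2 * r ^ n := by
  have h0 := hr.1
  refine ⟨by positivity, ?_⟩
  rcases Nat.eq_zero_or_pos n with rfl | hn
  · simp
  · exact div_le_self (by positivity) (by exact_mod_cast hn)

/-- The sine coefficients of a density. -/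
def sineCoeff (μ : Measure ℝ) (w : ℝ → ℝ) (n : ℕ) : ℝ :=
  ∫ x, w x * Real.sin (n * Real.arccos x) ∂μ

variable {μ : Measure ℝ} {w : ℝ → ℝ}

lemma integrable_mul_of_bound (hw : Integrable w μ) {f : ℝ → ℝ} (hf : Measurable f) {c : ℝ}
    (hc : ∀ x, |f x| ≤ c) : Integrable (fun x => w x * f x) μ :=
  Integrable.mul_bdd (c := c) hw hf.aestronglyMeasurable (ae_of_all _ hc)

lemma measurable_sin_arccos (n : ℕ) : Measurable fun x => Real.sin (n * Real.arccos x) :=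
  Real.measurable_sin.comp (Real.continuous_arccos.measurable.const_mul _)

/-- Sines diagonalise the Abel kernel. Termwise integration is justified by a geometric majorant,
available because r < 1. -/
lemma hasSum_energy [SFinite μ] (hw : Integrable w μ) {r : ℝ} (hr : r ∈ Ico (0 : ℝ) 1) :
    HasSum (fun n : ℕ => 2 * r ^ n / n * sineCoeff μ w n ^ 2)
      (∫ p, abelKernel r (Real.arccos p.1) (Real.arccos p.2) * (w p.1 * w p.2) ∂(μ.prod μ)) := by
  have hs : ∀ n : ℕ, Integrable (fun x => w x * Real.sin (n * Real.arccos x)) μ := fun n =>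
    integrable_mul_of_bound hw (measurable_sin_arccos n) fun x => Real.abs_sin_le_one _
  have hFi : ∀ n : ℕ, Integrable (fun p : ℝ × ℝ => 2 * r ^ n / n *
      ((w p.1 * Real.sin (n * Real.arccos p.1)) * (w p.2 * Real.sin (n * Real.arccos p.2))))
      (μ.prod μ) := fun n => ((hs n).mul_prod (hs n)).const_mul _
  have hsum := hasSum_integral_of_summable_integral_norm hFi ?_
  · have e1 : ∫ p, abelKernel r (Real.arccos p.1) (Real.arccos p.2) * (w p.1 * w p.2)
        ∂(μ.prod μ) = ∫ p : ℝ × ℝ, ∑' n : ℕ, 2 * r ^ n / n *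
        ((w p.1 * Real.sin (n * Real.arccos p.1)) * (w p.2 * Real.sin (n * Real.arccos p.2)))
        ∂(μ.prod μ) := by
      refine integral_congr_ae (ae_of_all _ fun p => ?_)
      have := (hasSum_abelKernel hr (Real.arccos p.1) (Real.arccos p.2)).mul_right (w p.1 * w p.2)
      simp only
      rw [← this.tsum_eq]
      refine tsum_congr fun n => ?_
      ring
    rw [e1]
    refine hsum.congr_fun fun n => ?_
    rw [integral_const_mul, integral_prod_mul
        (f := fun x => w x * Real.sin (n * Real.arccos x))
        (g := fun x => w x * Real.sin (n * Real.arccos x)), sineCoeff, sq]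
  · refine Summable.of_nonneg_of_le (fun n => integral_nonneg fun p => norm_nonneg _)
      (fun n => ?_) ((summable_geometric_of_lt_one hr.1 hr.2).mul_left
        (2 * ∫ p : ℝ × ℝ, |w p.1| * |w p.2| ∂(μ.prod μ)))
    rw [mul_right_comm, ← integral_const_mul]
    refine integral_mono (hFi n).norm ((hw.abs.mul_prod hw.abs).const_mul _) fun p => ?_
    obtain ⟨h1, h2⟩ := abs_abelCoeff_le hr n
    simp only
    rw [norm_mul, norm_mul, norm_mul, norm_mul, Real.norm_of_nonneg h1]
    have e1 := Real.abs_sin_le_one (n * Real.arccos p.1)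
    have e2 := Real.abs_sin_le_one (n * Real.arccos p.2)
    simp only [Real.norm_eq_abs]
    have h3 := mul_le_of_le_one_right (abs_nonneg (w p.1)) e1
    have h4 := mul_le_of_le_one_right (abs_nonneg (w p.2)) e2
    have h5 : 0 ≤ 2 * r ^ n := h1.trans h2
    gcongr

/-- The energy is the integral of w against its potential, hence zero, and it is the limit of the
Abel energies by domination with |K w w|; finite energy enters here. Each Abel energy is a sum of
nonnegative terms, so it bounds each single term from above. -/
lemma sineCoeff_eq_zero [SFinite μ] (hμ1 : ∀ᵐ x ∂μ, x ∈ Icc (-1 : ℝ) 1)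
    (hμ2 : ∀ᵐ p ∂(μ.prod μ), p.1 ≠ p.2)
    (hw : Integrable w μ)
    (hE : Integrable (fun p : ℝ × ℝ => kernel p.1 p.2 * w p.1 * w p.2) (μ.prod μ))
    (h0 : ∀ᵐ x ∂μ, ∫ y, kernel x y * w y ∂μ = 0) {k : ℕ} (hk : 1 ≤ k) :
    sineCoeff μ w k = 0 := by
  have hE0 : ∫ p, kernel p.1 p.2 * w p.1 * w p.2 ∂(μ.prod μ) = 0 := by
    rw [integral_prod _ hE]
    refine integral_eq_zero_of_ae ?_
    filter_upwards [h0] with x hx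
    simp only [Pi.zero_apply]
    rw [← mul_zero (w x), ← hx, ← integral_const_mul]
    congr 1; ext y; ring
  have hmem : ∀ᵐ p ∂(μ.prod μ), p.1 ∈ Icc (-1 : ℝ) 1 ∧ p.2 ∈ Icc (-1 : ℝ) 1 :=
    (Measure.quasiMeasurePreserving_fst.ae hμ1).and (Measure.quasiMeasurePreserving_snd.ae hμ1)
  have hlim : Tendsto (fun r => ∫ p, abelKernel r (Real.arccos p.1) (Real.arccos p.2) *
      (w p.1 * w p.2) ∂(μ.prod μ)) (𝓝[<] 1) (𝓝 0) := by
    rw [← hE0]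
    refine tendsto_integral_filter_of_dominated_convergence
      (fun p => ‖kernel p.1 p.2 * w p.1 * w p.2‖) ?_ ?_ hE.norm ?_
    · filter_upwards [eventually_mem_Ioo_half] with r hr
      have hc := continuous_abelKernel (r := r) ⟨by linarith [hr.1], hr.2⟩
      have h1 : Measurable fun p : ℝ × ℝ => (Real.arccos p.1, Real.arccos p.2) :=
        (Real.continuous_arccos.measurable.comp measurable_fst).prodMk
          (Real.continuous_arccos.measurable.comp measurable_snd)
      exact (hc.measurable.comp h1).aestronglyMeasurable.mul (hw.mul_prod hw).aestronglyMeasurable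
    · filter_upwards [eventually_mem_Ioo_half] with r hr
      filter_upwards [hμ2, hmem] with p h1 ⟨h2, h3⟩
      have hne : Real.arccos p.1 ≠ Real.arccos p.2 := fun h => h1 (Real.arccos_injOn h2 h3 h)
      have hr' : r ∈ Ico (0 : ℝ) 1 := ⟨by linarith [hr.1], hr.2⟩
      have m1 : Real.arccos p.1 ∈ Icc 0 Real.pi := ⟨Real.arccos_nonneg _, Real.arccos_le_pi _⟩
      have m2 : Real.arccos p.2 ∈ Icc 0 Real.pi := ⟨Real.arccos_nonneg _, Real.arccos_le_pi _⟩
      have h4 := abelKernel_nonneg m1 m2 hr'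
      have h5 := abelKernel_le_kernel m1 m2 hne hr'
      rw [Real.cos_arccos h2.1 h2.2, Real.cos_arccos h3.1 h3.2] at h5
      rw [mul_assoc, norm_mul, norm_mul (kernel _ _), Real.norm_of_nonneg h4,
        Real.norm_of_nonneg (h4.trans h5)]
      gcongr
    · filter_upwards [hμ2, hmem] with p h1 ⟨h2, h3⟩
      have hne : Real.arccos p.1 ≠ Real.arccos p.2 := fun h => h1 (Real.arccos_injOn h2 h3 h)
      have := tendsto_abelKernel (θ := Real.arccos p.1) (φ := Real.arccos p.2)
        ⟨Real.arccos_nonneg _, Real.arccos_le_pi _⟩ ⟨Real.arccos_nonneg _, Real.arccos_le_pi _⟩ hne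
      rw [Real.cos_arccos h2.1 h2.2, Real.cos_arccos h3.1 h3.2] at this
      rw [mul_assoc]
      exact this.mul_const _
  have hk' : Tendsto (fun r : ℝ => 2 * r ^ k / k * sineCoeff μ w k ^ 2) (𝓝[<] 1)
      (𝓝 (2 * 1 ^ k / k * sineCoeff μ w k ^ 2)) := by
    have : Continuous fun r : ℝ => 2 * r ^ k / k * sineCoeff μ w k ^ 2 := by fun_prop
    exact (this.tendsto 1).mono_left nhdsWithin_le_nhds
  have hle : 2 * 1 ^ k / k * sineCoeff μ w k ^ 2 ≤ 0 := by
    refine le_of_tendsto_of_tendsto hk' hlim ?_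
    filter_upwards [eventually_mem_Ioo_half] with r hr
    have hr' : r ∈ Ico (0 : ℝ) 1 := ⟨by linarith [hr.1], hr.2⟩
    exact le_hasSum (hasSum_energy hw hr') k fun n _ =>
      mul_nonneg (abs_abelCoeff_le hr' n).1 (sq_nonneg _)
  have hk0 : (0 : ℝ) < k := by exact_mod_cast hk
  have : 0 < 2 * 1 ^ k / (k : ℝ) := by positivity
  have h2 : sineCoeff μ w k ^ 2 ≤ 0 := by
    by_contra! h
    exact absurd hle (not_le.2 (mul_pos this h))
  exact pow_eq_zero_iff two_ne_zero |>.1 (le_antisymm h2 (sq_nonneg _))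

/-- Induction with sin(kθ) cos θ = (sin((k+1)θ) + sin((k-1)θ))/2. The case k = 1 says that every
moment of w √(1-x²) vanishes. -/
lemma integral_sin_mul_pow_eq_zero (hw : Integrable w μ)
    (h : ∀ k : ℕ, 1 ≤ k → sineCoeff μ w k = 0) (j : ℕ) :
    ∀ k : ℕ, ∫ x, w x * (Real.sin (k * Real.arccos x) * Real.cos (Real.arccos x) ^ j) ∂μ = 0 := by
  induction j with
  | zero =>
    intro k
    rcases Nat.eq_zero_or_pos k with rfl | hk
    · simp
    · simpa [sineCoeff] using h k hk
  | succ j ih =>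
    intro k
    rcases Nat.eq_zero_or_pos k with rfl | hk
    · simp
    obtain ⟨l, rfl⟩ : ∃ l, k = l + 1 := ⟨k - 1, by omega⟩
    have hi : ∀ k : ℕ, Integrable (fun x => w x *
        (Real.sin (k * Real.arccos x) * Real.cos (Real.arccos x) ^ j)) μ := fun k => by
      refine integrable_mul_of_bound hw (c := 1) ((measurable_sin_arccos k).mul
        ((Real.measurable_cos.comp Real.continuous_arccos.measurable).pow_const j)) fun x => ?_
      rw [abs_mul, abs_pow]
      exact mul_le_one₀ (Real.abs_sin_le_one _) (by positivity)
        (pow_le_one₀ (abs_nonneg _) (Real.abs_cos_le_one _))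
    have e : ∀ x, w x * (Real.sin ((l + 1 : ℕ) * Real.arccos x) *
        Real.cos (Real.arccos x) ^ (j + 1)) =
        (w x * (Real.sin ((l + 2 : ℕ) * Real.arccos x) * Real.cos (Real.arccos x) ^ j) +
          w x * (Real.sin (l * Real.arccos x) * Real.cos (Real.arccos x) ^ j)) / 2 := by
      intro x
      have e1 : ((l + 2 : ℕ) : ℝ) * Real.arccos x =
        ((l + 1 : ℕ) : ℝ) * Real.arccos x + Real.arccos x := by push_cast; ring
      have e2 : (l : ℝ) * Real.arccos x =
        ((l + 1 : ℕ) : ℝ) * Real.arccos x - Real.arccos x := by push_cast; ring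
      rw [e1, e2, Real.sin_add, Real.sin_sub]
      ring
    simp_rw [e]
    rw [integral_div, integral_add (hi _) (hi _), ih, ih]
    simp

/-- An integrable function on `[-1, 1]` whose moments vanish is zero. -/
lemma ae_eq_zero_of_moments {g : ℝ → ℝ} (hg : Integrable g)
    (hsupp : ∀ x, x ∉ Icc (-1 : ℝ) 1 → g x = 0) (h : ∀ j : ℕ, ∫ x, g x * x ^ j = 0) :
    g =ᵐ[volume] 0 := by
  have hij : ∀ j : ℕ, Integrable fun x => g x * x ^ j := fun j => by
    refine hg.mono (hg.aestronglyMeasurable.mul (by fun_prop)) (ae_of_all _ fun x => ?_)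
    by_cases hx : x ∈ Icc (-1 : ℝ) 1
    · rw [norm_mul, norm_pow, Real.norm_eq_abs x]
      exact mul_le_of_le_one_right (norm_nonneg _) (pow_le_one₀ (abs_nonneg _) (abs_le.2 hx))
    · simp [hsupp x hx]
  have hpe : ∀ (p : ℝ[X]) x, g x * p.eval x =
      ∑ i ∈ Finset.range (p.natDegree + 1), p.coeff i * (g x * x ^ i) := by
    intro p x
    rw [Polynomial.eval_eq_sum_range, Finset.mul_sum]
    exact Finset.sum_congr rfl fun i _ => by ring
  have hpi : ∀ p : ℝ[X], Integrable fun x => g x * p.eval x := fun p => by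
    simp_rw [hpe]
    exact integrable_finsetSum _ fun i _ => (hij i).const_mul _
  have hp0 : ∀ p : ℝ[X], ∫ x, g x * p.eval x = 0 := fun p => by
    simp_rw [hpe]
    rw [integral_finsetSum _ fun i _ => (hij i).const_mul _]
    refine Finset.sum_eq_zero fun i _ => ?_
    rw [integral_const_mul, h, mul_zero]
  refine ae_eq_zero_of_integral_contDiff_smul_eq_zero hg.locallyIntegrable fun f hf hfc => ?_
  have hfi : Integrable fun x => f x • g x := by
    obtain ⟨C, hC⟩ := hf.continuous.bounded_above_of_compact_support hfc
    exact hg.bdd_mul hf.continuous.aestronglyMeasurable (ae_of_all _ hC)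
  by_contra hne
  have hpos : 0 < |∫ x, f x • g x| := abs_pos.2 hne
  set M := ∫ x, |g x|
  have hM : 0 ≤ M := integral_nonneg fun x => abs_nonneg _
  -- Weierstrass approximation; the tolerance is such that tolerance times M is strictly less than
  -- the integral assumed nonzero, and M + 1 avoids dividing by zero.
  obtain ⟨p, hp⟩ := exists_polynomial_near_of_continuousOn (-1) 1 f hf.continuous.continuousOn
    (|∫ x, f x • g x| / (M + 1)) (by positivity)
  have e1 : ∫ x, f x • g x = ∫ x, (f x • g x - g x * p.eval x) := by
    rw [integral_sub hfi (hpi p), hp0, sub_zero]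
  have e2 : |∫ x, f x • g x| ≤ |∫ x, f x • g x| / (M + 1) * M := by
    conv_lhs => rw [e1]
    refine (abs_integral_le_integral_abs).trans ?_
    rw [← integral_const_mul]
    refine integral_mono (hfi.sub (hpi p)).abs (hg.abs.const_mul _) fun x => ?_
    by_cases hx : x ∈ Icc (-1 : ℝ) 1
    · have : f x • g x - g x * p.eval x = -(p.eval x - f x) * g x := by
        rw [smul_eq_mul]; ring
      simp only [this]
      rw [abs_mul, abs_neg]
      exact mul_le_mul_of_nonneg_right (hp x hx).le (abs_nonneg _)
    · simp [hsupp x hx]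
  rw [div_mul_eq_mul_div, le_div_iff₀ (by positivity)] at e2
  nlinarith

lemma finset_ae_notMem_volume (B : Finset ℝ) : ∀ᵐ x : ℝ, x ∉ B := by
  simpa using finset_ae_notMem B univ

/-- A density of finite energy on `Γ ⊆ [-1, 1]` whose potential vanishes on `Γ` is zero. -/
theorem ae_eq_zero_of_potential_eq_zero {Γ : Set ℝ} (hΓm : MeasurableSet Γ)
    (hΓ : Γ ⊆ Icc (-1) 1) (hw : IntegrableOn w Γ)
    (hE : Integrable (fun p : ℝ × ℝ => kernel p.1 p.2 * w p.1 * w p.2)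
      ((volume.restrict Γ).prod (volume.restrict Γ)))
    (h0 : ∀ z ∈ Γ, ∫ y in Γ, kernel z y * w y = 0) : w =ᵐ[volume.restrict Γ] 0 := by
  have hμ1 : ∀ᵐ x ∂volume.restrict Γ, x ∈ Icc (-1 : ℝ) 1 := by
    filter_upwards [ae_restrict_mem hΓm] with x hx using hΓ hx
  have hμ2 : ∀ᵐ p ∂((volume.restrict Γ).prod (volume.restrict Γ)), p.1 ≠ p.2 := by
    have hms : MeasurableSet {p : ℝ × ℝ | p.1 = p.2} :=
      measurableSet_eq_fun measurable_fst measurable_snd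
    rw [ae_iff]
    simp only [ne_eq, not_not]
    rw [Measure.measure_prod_null hms]
    refine ae_of_all _ fun x => ?_
    have : Prod.mk x ⁻¹' {p : ℝ × ℝ | p.1 = p.2} = {x} := by ext y; simp [eq_comm]
    simp [this]
  have hc : ∀ k : ℕ, 1 ≤ k → sineCoeff (volume.restrict Γ) w k = 0 := fun k hk =>
    sineCoeff_eq_zero hμ1 hμ2 hw hE (by
      filter_upwards [ae_restrict_mem hΓm] with x hx using h0 x hx) hk
  have hmom := fun j => integral_sin_mul_pow_eq_zero hw hc j 1
  set g : ℝ → ℝ := Γ.indicator fun x => w x * Real.sin (Real.arccos x) with hg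
  have hgi : Integrable g := by
    rw [hg, integrable_indicator_iff hΓm]
    exact integrable_mul_of_bound hw (by simpa using measurable_sin_arccos 1)
      fun x => Real.abs_sin_le_one _
  have hg0 : g =ᵐ[volume] 0 := by
    refine ae_eq_zero_of_moments hgi (fun x hx => ?_) fun j => ?_
    · exact indicator_of_notMem (fun h => hx (hΓ h)) _
    · have e : ∀ x, g x * x ^ j = Γ.indicator (fun x => w x *
          (Real.sin ((1 : ℕ) * Real.arccos x) * Real.cos (Real.arccos x) ^ j)) x := by
        intro x
        by_cases hx : x ∈ Γ
        · rw [hg, indicator_of_mem hx, indicator_of_mem hx,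
            Real.cos_arccos (hΓ hx).1 (hΓ hx).2, Nat.cast_one, one_mul]
          ring
        · rw [hg, indicator_of_notMem hx, indicator_of_notMem hx, zero_mul]
      simp_rw [e]
      rw [integral_indicator hΓm]
      exact hmom j
  rw [EventuallyEq, ae_restrict_iff' hΓm]
  filter_upwards [hg0, finset_ae_notMem_volume {1, -1}] with x hx hx1 hxΓ
  rw [hg, indicator_of_mem hxΓ] at hx
  simp only [Finset.mem_insert, Finset.mem_singleton, not_or] at hx1
  rcases mul_eq_zero.1 hx with h | h
  · exact h
  · exfalso
    have hs := Real.sin_pos_of_pos_of_lt_pi (x := Real.arccos x)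
      (Real.arccos_pos.2 (lt_of_le_of_ne (hΓ hxΓ).2 hx1.1))
      (lt_of_le_of_ne (Real.arccos_le_pi _) fun h => hx1.2
        (le_antisymm (Real.arccos_eq_pi.1 h) (hΓ hxΓ).1))
    exact hs.ne' h

end

/-! ### The finite Hilbert transform -/

/-- The reflection w ↦ 2x - w preserves the symmetric annulus and changes the sign of the integrand.
-/
lemma setIntegral_inv_sub_eq_zero (x ε δ : ℝ) :
    ∫ w in {w : ℝ | ε < |w - x| ∧ |w - x| < δ}, (w - x)⁻¹ = 0 := by
  set s := {w : ℝ | ε < |w - x| ∧ |w - x| < δ} with hs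
  have hmp := Measure.measurePreserving_sub_left (volume : Measure ℝ) (2 * x)
  have h := hmp.setIntegral_preimage_emb (MeasurableEquiv.subLeft (2 * x)).measurableEmbedding
    (fun w => (w - x)⁻¹) s
  have hpre : (fun w => 2 * x - w) ⁻¹' s = s := by
    ext w
    simp only [hs, mem_preimage, mem_ofPred_eq]
    rw [show 2 * x - w - x = -(w - x) by ring, abs_neg]
  have e : ∀ w : ℝ, (2 * x - w - x)⁻¹ = -(w - x)⁻¹ := fun w => by
    rw [show 2 * x - w - x = -(w - x) by ring, inv_neg]
  rw [hpre] at h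
  simp_rw [e] at h
  rw [integral_neg] at h
  linarith

lemma integral_re_inv_sub {z : ℂ} (hz : z.im ≠ 0) (a b : ℝ) :
    ∫ w in a..b, (((w : ℂ) - z)⁻¹).re =
      Real.log ((b - z.re) ^ 2 + z.im ^ 2) / 2 - Real.log ((a - z.re) ^ 2 + z.im ^ 2) / 2 := by
  have hpos : ∀ w : ℝ, 0 < (w - z.re) ^ 2 + z.im ^ 2 := fun w => by positivity
  have hre : ∀ w : ℝ, (((w : ℂ) - z)⁻¹).re = (w - z.re) / ((w - z.re) ^ 2 + z.im ^ 2) := by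
    intro w
    rw [Complex.inv_re, Complex.normSq_apply]
    simp only [Complex.sub_re, Complex.sub_im, Complex.ofReal_re, Complex.ofReal_im]
    congr 1; ring
  simp_rw [hre]
  refine intervalIntegral.integral_eq_sub_of_hasDerivAt
    (f := fun w => Real.log ((w - z.re) ^ 2 + z.im ^ 2) / 2) (fun w _ => ?_) ?_
  · have h1 : HasDerivAt (fun w : ℝ => (w - z.re) ^ 2 + z.im ^ 2) (2 * (w - z.re)) w := by
      have := (((hasDerivAt_id w).sub_const z.re).pow 2).add_const (z.im ^ 2)
      exact this.congr_deriv (by simp)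
    exact ((h1.log (hpos w).ne').div_const 2).congr_deriv (by ring)
  · refine Continuous.intervalIntegrable ?_ _ _
    exact Continuous.div (by fun_prop) (by fun_prop) fun w => (hpos w).ne'

/-- If the Cauchy transform of `ψ` has a limit at `x` along a path which stays in a cone, then the
principal value exists at `x` and is the real part of that limit. -/
lemma tendsto_principalValue {ψ : ℝ → ℝ} (hψ : IntegrableOn ψ (Ioo (-1) 1)) {x : ℝ}
    (hx : x ∈ Ioo (-1 : ℝ) 1) (hd : DifferentiableAt ℝ ψ x) {J : ℝ → ℂ} {l : Filter ℝ} [l.NeBot]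
    [l.IsCountablyGenerated] (hJ : Tendsto J l (𝓝 x)) (hJim : ∀ᶠ r in l, (J r).im ≠ 0)
    (hJcone : ∀ᶠ r in l, ∀ w ∈ Ioo (-1 : ℝ) 1, |w - x| / 4 ≤ ‖(w : ℂ) - J r‖) {L : ℝ}
    (hL : Tendsto (fun r => (∫ w in Ioo (-1 : ℝ) 1, (ψ w : ℂ) * ((w : ℂ) - J r)⁻¹).re) l (𝓝 L)) :
    Tendsto (fun ε => ∫ w in Ioo (-1 : ℝ) 1 ∩ {w | ε < |w - x|}, ψ w * (w - x)⁻¹) (𝓝[>] 0)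
      (𝓝 L) := by
  obtain ⟨C, hC⟩ := hd.isBigO_sub.bound
  obtain ⟨δ₁, hδ₁, hδC⟩ := Metric.eventually_nhds_iff.1 hC
  set δ := min δ₁ (min (x + 1) (1 - x)) with hδdef
  have hδ : 0 < δ := lt_min hδ₁ (lt_min (by linarith [hx.1]) (by linarith [hx.2]))
  have hδ2 : δ ≤ x + 1 := (min_le_right _ _).trans (min_le_left _ _)
  have hδ3 : δ ≤ 1 - x := (min_le_right _ _).trans (min_le_right _ _)
  have hIsub : Ioo (x - δ) (x + δ) ⊆ Ioo (-1) 1 :=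
    Ioo_subset_Ioo (by linarith) (by linarith)
  set I := Ioo (-1 : ℝ) 1
  have hN : ∀ w, w ∈ Ioo (x - δ) (x + δ) ↔ |w - x| < δ := fun w => by
    rw [abs_lt, mem_Ioo]; constructor <;> rintro ⟨h1, h2⟩ <;> constructor <;> linarith
  -- Splitting off the constant ψ(x) on an interval symmetric about x: its truncated integral
  -- vanishes by symmetry and its Cauchy integral is an explicit logarithm. The rest is O(|w - x|)
  -- near x by differentiability, and dominated convergence applies to it on both sides.
  set χ : ℝ → ℝ := (Ioo (x - δ) (x + δ)).indicator fun _ => ψ x with hχ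
  set ψ₁ : ℝ → ℝ := fun w => ψ w - χ w with hψ₁
  have hχi : IntegrableOn χ I := by
    refine Integrable.integrableOn ?_
    rw [hχ, integrable_indicator_iff measurableSet_Ioo]
    exact integrableOn_const (by simp)
  have hψ₁i : IntegrableOn ψ₁ I := hψ.sub hχi
  -- the dominating function
  set G : ℝ → ℝ := fun w => |C| + |ψ₁ w| / δ with hG
  have hGi : IntegrableOn G I := (integrableOn_const (by simp [I])).add (hψ₁i.abs.div_const δ)
  have hψ₁G : ∀ w, |ψ₁ w| ≤ G w * |w - x| := by
    intro w
    have h0 := abs_nonneg (w - x)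
    by_cases hw : |w - x| < δ
    · have h1 : ψ₁ w = ψ w - ψ x := by
        simp only [hψ₁, hχ]; rw [indicator_of_mem ((hN w).2 hw)]
      have h2 := hδC (y := w) (by rw [Real.dist_eq]; exact hw.trans_le (min_le_left _ _))
      rw [Real.norm_eq_abs, Real.norm_eq_abs] at h2
      rw [h1]
      refine h2.trans (mul_le_mul_of_nonneg_right ?_ h0)
      have : 0 ≤ |ψ₁ w| / δ := by positivity
      have := le_abs_self C
      simp only [hG]; linarith
    · push Not at hw
      have h1 : |ψ₁ w| = |ψ₁ w| / δ * δ := by field_simp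
      rw [h1]
      have : 0 ≤ |C| := abs_nonneg C
      have : |ψ₁ w| / δ ≤ G w := by simp only [hG]; linarith
      have : 0 ≤ |ψ₁ w| / δ := by positivity
      exact mul_le_mul ‹_› hw hδ.le (by linarith)
  have hG0 : ∀ w, 0 ≤ G w := fun w => by simp only [hG]; positivity
  have hbd : ∀ w, |ψ₁ w * (w - x)⁻¹| ≤ G w := by
    intro w
    rw [abs_mul, abs_inv]
    rcases eq_or_ne w x with rfl | h
    · simp [hG0]
    · have : 0 < |w - x| := abs_pos.2 (sub_ne_zero.2 h)
      rw [← div_eq_mul_inv, div_le_iff₀ this]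
      exact hψ₁G w
  have hmeas1 : AEStronglyMeasurable ψ₁ (volume.restrict I) := hψ₁i.aestronglyMeasurable
  have hmeasx : Measurable fun w : ℝ => (w - x)⁻¹ := by fun_prop
  -- limits of the regular part
  have hlim1 : Tendsto (fun ε => ∫ w in I ∩ {w | ε < |w - x|}, ψ₁ w * (w - x)⁻¹) (𝓝[>] 0)
      (𝓝 (∫ w in I, ψ₁ w * (w - x)⁻¹)) := by
    have hms : ∀ ε : ℝ, MeasurableSet {w : ℝ | ε < |w - x|} := fun ε =>
      measurableSet_lt measurable_const (by fun_prop)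
    have e : ∀ ε : ℝ, ∫ w in I ∩ {w | ε < |w - x|}, ψ₁ w * (w - x)⁻¹ =
        ∫ w in I, {w | ε < |w - x|}.indicator (fun w => ψ₁ w * (w - x)⁻¹) w := fun ε => by
      rw [setIntegral_indicator (hms ε)]
    simp_rw [e]
    refine tendsto_integral_filter_of_dominated_convergence G ?_ ?_ hGi ?_
    · exact Eventually.of_forall fun ε =>
        (hmeas1.mul hmeasx.aestronglyMeasurable).indicator (hms ε)
    · refine Eventually.of_forall fun ε => ae_of_all _ fun w => ?_
      refine (norm_indicator_le_norm_self _ _).trans ?_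
      exact hbd w
    · refine ae_of_all _ fun w => ?_
      rcases eq_or_ne w x with rfl | h
      · refine tendsto_const_nhds.congr fun ε => ?_
        by_cases hm : w ∈ {v : ℝ | ε < |v - w|}
        · rw [indicator_of_mem hm]
        · rw [indicator_of_notMem hm]; simp
      · have hp : 0 < |w - x| := abs_pos.2 (sub_ne_zero.2 h)
        refine tendsto_const_nhds.congr' ?_
        filter_upwards [nhdsWithin_le_nhds (Iio_mem_nhds hp)] with ε hε
        rw [indicator_of_mem]
        exact hε
  have hlim2 : Tendsto (fun r => (∫ w in I, (ψ₁ w : ℂ) * ((w : ℂ) - J r)⁻¹).re) l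
      (𝓝 (∫ w in I, ψ₁ w * (w - x)⁻¹)) := by
    have e : ((∫ w in I, ψ₁ w * (w - x)⁻¹ : ℝ)) =
        (∫ w in I, ((ψ₁ w : ℂ) * ((w : ℂ) - x)⁻¹)).re := by
      rw [← Complex.ofReal_re (∫ w in I, ψ₁ w * (w - x)⁻¹), ← integral_complex_ofReal]
      congr 2; ext w; push_cast; rfl
    rw [e]
    refine (Complex.continuous_re.tendsto _).comp ?_
    refine tendsto_integral_filter_of_dominated_convergence (fun w => 4 * G w) ?_ ?_
      (hGi.const_mul 4) ?_
    · exact Eventually.of_forall fun r =>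
        (Complex.continuous_ofReal.comp_aestronglyMeasurable hmeas1).mul
          (Measurable.aestronglyMeasurable (by fun_prop))
    · filter_upwards [hJcone, hJim] with r hr hr'
      filter_upwards [ae_restrict_mem measurableSet_Ioo] with w hw
      have h1 := hr w hw
      have h2 : 0 < ‖(w : ℂ) - J r‖ := norm_pos_iff.2 fun h => hr' (by
        rw [← sub_eq_zero.1 h]; simp)
      rw [norm_mul, norm_inv, Complex.norm_real, Real.norm_eq_abs, ← div_eq_mul_inv,
        div_le_iff₀ h2]
      have := hψ₁G w
      nlinarith [hG0 w]
    · filter_upwards [finset_ae_notMem {x} I] with w hw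
      have hwx : (w : ℂ) - x ≠ 0 := by
        rw [← Complex.ofReal_sub]
        exact_mod_cast sub_ne_zero.2 (by simpa using hw)
      exact ((tendsto_const_nhds.sub hJ).inv₀ hwx).const_mul _
  -- the singular part drops out
  have hlim3 : Tendsto (fun r => (∫ w in I, (χ w : ℂ) * ((w : ℂ) - J r)⁻¹).re) l (𝓝 0) := by
    have e : ∀ r, (J r).im ≠ 0 → (∫ w in I, (χ w : ℂ) * ((w : ℂ) - J r)⁻¹).re = ψ x *
        (Real.log ((x + δ - (J r).re) ^ 2 + (J r).im ^ 2) / 2 -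
          Real.log ((x - δ - (J r).re) ^ 2 + (J r).im ^ 2) / 2) := by
      intro r hr
      have hne : ∀ w : ℝ, (w : ℂ) - J r ≠ 0 := fun w h => hr (by rw [← sub_eq_zero.1 h]; simp)
      have hc : Continuous fun w : ℝ => ((w : ℂ) - J r)⁻¹ :=
        Continuous.inv₀ (by fun_prop) hne
      have e1 : ∀ w, (χ w : ℂ) * ((w : ℂ) - J r)⁻¹ =
          (Ioo (x - δ) (x + δ)).indicator (fun w : ℝ => (ψ x : ℂ) * ((w : ℂ) - J r)⁻¹) w := by
        intro w
        by_cases hw : w ∈ Ioo (x - δ) (x + δ)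
        · rw [hχ, indicator_of_mem hw, indicator_of_mem hw]
        · rw [hχ, indicator_of_notMem hw, indicator_of_notMem hw]; simp
      simp_rw [e1]
      rw [setIntegral_indicator measurableSet_Ioo, inter_eq_self_of_subset_right hIsub,
        integral_const_mul, Complex.re_ofReal_mul, ← integral_re_inv_sub hr,
        intervalIntegral.integral_of_le (by linarith), integral_Ioc_eq_integral_Ioo]
      congr 1
      exact (Complex.reCLM.integral_comp_comm
        (hc.integrableOn_Icc.mono_set Ioo_subset_Icc_self)).symm
    have hre : Tendsto (fun r => (J r).re) l (𝓝 x) := (Complex.continuous_re.tendsto _).comp hJ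
    have him : Tendsto (fun r => (J r).im) l (𝓝 0) := (Complex.continuous_im.tendsto _).comp hJ
    have hlog : ∀ c : ℝ, c ^ 2 = δ ^ 2 →
        Tendsto (fun r => Real.log ((x + c - (J r).re) ^ 2 + (J r).im ^ 2) / 2) l
          (𝓝 (Real.log (δ ^ 2) / 2)) := by
      intro c hc
      have h1 := (((hre.const_sub (x + c)).pow 2).add (him.pow 2))
      rw [show (x + c - x) ^ 2 + (0 : ℝ) ^ 2 = δ ^ 2 by rw [← hc]; ring] at h1
      exact (h1.log (by positivity)).div_const 2
    have h2 := ((hlog δ rfl).sub (hlog (-δ) (by ring))).const_mul (ψ x)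
    rw [sub_self, mul_zero] at h2
    refine h2.congr' ?_
    filter_upwards [hJim] with r hr
    rw [e r hr, ← sub_eq_add_neg x δ]
  have hsum : L = ∫ w in I, ψ₁ w * (w - x)⁻¹ := by
    have h := hlim2.add hlim3
    rw [add_zero] at h
    refine tendsto_nhds_unique hL (h.congr' ?_)
    filter_upwards [hJim] with r hr
    have hne : ∀ w : ℝ, (w : ℂ) - J r ≠ 0 := fun w h => hr (by rw [← sub_eq_zero.1 h]; simp)
    have hc : Continuous fun w : ℝ => ((w : ℂ) - J r)⁻¹ := Continuous.inv₀ (by fun_prop) hne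
    obtain ⟨K, hK⟩ : ∃ K, ∀ w : ℝ, ‖((w : ℂ) - J r)⁻¹‖ ≤ K := by
      refine ⟨|(J r).im|⁻¹, fun w => ?_⟩
      rw [norm_inv]
      have := Complex.abs_im_le_norm ((w : ℂ) - J r)
      simp only [Complex.sub_im, Complex.ofReal_im, zero_sub, abs_neg] at this
      have h0 := abs_pos.2 hr
      gcongr
    have hi : ∀ f : ℝ → ℝ, IntegrableOn f I →
        IntegrableOn (fun w => (f w : ℂ) * ((w : ℂ) - J r)⁻¹) I := fun f hf =>
      Integrable.mul_bdd (c := K) hf.ofReal hc.aestronglyMeasurable (ae_of_all _ hK)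
    rw [← Complex.add_re, ← integral_add (hi _ hψ₁i) (hi _ hχi)]
    congr 2; ext w
    simp only [hψ₁]; push_cast; ring
  rw [hsum]
  refine hlim1.congr' ?_
  filter_upwards [self_mem_nhdsWithin] with ε hε
  have hε0 : (0 : ℝ) < ε := hε
  have hms : MeasurableSet {w : ℝ | ε < |w - x|} := measurableSet_lt measurable_const (by fun_prop)
  have hmI : MeasurableSet (I ∩ {w : ℝ | ε < |w - x|}) := measurableSet_Ioo.inter hms
  have hbi : ∀ f : ℝ → ℝ, IntegrableOn f I →
      IntegrableOn (fun w => f w * (w - x)⁻¹) (I ∩ {w | ε < |w - x|}) := fun f hf => by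
    refine Integrable.mul_bdd (c := ε⁻¹) (hf.mono_set inter_subset_left)
      hmeasx.aestronglyMeasurable ?_
    filter_upwards [ae_restrict_mem hmI] with w hw
    rw [norm_inv, Real.norm_eq_abs]
    have := hw.2
    simp only [mem_ofPred_eq] at this
    gcongr
  have hχ0 : ∫ w in I ∩ {w | ε < |w - x|}, χ w * (w - x)⁻¹ = 0 := by
    have e1 : ∀ w, χ w * (w - x)⁻¹ =
        (Ioo (x - δ) (x + δ)).indicator (fun w : ℝ => ψ x * (w - x)⁻¹) w := by
      intro w
      by_cases hw : w ∈ Ioo (x - δ) (x + δ)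
      · rw [hχ, indicator_of_mem hw, indicator_of_mem hw]
      · rw [hχ, indicator_of_notMem hw, indicator_of_notMem hw, zero_mul]
    simp_rw [e1]
    rw [setIntegral_indicator measurableSet_Ioo]
    have e2 : I ∩ {w | ε < |w - x|} ∩ Ioo (x - δ) (x + δ) =
        {w : ℝ | ε < |w - x| ∧ |w - x| < δ} := by
      ext w
      constructor
      · rintro ⟨⟨_, h1⟩, h2⟩; exact ⟨h1, (hN w).1 h2⟩
      · rintro ⟨h1, h2⟩; exact ⟨⟨hIsub ((hN w).2 h2), h1⟩, (hN w).2 h2⟩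
    rw [e2, integral_const_mul, setIntegral_inv_sub_eq_zero, mul_zero]
  rw [← add_zero (∫ w in I ∩ {w | ε < |w - x|}, ψ₁ w * (w - x)⁻¹), ← hχ0,
    ← integral_add (hbi _ hψ₁i) (hbi _ hχi)]
  congr 1; ext w
  simp only [hψ₁]; ring

/-! ### The Hilbert transform on [-1, 1] as a radial limit of the remainder -/

section

variable {B : Finset ℝ} {m : ℕ} {P : ℝ[X]} {α β γ : ℝ}

lemma joukowski_sub {ζ : ℂ} (h0 : ζ ≠ 0) (w : ℂ) :
    2 * ζ * (joukowski ζ - w) = 1 - 2 * w * ζ + ζ ^ 2 := by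
  rw [joukowski]; field_simp; ring

lemma joukowski_im (r θ : ℝ) :
    (joukowski (r * Complex.exp (θ * Complex.I))).im = (r - r⁻¹) * Real.sin θ / 2 := by
  have h : ((r : ℂ) * Complex.exp (θ * Complex.I))⁻¹ =
      (r⁻¹ : ℝ) * Complex.exp ((-θ : ℝ) * Complex.I) := by
    rw [mul_inv, ← Complex.exp_neg]; push_cast; ring_nf
  rw [joukowski, h, show (2 : ℂ) = ((2 : ℝ) : ℂ) by simp, Complex.div_ofReal_im, Complex.add_im,
    Complex.im_ofReal_mul, Complex.im_ofReal_mul, Complex.exp_ofReal_mul_I_im,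
    Complex.exp_ofReal_mul_I_im, Real.sin_neg]
  ring

/-- The denominator of the sine kernel is 2ζ(J(ζ) - cos φ), so the substitution w = cos φ turns the
sine kernel formula into a Cauchy integral. -/
lemma IsRemainder.eq_cauchyTransform (hB : ↑B ⊆ Icc (-1 : ℝ) 1) {h : ℂ → ℂ}
    (H : IsRemainder B P α β γ h) {ζ : ℂ} (hζ : ‖ζ‖ < 1) (h0 : ζ ≠ 0) :
    Real.pi * h ζ = ∫ w in Ioo (-1 : ℝ) 1,
      (((rootQuot B P w).re * √(1 - w ^ 2) : ℝ) : ℂ) * ((w : ℂ) - joukowski ζ)⁻¹ := by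
  have hc := integral_comp_cos Real.pi_pos.le le_rfl fun w : ℝ =>
    (((rootQuot B P w).re * √(1 - w ^ 2) : ℝ) : ℂ) * ((w : ℂ) - joukowski ζ)⁻¹
  rw [Real.cos_pi] at hc
  rw [H.eq_integral hB hζ, ← hc]
  refine setIntegral_congr_fun measurableSet_Ioo fun φ hφ => ?_
  have hs : √(1 - Real.cos φ ^ 2) = Real.sin φ := by
    rw [← Real.sin_sq, Real.sqrt_sq (Real.sin_pos_of_mem_Ioo hφ).le]
  have hd := sineKernel_denom_ne_zero hζ φ
  have e : 1 - 2 * ζ * (Real.cos φ : ℝ) + ζ ^ 2 = 2 * ζ * (joukowski ζ - (Real.cos φ : ℝ)) := by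
    rw [joukowski_sub h0]; ring
  rw [e] at hd
  have hne : joukowski ζ - (Real.cos φ : ℝ) ≠ 0 := right_ne_zero_of_mul hd
  have hne' : (Real.cos φ : ℝ) - joukowski ζ ≠ 0 := by rw [← neg_sub]; exact neg_ne_zero.2 hne
  simp only [Complex.real_smul]
  rw [hs, sineKernel, e, boundaryIm, ← neg_sub (joukowski ζ), inv_neg]
  generalize joukowski ζ - (Real.cos φ : ℝ) = D at *
  push_cast
  field_simp

/-- The finite Hilbert transform of `P √(1 - x²) / ∏ (x - b)^{1/2}`. -/
theorem HasExpansion.tendsto_hilbert (hB : ↑B ⊆ Icc (-1 : ℝ) 1) (hm : B.card = 2 * m)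
    (hP : HasExpansion B m P α β γ) {x : ℝ} (hx : x ∈ Ioo (-1 : ℝ) 1) (hxB : x ∉ B) :
    Tendsto (fun ε => ∫ w in Ioo (-1 : ℝ) 1 ∩ {w | ε < |w - x|},
      ((rootQuot B P w).re * √(1 - w ^ 2)) * (w - x)⁻¹) (𝓝[>] 0)
      (𝓝 (Real.pi * (-(√(1 - x ^ 2) * (rootQuot B P x).im) - (α * x ^ 2 + β * x + γ)))) := by
  obtain ⟨h, H⟩ := hP.exists_isRemainder hB hm
  obtain ⟨θ, hθ, rfl⟩ : x ∈ Real.cos '' Ioo 0 Real.pi := by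
    rw [cos_image_Ioo Real.pi_pos.le le_rfl, Real.cos_pi]; exact hx
  have hs : √(1 - Real.cos θ ^ 2) = Real.sin θ := by
    rw [← Real.sin_sq, Real.sqrt_sq (Real.sin_pos_of_mem_Ioo hθ).le]
  have hle : ∀ w : ℝ, √(1 - w ^ 2) ≤ 1 := fun w => Real.sqrt_le_one.2 (by nlinarith [sq_nonneg w])
  refine tendsto_principalValue (l := 𝓝[<] 1)
    (J := fun r : ℝ => joukowski (r * Complex.exp (θ * Complex.I))) ?_ hx ?_ ?_ ?_ ?_ ?_
  · refine Integrable.mul_bdd (c := 1) (integrableOn_rootQuot hB hm P).re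
      (Measurable.aestronglyMeasurable (by fun_prop)) (ae_of_all _ fun w => ?_)
    rw [Real.norm_of_nonneg (Real.sqrt_nonneg _)]
    exact hle w
  · have h1 : DifferentiableAt ℝ (rootQuot B P) (Real.cos θ) := by
      unfold rootQuot
      refine DifferentiableAt.div ?_ (differentiableAt_rootProd hxB) (rootProd_ne_zero hxB)
      exact P.differentiableAt.hasDerivAt.ofReal_comp.differentiableAt
    have h2 : DifferentiableAt ℝ (fun w => (rootQuot B P w).re) (Real.cos θ) :=
      (Complex.reCLM.differentiableAt).comp _ h1
    refine h2.mul (DifferentiableAt.sqrt (by fun_prop) ?_)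
    rw [← Real.sin_sq]
    exact (pow_pos (Real.sin_pos_of_mem_Ioo hθ) 2).ne'
  · have hc := continuousAt_joukowski (Complex.exp_ne_zero (θ * Complex.I))
    have ht : Tendsto (fun r : ℝ => (r : ℂ) * Complex.exp (θ * Complex.I)) (𝓝[<] 1)
        (𝓝 (Complex.exp (θ * Complex.I))) := by
      have : Continuous fun r : ℝ => (r : ℂ) * Complex.exp (θ * Complex.I) := by fun_prop
      have := this.tendsto 1
      simp only [Complex.ofReal_one, one_mul] at this
      exact this.mono_left nhdsWithin_le_nhds
    have := hc.tendsto.comp ht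
    rwa [joukowski_exp] at this
  · filter_upwards [eventually_mem_Ioo_half] with r hr
    have hr0 : 0 < r := by linarith [hr.1]
    rw [joukowski_im]
    have h1 : 1 < r⁻¹ := (one_lt_inv₀ hr0).2 hr.2
    have h2 : r - r⁻¹ ≠ 0 := by linarith [hr.2]
    have := (Real.sin_pos_of_mem_Ioo hθ).ne'
    positivity
  -- The cone condition is `abs_cos_sub_le` with its quadratic written as 2ζ(J(ζ) - w); the constant
  -- 4 comes from |2ζ| ≤ 2.
  · filter_upwards [eventually_mem_Ioo_half] with r hr w hw
    have hr0 : 0 < r := by linarith [hr.1]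
    have h1 := abs_cos_sub_le (Ioo_subset_Icc_self hw) (r := r) ⟨hr0.le, hr.2.le⟩ θ
    have hne : (r : ℂ) * Complex.exp (θ * Complex.I) ≠ 0 := by
      rw [← norm_ne_zero_iff, norm_ofReal_mul_exp hr0.le]; exact hr0.ne'
    rw [← joukowski_sub hne, norm_mul, norm_mul, norm_ofReal_mul_exp hr0.le, norm_sub_rev,
      abs_sub_comm] at h1
    simp only [Complex.norm_ofNat] at h1
    nlinarith [norm_nonneg ((w : ℂ) - joukowski (r * Complex.exp (θ * Complex.I))), hr.2]
  · rw [hs]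
    refine ((H.tendsto_re hθ hxB).const_mul Real.pi).congr' ?_
    filter_upwards [eventually_mem_Ioo_half] with r hr
    have hr0 : 0 < r := by linarith [hr.1]
    have hne : (r : ℂ) * Complex.exp (θ * Complex.I) ≠ 0 := by
      rw [← norm_ne_zero_iff, norm_ofReal_mul_exp hr0.le]; exact hr0.ne'
    rw [← H.eq_cauchyTransform hB (by rw [norm_ofReal_mul_exp hr0.le]; exact hr.2) hne,
      Complex.re_ofReal_mul]

end

/-! ### Bands and gaps -/

/-- The indices of the bands which are not collapsed. -/
def openBands (n : ℕ) (a : ℕ → ℝ) : Finset ℕ :=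
  (Finset.range (n + 1)).filter fun k => a (2 * k) < a (2 * k + 1)

/-- The endpoints of the bands which are not collapsed. -/
def bandEnds (n : ℕ) (a : ℕ → ℝ) : Finset ℝ :=
  (openBands n a).biUnion fun k => {a (2 * k), a (2 * k + 1)}

/-- The monic polynomial which vanishes at the collapsed bands. -/
def collapsePoly (n : ℕ) (a : ℕ → ℝ) : ℝ[X] :=
  ∏ k ∈ Finset.range (n + 1) \ openBands n a, (X - C (a (2 * k)))

lemma prod_range_two_mul {M : Type*} [CommMonoid M] (f : ℕ → M) (N : ℕ) :
    ∏ j ∈ Finset.range (2 * N), f j = ∏ k ∈ Finset.range N, (f (2 * k) * f (2 * k + 1)) := by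
  induction N with
  | zero => simp
  | succ N ih =>
    rw [show 2 * (N + 1) = 2 * N + 1 + 1 by ring, Finset.prod_range_succ, Finset.prod_range_succ,
      ih, Finset.prod_range_succ, mul_assoc]

section endpoints

variable {n : ℕ} {a : ℕ → ℝ}

lemma IsEndpoints.le_succ (ha : IsEndpoints n a) {j : ℕ} (hj : j ≤ 2 * n) : a j ≤ a (j + 1) := by
  obtain ⟨k, hk | hk⟩ := Nat.even_or_odd' j
  · subst hk; exact ha.band k (by omega)
  · subst hk; exact (ha.gap k (by omega)).le

lemma IsEndpoints.mono (ha : IsEndpoints n a) {i j : ℕ} (hij : i ≤ j) (hj : j ≤ 2 * n + 1) :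
    a i ≤ a j := by
  induction j, hij using Nat.le_induction with
  | base => exact le_rfl
  | succ j _ ih => exact (ih (by omega)).trans (ha.le_succ (by omega))

lemma IsEndpoints.mem_Icc (ha : IsEndpoints n a) {j : ℕ} (hj : j ≤ 2 * n + 1) :
    a j ∈ Icc (-1 : ℝ) 1 := by
  rw [← ha.left, ← ha.right]
  exact ⟨ha.mono (Nat.zero_le _) hj, ha.mono hj le_rfl⟩

lemma mem_openBands {k : ℕ} : k ∈ openBands n a ↔ k ≤ n ∧ a (2 * k) < a (2 * k + 1) := by
  simp [openBands]

lemma mem_bandEnds {x : ℝ} :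
    x ∈ bandEnds n a ↔ ∃ k ∈ openBands n a, x = a (2 * k) ∨ x = a (2 * k + 1) := by
  simp [bandEnds]

lemma mem_support {x : ℝ} :
    x ∈ support n a ↔ ∃ j < n, x ∈ Icc (a (2 * j + 1)) (a (2 * j + 2)) := by
  simp only [support, mem_iUnion, Finset.mem_range, exists_prop]

lemma IsEndpoints.bandEnds_subset (ha : IsEndpoints n a) : ↑(bandEnds n a) ⊆ Icc (-1 : ℝ) 1 := by
  intro x hx
  obtain ⟨k, hk, rfl | rfl⟩ := mem_bandEnds.1 (Finset.mem_coe.1 hx)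
  all_goals exact ha.mem_Icc (by have := (mem_openBands.1 hk).1; omega)

lemma IsEndpoints.support_subset (ha : IsEndpoints n a) : support n a ⊆ Icc (-1) 1 := by
  intro x hx
  obtain ⟨j, hj, h1, h2⟩ := mem_support.1 hx
  exact ⟨(ha.mem_Icc (by omega)).1.trans h1, h2.trans (ha.mem_Icc (by omega)).2⟩

lemma measurableSet_support : MeasurableSet (support n a) :=
  Finset.measurableSet_biUnion _ fun _ _ => measurableSet_Icc

lemma IsEndpoints.lt_of_lt (ha : IsEndpoints n a) {k l : ℕ} (hkl : k < l) (hl : l ≤ n) :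
    a (2 * k + 1) < a (2 * l) :=
  (ha.gap k (by omega)).trans_le (ha.mono (by omega) (by omega))

lemma IsEndpoints.pairwiseDisjoint (ha : IsEndpoints n a) :
    (openBands n a : Set ℕ).PairwiseDisjoint
      fun k => ({a (2 * k), a (2 * k + 1)} : Finset ℝ) := by
  have key : ∀ k ∈ openBands n a, ∀ l ∈ openBands n a, k < l →
      Disjoint ({a (2 * k), a (2 * k + 1)} : Finset ℝ) {a (2 * l), a (2 * l + 1)} := by
    intro k hk l hl hkl
    have h1 := ha.lt_of_lt hkl (mem_openBands.1 hl).1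
    have h2 := (mem_openBands.1 hk).2
    have h3 := (mem_openBands.1 hl).2
    rw [Finset.disjoint_left]
    intro x hx hx'
    simp only [Finset.mem_insert, Finset.mem_singleton] at hx hx'
    rcases hx with rfl | rfl <;> rcases hx' with h | h <;> linarith
  intro k hk l hl hkl
  rcases hkl.lt_or_gt with h | h
  · exact key k hk l hl h
  · exact (key l hl k hk h).symm

lemma IsEndpoints.prod_bandEnds (ha : IsEndpoints n a) {M : Type*} [CommMonoid M] (f : ℝ → M) :
    ∏ b ∈ bandEnds n a, f b = ∏ k ∈ openBands n a, (f (a (2 * k)) * f (a (2 * k + 1))) := by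
  rw [bandEnds, Finset.prod_biUnion ha.pairwiseDisjoint]
  exact Finset.prod_congr rfl fun k hk => Finset.prod_pair (mem_openBands.1 hk).2.ne

lemma IsEndpoints.card_bandEnds (ha : IsEndpoints n a) :
    (bandEnds n a).card = 2 * (openBands n a).card := by
  rw [bandEnds, Finset.card_biUnion ha.pairwiseDisjoint,
    Finset.sum_congr rfl fun k hk => Finset.card_pair (mem_openBands.1 hk).2.ne]
  simp [mul_comm]

lemma IsEndpoints.eq_of_notMem_openBands (ha : IsEndpoints n a) {k : ℕ} (hk : k ≤ n)
    (h : k ∉ openBands n a) : a (2 * k + 1) = a (2 * k) :=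
  le_antisymm (not_lt.1 fun h' => h (mem_openBands.2 ⟨hk, h'⟩)) (ha.band k (by omega))

lemma openBands_subset : openBands n a ⊆ Finset.range (n + 1) := Finset.filter_subset _ _

/-- Splitting of a product over the endpoints into collapsed bands and branch points. -/
lemma IsEndpoints.prod_range (ha : IsEndpoints n a) {M : Type*} [CommMonoid M] (f : ℝ → M) :
    ∏ j ∈ Finset.range (2 * n + 2), f (a j) =
      (∏ k ∈ Finset.range (n + 1) \ openBands n a, f (a (2 * k)) * f (a (2 * k))) *
        ∏ b ∈ bandEnds n a, f b := by
  rw [show 2 * n + 2 = 2 * (n + 1) by ring, prod_range_two_mul, ha.prod_bandEnds,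
    ← Finset.prod_sdiff openBands_subset]
  congr 1
  refine Finset.prod_congr rfl fun k hk => ?_
  rw [Finset.mem_sdiff, Finset.mem_range] at hk
  rw [ha.eq_of_notMem_openBands (by omega) hk.2]

lemma collapsePoly_eval {x : ℝ} : (collapsePoly n a).eval x =
    ∏ k ∈ Finset.range (n + 1) \ openBands n a, (x - a (2 * k)) := by
  simp [collapsePoly, Polynomial.eval_prod]

/-- R₀ supplies the factors for the outermost endpoints ∓1. In the full product a collapsed band
occurs twice and its two equal roots multiply to a linear factor. -/
lemma IsEndpoints.R_mul_R₀ (ha : IsEndpoints n a) (x : ℝ) :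
    R n a x * R₀ x = ((collapsePoly n a).eval x : ℝ) * rootProd (bandEnds n a) x := by
  have h : R n a x * R₀ x = ∏ j ∈ Finset.range (2 * n + 2), csqrt ((x : ℂ) - a j) := by
    rw [Finset.prod_range_succ, Finset.prod_range_succ', ha.left, ha.right, R, R₀]
    push_cast
    rw [sub_neg_eq_add]
    ring
  rw [h, ha.prod_range fun b => csqrt ((x : ℂ) - b), rootProd, collapsePoly_eval]
  congr 1
  push_cast
  exact Finset.prod_congr rfl fun k _ => csqrt_mul_self _

lemma mem_endpoints {x : ℝ} : x ∈ endpoints n a ↔ ∃ j ≤ 2 * n + 1, a j = x := by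
  simp only [endpoints, mem_ofPred_eq, Finset.mem_range]
  constructor <;> rintro ⟨j, h1, h2⟩ <;> exact ⟨j, by omega, h2⟩

lemma finite_endpoints : (endpoints n a).Finite := by
  have : endpoints n a = a '' (Finset.range (2 * n + 2)) := by
    ext x; simp [endpoints]
  rw [this]
  exact (Finset.finite_toSet _).image _

lemma ae_notMem_endpoints (s : Set ℝ) : ∀ᵐ x ∂volume.restrict s, x ∉ endpoints n a :=
  ae_restrict_of_ae (by
    rw [ae_iff]
    simpa using finite_endpoints.measure_zero volume)

lemma bandEnds_subset_endpoints {x : ℝ} (hx : x ∈ bandEnds n a) : x ∈ endpoints n a := by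
  obtain ⟨k, hk, rfl | rfl⟩ := mem_bandEnds.1 hx
  all_goals exact mem_endpoints.2 ⟨_, by have := (mem_openBands.1 hk).1; omega, rfl⟩

lemma collapsePoly_eval_ne_zero {x : ℝ} (hx : x ∉ endpoints n a) :
    (collapsePoly n a).eval x ≠ 0 := by
  rw [collapsePoly_eval, Finset.prod_ne_zero_iff]
  intro k hk h
  rw [Finset.mem_sdiff, Finset.mem_range] at hk
  exact hx (mem_endpoints.2 ⟨2 * k, by omega, by linarith⟩)

/-- The common factor cancels only where it is nonzero: at a collapsed band the left-hand quotient
is 0/0, which evaluates to 0. -/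
lemma IsEndpoints.density_eq (ha : IsEndpoints n a) (P : ℝ[X]) {x : ℝ}
    (hx : x ∉ endpoints n a) :
    density n a ((collapsePoly n a * P).map (algebraMap ℝ ℂ)) x =
      rootQuot (bandEnds n a) P x := by
  have h := collapsePoly_eval_ne_zero hx
  have h' : (((collapsePoly n a).eval x : ℝ) : ℂ) ≠ 0 := by exact_mod_cast h
  have e : ((collapsePoly n a * P).map (algebraMap ℝ ℂ)).eval (x : ℂ) =
      (((collapsePoly n a).eval x : ℝ) : ℂ) * ((P.eval x : ℝ) : ℂ) := by
    rw [← Complex.ofReal_mul, ← Polynomial.eval_mul]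
    exact Polynomial.eval_map_algebraMap _ _ |>.trans
      (Polynomial.aeval_algebraMap_apply_eq_algebraMap_eval _ _)
  rw [density, ha.R_mul_R₀, e, rootQuot, mul_div_mul_left _ _ h']

lemma IsEndpoints.exists_mem_Icc (ha : IsEndpoints n a) {x : ℝ} (hx : x ∈ Icc (-1 : ℝ) 1) :
    ∃ k ≤ 2 * n, x ∈ Icc (a k) (a (k + 1)) := by
  by_contra! h
  have key : ∀ k ≤ 2 * n + 1, a k ≤ x := by
    intro k
    induction k with
    | zero => intro _; rw [ha.left]; exact hx.1
    | succ k ih =>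
      intro hk
      by_contra! hlt
      exact h k (by omega) ⟨ih (by omega), hlt.le⟩
  exact h (2 * n) le_rfl ⟨key _ (by omega), by rw [ha.right]; exact hx.2⟩

lemma IsEndpoints.mem_support_or (ha : IsEndpoints n a) {x : ℝ} (hx : x ∈ Icc (-1 : ℝ) 1)
    (hxe : x ∉ endpoints n a) :
    x ∈ support n a ∨ ∃ k ∈ openBands n a, x ∈ Ioo (a (2 * k)) (a (2 * k + 1)) := by
  obtain ⟨k, hk, h1, h2⟩ := ha.exists_mem_Icc hx
  obtain ⟨j, hj | hj⟩ := Nat.even_or_odd' k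
  · right
    subst hj
    have h3 : a (2 * j) < x := lt_of_le_of_ne h1 fun h => hxe (mem_endpoints.2 ⟨_, by omega, h⟩)
    have h4 : x < a (2 * j + 1) :=
      lt_of_le_of_ne h2 fun h => hxe (mem_endpoints.2 ⟨2 * j + 1, by omega, h.symm⟩)
    exact ⟨j, mem_openBands.2 ⟨by omega, h3.trans h4⟩, h3, h4⟩
  · left
    subst hj
    exact mem_support.2 ⟨j, by omega, h1, h2⟩

lemma IsEndpoints.le_or_le_of_mem_support (ha : IsEndpoints n a) {x : ℝ} (hx : x ∈ support n a)
    {k : ℕ} (hk : k ≤ n) : x ≤ a (2 * k) ∨ a (2 * k + 1) ≤ x := by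
  obtain ⟨j, hj, h1, h2⟩ := mem_support.1 hx
  rcases le_or_gt k j with h | h
  · exact Or.inr ((ha.mono (by omega) (by omega)).trans h1)
  · exact Or.inl (h2.trans (ha.mono (by omega) (by omega)))

/-! ### Phases -/

lemma csqrt_mul_csqrt_of_lt {x b c : ℝ} (hb : x ≤ b) (hc : x ≤ c) :
    csqrt ((x : ℂ) - b) * csqrt ((x : ℂ) - c) = ((-(√(b - x) * √(c - x)) : ℝ) : ℂ) := by
  rw [← Complex.ofReal_sub, ← Complex.ofReal_sub, csqrt_ofReal_of_nonpos (by linarith),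
    csqrt_ofReal_of_nonpos (by linarith), neg_sub, neg_sub]
  push_cast
  linear_combination (√(b - x) : ℂ) * (√(c - x) : ℂ) * Complex.I_sq

lemma csqrt_mul_csqrt_of_gt {x b c : ℝ} (hb : b ≤ x) (hc : c ≤ x) :
    csqrt ((x : ℂ) - b) * csqrt ((x : ℂ) - c) = ((√(x - b) * √(x - c) : ℝ) : ℂ) := by
  rw [← Complex.ofReal_sub, ← Complex.ofReal_sub, csqrt_ofReal_of_nonneg (by linarith),
    csqrt_ofReal_of_nonneg (by linarith), Complex.ofReal_mul]

lemma csqrt_mul_csqrt_of_mem {x b c : ℝ} (hb : b ≤ x) (hc : x ≤ c) :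
    csqrt ((x : ℂ) - b) * csqrt ((x : ℂ) - c) =
      Complex.I * ((√(x - b) * √(c - x) : ℝ) : ℂ) := by
  rw [← Complex.ofReal_sub, ← Complex.ofReal_sub, csqrt_ofReal_of_nonneg (by linarith),
    csqrt_ofReal_of_nonpos (by linarith), neg_sub, Complex.ofReal_mul]
  ring

/-- The real value of `((x - b)(x - c))^{1/2}` outside of `(b, c)`. -/
def pairRoot (b c x : ℝ) : ℝ := if x ≤ b then -(√(b - x) * √(c - x)) else √(x - b) * √(x - c)

lemma pairRoot_eq {x b c : ℝ} (hbc : b ≤ c) (hx : x ≤ b ∨ c ≤ x) :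
    csqrt ((x : ℂ) - b) * csqrt ((x : ℂ) - c) = (pairRoot b c x : ℂ) := by
  rw [pairRoot]
  split_ifs with h
  · exact csqrt_mul_csqrt_of_lt h (h.trans hbc)
  · exact csqrt_mul_csqrt_of_gt (not_le.1 h).le (hx.resolve_left h)

lemma pairRoot_neg {x b c : ℝ} (hbc : b ≤ c) (hx : x < b) : pairRoot b c x < 0 := by
  rw [pairRoot, if_pos hx.le]
  have h1 : 0 < √(b - x) := Real.sqrt_pos.2 (by linarith)
  have h2 : 0 < √(c - x) := Real.sqrt_pos.2 (by linarith)
  have := mul_pos h1 h2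
  linarith

lemma pairRoot_pos {x b c : ℝ} (hbc : b ≤ c) (hx : c < x) : 0 < pairRoot b c x := by
  rw [pairRoot, if_neg (by linarith)]
  have h1 : 0 < √(x - b) := Real.sqrt_pos.2 (by linarith)
  have h2 : 0 < √(x - c) := Real.sqrt_pos.2 (by linarith)
  positivity

/-- A point of Γ has every open band entirely on one side, so both roots of a pair are real or both
are imaginary. -/
lemma IsEndpoints.rootProd_eq_of_mem_support (ha : IsEndpoints n a) {x : ℝ}
    (hx : x ∈ support n a) : rootProd (bandEnds n a) x =
      ((∏ k ∈ openBands n a, pairRoot (a (2 * k)) (a (2 * k + 1)) x : ℝ) : ℂ) := by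
  rw [rootProd, ha.prod_bandEnds fun b => csqrt ((x : ℂ) - b)]
  push_cast
  refine Finset.prod_congr rfl fun k hk => ?_
  obtain ⟨h1, h2⟩ := mem_openBands.1 hk
  exact pairRoot_eq h2.le (ha.le_or_le_of_mem_support hx h1)

lemma IsEndpoints.le_or_le_of_mem_band (ha : IsEndpoints n a) {x : ℝ} {k l : ℕ}
    (hk : k ≤ n) (hx : x ∈ Ioo (a (2 * k)) (a (2 * k + 1))) (hl : l ≤ n) (hlk : l ≠ k) :
    (k < l ∧ x < a (2 * l)) ∨ (l < k ∧ a (2 * l + 1) < x) := by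
  rcases hlk.lt_or_gt with h | h
  · exact Or.inr ⟨h, (ha.lt_of_lt h hk).trans hx.1⟩
  · exact Or.inl ⟨h, hx.2.trans (ha.lt_of_lt h hl)⟩

/-- Inside a band exactly one pair straddles x, and it alone contributes a factor i. -/
lemma IsEndpoints.rootProd_eq_of_mem_band (ha : IsEndpoints n a) {x : ℝ} {k : ℕ}
    (hk : k ∈ openBands n a) (hx : x ∈ Ioo (a (2 * k)) (a (2 * k + 1))) :
    rootProd (bandEnds n a) x = Complex.I *
      ((√(x - a (2 * k)) * √(a (2 * k + 1) - x) *
        ∏ l ∈ (openBands n a).erase k, pairRoot (a (2 * l)) (a (2 * l + 1)) x : ℝ) : ℂ) := by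
  rw [rootProd, ha.prod_bandEnds fun b => csqrt ((x : ℂ) - b),
    ← Finset.mul_prod_erase _ _ hk, csqrt_mul_csqrt_of_mem hx.1.le hx.2.le]
  push_cast
  rw [mul_assoc]
  congr 2
  refine Finset.prod_congr rfl fun l hl => ?_
  obtain ⟨h0, hl⟩ := Finset.mem_erase.1 hl
  obtain ⟨h1, h2⟩ := mem_openBands.1 hl
  exact pairRoot_eq h2.le ((ha.le_or_le_of_mem_band (mem_openBands.1 hk).1 hx h1 h0).imp
    (fun h => h.2.le) fun h => h.2.le)

lemma IsEndpoints.rootQuot_im_of_mem_support (ha : IsEndpoints n a) (P : ℝ[X]) {x : ℝ}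
    (hx : x ∈ support n a) : (rootQuot (bandEnds n a) P x).im = 0 := by
  rw [rootQuot, ha.rootProd_eq_of_mem_support hx, ← Complex.ofReal_div, Complex.ofReal_im]

lemma IsEndpoints.rootQuot_of_mem_band (ha : IsEndpoints n a) (P : ℝ[X]) {x : ℝ} {k : ℕ}
    (hk : k ∈ openBands n a) (hx : x ∈ Ioo (a (2 * k)) (a (2 * k + 1))) :
    rootQuot (bandEnds n a) P x = -Complex.I *
      ((P.eval x / (√(x - a (2 * k)) * √(a (2 * k + 1) - x) *
        ∏ l ∈ (openBands n a).erase k, pairRoot (a (2 * l)) (a (2 * l + 1)) x) : ℝ) : ℂ) := by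
  rw [rootQuot, ha.rootProd_eq_of_mem_band hk hx, Complex.ofReal_div, div_mul_eq_div_div,
    div_eq_mul_inv (_ : ℂ) Complex.I, Complex.inv_I]
  ring

lemma IsEndpoints.rootQuot_re_of_mem_band (ha : IsEndpoints n a) (P : ℝ[X]) {x : ℝ} {k : ℕ}
    (hk : k ∈ openBands n a) (hx : x ∈ Ioo (a (2 * k)) (a (2 * k + 1))) :
    (rootQuot (bandEnds n a) P x).re = 0 := by
  rw [ha.rootQuot_of_mem_band P hk hx]
  simp only [neg_mul, Complex.neg_re, Complex.re_mul_ofReal, Complex.I_re, zero_mul, neg_zero]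

end endpoints

/-! ### Integrals over the support and over the bands -/

section bands

variable {n : ℕ} {a : ℕ → ℝ} {P : ℝ[X]} {α β γ : ℝ}

lemma IsEndpoints.notMem_support_of_mem_band (ha : IsEndpoints n a) {x : ℝ} {k : ℕ}
    (hk : k ≤ n) (hx : x ∈ Ioo (a (2 * k)) (a (2 * k + 1))) : x ∉ support n a := by
  intro h
  rcases ha.le_or_le_of_mem_support h hk with h | h
  · exact absurd h (not_le.2 hx.1)
  · exact absurd h (not_le.2 hx.2)

/-- The real part vanishes on the open bands. The set S is there for the truncations in the
principal value. -/
lemma IsEndpoints.setIntegral_support (ha : IsEndpoints n a) {f : ℝ → ℝ}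
    (hf : ∀ x, (rootQuot (bandEnds n a) P x).re = 0 → f x = 0) {S : Set ℝ}
    (hS : MeasurableSet S) :
    ∫ x in Ioo (-1) 1 ∩ S, f x = ∫ x in support n a ∩ S, f x := by
  have h1 : (Ioo (-1) 1 ∩ S : Set ℝ) =ᵐ[volume] (Icc (-1) 1 ∩ S : Set ℝ) :=
    Ioo_ae_eq_Icc.inter (ae_eq_refl S)
  rw [setIntegral_congr_set h1]
  refine setIntegral_eq_of_subset_of_ae_sdiff_eq_zero
    (measurableSet_Icc.inter hS).nullMeasurableSet
    (inter_subset_inter_left S ha.support_subset) ?_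
  have h2 := ae_notMem_endpoints (n := n) (a := a) univ
  rw [Measure.restrict_univ] at h2
  filter_upwards [h2] with x hx hx'
  rcases ha.mem_support_or hx'.1.1 hx with h | ⟨k, hk, h⟩
  · exact absurd ⟨h, hx'.1.2⟩ hx'.2
  · exact hf x (ha.rootQuot_re_of_mem_band P hk h)

/-- The integral of `-i P / ∏ (x - b)^{1/2}` over the band with index `k`. -/
def bandIntegral (n : ℕ) (a : ℕ → ℝ) (P : ℝ[X]) (k : ℕ) : ℝ :=
  ∫ x in Ioo (a (2 * k)) (a (2 * k + 1)), (rootQuot (bandEnds n a) P x).im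

lemma IsEndpoints.integrableOn_rootQuot (ha : IsEndpoints n a) (P : ℝ[X]) :
    IntegrableOn (rootQuot (bandEnds n a) P) (Ioo (-1) 1) :=
  DefNLS.integrableOn_rootQuot ha.bandEnds_subset ha.card_bandEnds P

lemma IsEndpoints.band_subset (ha : IsEndpoints n a) {k : ℕ} (hk : k ≤ n) :
    Ioo (a (2 * k)) (a (2 * k + 1)) ⊆ Ioo (-1) 1 :=
  Ioo_subset_Ioo (ha.mem_Icc (by omega)).1 (ha.mem_Icc (by omega)).2

lemma IsEndpoints.integrableOn_band (ha : IsEndpoints n a) (P : ℝ[X]) {k : ℕ} (hk : k ≤ n) :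
    IntegrableOn (rootQuot (bandEnds n a) P) (Ioo (a (2 * k)) (a (2 * k + 1))) :=
  (ha.integrableOn_rootQuot P).mono_set (ha.band_subset hk)

lemma IsEndpoints.disjoint_bands (ha : IsEndpoints n a) :
    (openBands n a : Set ℕ).Pairwise
      (Function.onFun Disjoint fun k => Ioo (a (2 * k)) (a (2 * k + 1))) := by
  intro k hk l hl hkl
  refine Set.disjoint_left.2 fun x hx hx' => ?_
  rcases ha.le_or_le_of_mem_band (mem_openBands.1 hk).1 hx (mem_openBands.1 hl).1 hkl.symm
    with h | h
  · exact absurd hx'.1 (not_lt.2 h.2.le)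
  · exact absurd hx'.2 (not_lt.2 h.2.le)

/-- The integral of `Im P / ∏ (x - b)^{1/2}` over `(z, 1)` is the sum over the bands in it. -/
lemma IsEndpoints.integral_im (ha : IsEndpoints n a) (P : ℝ[X]) {z : ℝ} (hz : -1 ≤ z)
    (hzb : ∀ k ≤ n, z ≤ a (2 * k) ∨ a (2 * k + 1) ≤ z) :
    ∫ x in Ioo z 1, (rootQuot (bandEnds n a) P x).im =
      ∑ k ∈ (openBands n a).filter (fun k => z ≤ a (2 * k)), bandIntegral n a P k := by
  set F := (openBands n a).filter (fun k => z ≤ a (2 * k))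
  have hF : ∀ k ∈ F, k ∈ openBands n a := fun k hk => (Finset.mem_filter.1 hk).1
  unfold bandIntegral
  have hint : ∀ k ∈ F, IntegrableOn (fun x => (rootQuot (bandEnds n a) P x).im)
      (Ioo (a (2 * k)) (a (2 * k + 1))) := fun k hk =>
    (ha.integrableOn_band P (mem_openBands.1 (hF k hk)).1).im
  rw [← integral_biUnion_finset F (fun _ _ => measurableSet_Ioo)
    (ha.disjoint_bands.mono fun k hk => hF k hk) hint]
  refine setIntegral_eq_of_subset_of_ae_sdiff_eq_zero measurableSet_Ioo.nullMeasurableSet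
    (iUnion₂_subset fun k hk => Ioo_subset_Ioo (Finset.mem_filter.1 hk).2
      (ha.mem_Icc (by have := (mem_openBands.1 (hF k hk)).1; omega)).2) ?_
  have h2 := ae_notMem_endpoints (n := n) (a := a) univ
  rw [Measure.restrict_univ] at h2
  filter_upwards [h2] with x hx hx'
  rcases ha.mem_support_or ⟨hz.trans hx'.1.1.le, hx'.1.2.le⟩ hx with h | ⟨k, hk, h⟩
  · exact ha.rootQuot_im_of_mem_support P h
  · refine absurd (mem_iUnion₂.2 ⟨k, Finset.mem_filter.2 ⟨hk, ?_⟩, h⟩) hx'.2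
    exact (hzb k (mem_openBands.1 hk).1).resolve_right
      (not_le.2 (hx'.1.1.trans h.2))

lemma integral_cos_sq_add (α β γ θ : ℝ) (hθ : 0 ≤ θ) :
    ∫ t in Ioo 0 θ, (α * Real.cos t ^ 2 + β * Real.cos t + γ) =
      α / 2 * (Real.sin θ * Real.cos θ) + β * Real.sin θ + (γ + α / 2) * θ := by
  rw [← integral_Ioc_eq_integral_Ioo, ← intervalIntegral.integral_of_le hθ]
  rw [intervalIntegral.integral_add, intervalIntegral.integral_add,
    intervalIntegral.integral_const_mul, intervalIntegral.integral_const_mul, integral_cos_sq,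
    integral_cos, intervalIntegral.integral_const]
  · simp; ring
  all_goals exact Continuous.intervalIntegrable (by fun_prop) _ _

/-- Evaluate the potential formula at θ = π, where K(-1, w) = 0. This sum rule ties the constant γ
to the band conditions, and makes one of them redundant once α and γ are known. -/
lemma IsEndpoints.sum_bandIntegral (ha : IsEndpoints n a)
    (hP : HasExpansion (bandEnds n a) (openBands n a).card P α β γ) :
    ∑ k ∈ openBands n a, bandIntegral n a P k = -(Real.pi * (γ + α / 2)) := by
  have h := hP.integral_kernel ha.bandEnds_subset ha.card_bandEnds (θ := Real.pi)
    ⟨Real.pi_pos.le, le_rfl⟩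
  have h0 : ∀ w ∈ Ioo (-1 : ℝ) 1,
      kernel (Real.cos Real.pi) w * (rootQuot (bandEnds n a) P w).re = 0 := by
    intro w hw
    have : kernel (Real.cos Real.pi) w = 0 := by
      rw [Real.cos_pi, kernel_eq (by norm_num) (Ioo_subset_Icc_self hw), abs_of_neg (by linarith [hw.1])]
      have : 1 + w ≠ 0 := by linarith [hw.1]
      rw [show (1 - -1 * w + √(1 - (-1) ^ 2) * √(1 - w ^ 2)) / -(-1 - w) = 1 by
        rw [show (1 : ℝ) - (-1) ^ 2 = 0 by norm_num, Real.sqrt_zero, div_eq_one_iff_eq (by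
          intro h; exact this (by linarith))]; ring, Real.log_one]
    rw [this, zero_mul]
  rw [setIntegral_congr_fun measurableSet_Ioo h0, integral_zero, Real.cos_pi,
    ha.integral_im P le_rfl fun k hk => Or.inl (ha.mem_Icc (by omega)).1,
    integral_cos_sq_add _ _ _ _ Real.pi_pos.le, Real.sin_pi,
    Finset.filter_true_of_mem fun k hk =>
      (ha.mem_Icc (by have := (mem_openBands.1 hk).1; omega)).1] at h
  rcases mul_eq_zero.1 h.symm with h | h
  · exact absurd h Real.pi_pos.ne'
  · linarith

/-- The potential of `P / ∏ (x - b)^{1/2}` on the support. -/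
lemma IsEndpoints.integral_kernel (ha : IsEndpoints n a)
    (hP : HasExpansion (bandEnds n a) (openBands n a).card P α β γ)
    (h0 : ∀ k ∈ openBands n a, bandIntegral n a P k = 0) {z : ℝ} (hz : z ∈ support n a) :
    ∫ w in support n a, kernel z w * (rootQuot (bandEnds n a) P w).re =
      Real.pi * ((α / 2 * z + β) * √(1 - z ^ 2)) := by
  have hz' := ha.support_subset hz
  have h := hP.integral_kernel ha.bandEnds_subset ha.card_bandEnds (θ := Real.arccos z)
    ⟨Real.arccos_nonneg z, Real.arccos_le_pi z⟩
  have hs := ha.sum_bandIntegral hP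
  rw [Finset.sum_eq_zero h0] at hs
  have hγ : γ + α / 2 = 0 := by
    rcases mul_eq_zero.1 (show Real.pi * (γ + α / 2) = 0 by linarith) with h | h
    · exact absurd h Real.pi_pos.ne'
    · exact h
  rw [integral_cos_sq_add _ _ _ _ (Real.arccos_nonneg z), Real.cos_arccos hz'.1 hz'.2,
    Real.sin_arccos, ha.integral_im P hz'.1 fun k hk => ha.le_or_le_of_mem_support hz hk,
    Finset.sum_eq_zero fun k hk => h0 k (Finset.mem_filter.1 hk).1, hγ] at h
  have e := ha.setIntegral_support (P := P)
    (f := fun w => kernel z w * (rootQuot (bandEnds n a) P w).re)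
    (fun x hx => by rw [hx, mul_zero]) MeasurableSet.univ
  rw [inter_univ, inter_univ] at e
  rw [← e, h]
  ring

lemma IsEndpoints.interior_subset (ha : IsEndpoints n a) {x : ℝ}
    (hx : x ∈ interior (support n a)) : x ∈ Ioo (-1 : ℝ) 1 ∧ x ∉ bandEnds n a := by
  constructor
  · have := interior_mono ha.support_subset hx
    rwa [interior_Icc] at this
  · intro hxB
    obtain ⟨k, hk, h⟩ := mem_bandEnds.1 hxB
    obtain ⟨hk, hlt⟩ := mem_openBands.1 hk
    have hcl : x ∈ closure (Ioo (a (2 * k)) (a (2 * k + 1))) := by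
      rw [closure_Ioo hlt.ne]
      rcases h with rfl | rfl
      · exact left_mem_Icc.2 hlt.le
      · exact right_mem_Icc.2 hlt.le
    obtain ⟨y, hy1, hy2⟩ := mem_closure_iff.1 hcl _ isOpen_interior hx
    exact ha.notMem_support_of_mem_band hk hy2 (_root_.interior_subset hy1)

/-- The numerator `collapsePoly * P`, over `ℂ`, of the density `P / ∏ (x - b)^{1/2}`. -/
abbrev liftPoly (n : ℕ) (a : ℕ → ℝ) (P : ℝ[X]) : ℂ[X] :=
  (collapsePoly n a * P).map (algebraMap ℝ ℂ)

lemma IsEndpoints.density_ae (ha : IsEndpoints n a) (P : ℝ[X]) (s : Set ℝ) :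
    density n a (liftPoly n a P) =ᵐ[volume.restrict s] rootQuot (bandEnds n a) P := by
  filter_upwards [ae_notMem_endpoints (n := n) (a := a) s] with x hx using ha.density_eq P hx

lemma IsEndpoints.rootQuot_of_mem_support (ha : IsEndpoints n a) (P : ℝ[X]) {x : ℝ}
    (hx : x ∈ support n a) :
    rootQuot (bandEnds n a) P x = ((rootQuot (bandEnds n a) P x).re : ℂ) :=
  Complex.ext rfl (by simp [ha.rootQuot_im_of_mem_support P hx])

lemma IsEndpoints.support_ae_subset (ha : IsEndpoints n a) {E : Type*} [NormedAddCommGroup E]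
    {f : ℝ → E} (hf : IntegrableOn f (Ioo (-1) 1)) : IntegrableOn f (support n a) :=
  ((integrableOn_Icc_iff_integrableOn_Ioo (a := (-1 : ℝ)) (b := 1)).2 hf).mono_set
    ha.support_subset

/-- On Γ the imaginary part of the quotient is zero, so in `HasExpansion.tendsto_hilbert` only the
quadratic polynomial remains. No band condition is involved. -/
lemma IsEndpoints.hasFHT (ha : IsEndpoints n a)
    (hP : HasExpansion (bandEnds n a) (openBands n a).card P α β γ) {x : ℝ}
    (hx : x ∈ interior (support n a)) :
    HasFHT (support n a) (fun w => density n a (liftPoly n a P) w * ‖R₀ w‖) x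
      (-(α * x ^ 2 + β * x + γ) : ℝ) := by
  obtain ⟨hx1, hx2⟩ := ha.interior_subset hx
  have hm := measurableSet_support (n := n) (a := a)
  set U := rootQuot (bandEnds n a) P
  have hae : ∀ S : Set ℝ, S ⊆ support n a → MeasurableSet S →
      (fun w => density n a (liftPoly n a P) w * ‖R₀ w‖) =ᵐ[volume.restrict S]
        fun w => (((U w).re * √(1 - w ^ 2) : ℝ) : ℂ) := by
    intro S hS hSm
    filter_upwards [ha.density_ae P S, ae_restrict_mem hSm] with w hw hwS
    rw [hw, ha.rootQuot_of_mem_support P (hS hwS), norm_R₀ (ha.support_subset (hS hwS))]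
    push_cast; rfl
  constructor
  · refine Integrable.congr ?_ (hae _ subset_rfl hm).symm
    refine Integrable.ofReal ?_
    have := ha.support_ae_subset (ha.integrableOn_rootQuot P)
    refine this.re.mul_bdd (c := 1) ?_ ?_
    · exact (Continuous.aestronglyMeasurable (by fun_prop))
    · refine Eventually.of_forall fun w => ?_
      rw [Real.norm_of_nonneg (Real.sqrt_nonneg _)]
      exact Real.sqrt_le_one.2 (by nlinarith [sq_nonneg w])
  · have h := hP.tendsto_hilbert ha.bandEnds_subset ha.card_bandEnds hx1 hx2
    rw [ha.rootQuot_im_of_mem_support P (_root_.interior_subset hx)] at h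
    have h2 := ((Complex.continuous_ofReal.tendsto _).comp (h.const_mul Real.pi⁻¹))
    have e : (fun ε : ℝ => (1 / (Real.pi : ℂ)) * ∫ w in support n a ∩ {w : ℝ | ε < |w - x|},
        density n a (liftPoly n a P) w * ‖R₀ w‖ / ((w : ℂ) - x)) =
        Complex.ofReal ∘ fun ε => Real.pi⁻¹ * ∫ w in Ioo (-1) 1 ∩ {w | ε < |w - x|},
          ((U w).re * √(1 - w ^ 2)) * (w - x)⁻¹ := by
      funext ε
      have hS : MeasurableSet {w : ℝ | ε < |w - x|} :=
        measurableSet_lt measurable_const (by fun_prop)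
      simp only [Function.comp]
      rw [ha.setIntegral_support (P := P) (f := fun w => (U w).re * √(1 - w ^ 2) * (w - x)⁻¹)
        (fun w hw => by
          have hw : (U w).re = 0 := hw
          simp only [hw, zero_mul]) hS]
      simp only [Complex.ofReal_mul, Complex.ofReal_inv, one_div]
      rw [← integral_complex_ofReal]
      congr 1
      refine integral_congr_ae ?_
      filter_upwards [hae _ inter_subset_left (hm.inter hS)] with w hw
      rw [hw]
      push_cast
      rw [div_eq_mul_inv]
    rw [e]
    convert h2 using 2
    congr 1
    field_simp [Real.pi_pos.ne']
    ring

lemma IsEndpoints.rootQuot_of_mem_band' (ha : IsEndpoints n a) (P : ℝ[X]) {x : ℝ} {k : ℕ}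
    (hk : k ∈ openBands n a) (hx : x ∈ Ioo (a (2 * k)) (a (2 * k + 1))) :
    rootQuot (bandEnds n a) P x = ((rootQuot (bandEnds n a) P x).im : ℂ) * Complex.I :=
  Complex.ext (by simp [ha.rootQuot_re_of_mem_band P hk hx]) (by simp)

lemma IsEndpoints.intervalIntegral_density (ha : IsEndpoints n a) (P : ℝ[X]) {k : ℕ}
    (hk : k ∈ openBands n a) :
    ∫ x in (a (2 * k))..(a (2 * k + 1)), density n a (liftPoly n a P) x =
      (bandIntegral n a P k : ℂ) * Complex.I := by
  rw [intervalIntegral.integral_of_le (mem_openBands.1 hk).2.le, integral_Ioc_eq_integral_Ioo,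
    integral_congr_ae (ha.density_ae P _), bandIntegral, ← integral_complex_ofReal,
    ← integral_mul_const]
  exact setIntegral_congr_fun measurableSet_Ioo fun x hx => ha.rootQuot_of_mem_band' P hk hx

lemma IsEndpoints.intervalIntegrable_density (ha : IsEndpoints n a) (P : ℝ[X]) {k : ℕ}
    (hk : k ≤ n) :
    IntervalIntegrable (density n a (liftPoly n a P)) volume (a (2 * k)) (a (2 * k + 1)) := by
  rw [intervalIntegrable_iff_integrableOn_Ioo_of_le (ha.band k (by omega))]
  exact (ha.integrableOn_band P hk).congr (ha.density_ae P _).symm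

lemma IsEndpoints.bandVanishing_iff (ha : IsEndpoints n a) (P : ℝ[X]) {N : ℕ} (hN : N ≤ n + 1) :
    BandVanishing a N (density n a (liftPoly n a P)) ↔
      ∀ k ∈ openBands n a, k < N → bandIntegral n a P k = 0 := by
  constructor
  · intro h k hk hkN
    have := (h k hkN).2
    rw [ha.intervalIntegral_density P hk] at this
    simpa using this
  · intro h k hkN
    refine ⟨ha.intervalIntegrable_density P (by omega), ?_⟩
    by_cases hk : k ∈ openBands n a
    · rw [ha.intervalIntegral_density P hk, h k hk hkN]; simp
    · rw [ha.eq_of_notMem_openBands (by omega) hk, intervalIntegral.integral_same]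

end bands

/-! ### The polynomials of the densities -/

lemma continuousAt_rootQuot {B : Finset ℝ} (P : ℝ[X]) {x : ℝ} (hx : x ∉ B) :
    ContinuousAt (rootQuot B P) x :=
  ContinuousAt.div (Complex.continuous_ofReal.comp P.continuous).continuousAt
    (differentiableAt_rootProd hx).continuousAt (rootProd_ne_zero hx)

lemma rootQuot_add (B : Finset ℝ) (P Q : ℝ[X]) (x : ℝ) :
    rootQuot B (P + Q) x = rootQuot B P x + rootQuot B Q x := by
  simp only [rootQuot, Polynomial.eval_add, Complex.ofReal_add, add_div]

lemma rootQuot_smul (B : Finset ℝ) (c : ℝ) (P : ℝ[X]) (x : ℝ) :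
    rootQuot B (c • P) x = c * rootQuot B P x := by
  simp only [rootQuot, Polynomial.eval_smul, smul_eq_mul, Complex.ofReal_mul, mul_div_assoc]

section linear

variable {n : ℕ} {a : ℕ → ℝ} {P Q : ℝ[X]}

lemma IsEndpoints.bandIntegral_add (ha : IsEndpoints n a) (P Q : ℝ[X]) {k : ℕ} (hk : k ≤ n) :
    bandIntegral n a (P + Q) k = bandIntegral n a P k + bandIntegral n a Q k := by
  unfold bandIntegral
  rw [← integral_add (f := fun x => (rootQuot (bandEnds n a) P x).im)
    (g := fun x => (rootQuot (bandEnds n a) Q x).im) (ha.integrableOn_band P hk).im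
    (ha.integrableOn_band Q hk).im]
  simp only [rootQuot_add, Complex.add_im]

lemma bandIntegral_smul (c : ℝ) (P : ℝ[X]) (k : ℕ) :
    bandIntegral n a (c • P) k = c * bandIntegral n a P k := by
  unfold bandIntegral
  rw [← integral_const_mul]
  simp only [rootQuot_smul, Complex.im_ofReal_mul]

lemma IsEndpoints.notMem_bandEnds (ha : IsEndpoints n a) {x : ℝ} {k : ℕ}
    (hk : k ≤ n) (hx : x ∈ Ioo (a (2 * k)) (a (2 * k + 1))) : x ∉ bandEnds n a := by
  intro h
  obtain ⟨l, hl, h⟩ := mem_bandEnds.1 h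
  have hlt := (mem_openBands.1 hl).2
  rcases eq_or_ne l k with rfl | hlk
  · rcases h with rfl | rfl
    · exact lt_irrefl _ hx.1
    · exact lt_irrefl _ hx.2
  · rcases ha.le_or_le_of_mem_band hk hx (mem_openBands.1 hl).1 hlk with h' | h' <;>
    rcases h with rfl | rfl <;> linarith [h'.2]

/-- Without a root the integrand is continuous and nonvanishing on the open band, hence of constant
sign; multiplying by its value at one point makes the integral strictly positive. -/
lemma IsEndpoints.exists_root_of_bandIntegral_eq_zero (ha : IsEndpoints n a) {k : ℕ}
    (hk : k ∈ openBands n a) (h : bandIntegral n a P k = 0) :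
    ∃ x ∈ Ioo (a (2 * k)) (a (2 * k + 1)), P.eval x = 0 := by
  by_contra! h0
  obtain ⟨hkn, hlt⟩ := mem_openBands.1 hk
  set f : ℝ → ℝ := fun x => (rootQuot (bandEnds n a) P x).im
  have hne : ∀ x ∈ Ioo (a (2 * k)) (a (2 * k + 1)), f x ≠ 0 := by
    intro x hx hfx
    have h1 := ha.rootQuot_of_mem_band' P hk hx
    rw [show (rootQuot (bandEnds n a) P x).im = 0 from hfx, Complex.ofReal_zero, zero_mul,
      rootQuot, div_eq_zero_iff] at h1
    rcases h1 with h1 | h1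
    · exact h0 x hx (by exact_mod_cast h1)
    · exact rootProd_ne_zero (ha.notMem_bandEnds hkn hx) h1
  have hcont : ContinuousOn f (Ioo (a (2 * k)) (a (2 * k + 1))) := fun x hx =>
    (Complex.continuous_im.continuousAt.comp
      (continuousAt_rootQuot P (ha.notMem_bandEnds hkn hx))).continuousWithinAt
  have hint : IntervalIntegrable f volume (a (2 * k)) (a (2 * k + 1)) :=
    (intervalIntegrable_iff_integrableOn_Ioo_of_le hlt.le).2 (ha.integrableOn_band P hkn).im
  have hI : ∫ x in (a (2 * k))..(a (2 * k + 1)), f x = 0 := by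
    rw [intervalIntegral.integral_of_le hlt.le, integral_Ioc_eq_integral_Ioo]; exact h
  obtain ⟨c, hc⟩ := nonempty_Ioo.2 hlt
  have hsign : ∀ x ∈ Ioo (a (2 * k)) (a (2 * k + 1)), 0 < f x * f c := by
    intro x hx
    by_contra! hle
    have hz : (0 : ℝ) ∈ f '' Ioo (a (2 * k)) (a (2 * k + 1)) := by
      rcases mul_nonpos_iff.1 hle with ⟨h1, h2⟩ | ⟨h1, h2⟩
      · exact isPreconnected_Ioo.intermediate_value hc hx hcont ⟨h2, h1⟩
      · exact isPreconnected_Ioo.intermediate_value hx hc hcont ⟨h1, h2⟩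
    obtain ⟨y, hy, hy0⟩ := hz
    exact hne y hy hy0
  have := intervalIntegral.intervalIntegral_pos_of_pos_on (hint.mul_const (f c)) hsign hlt
  rw [intervalIntegral.integral_mul_const, hI, zero_mul] at this
  exact lt_irrefl _ this

lemma IsEndpoints.injOn_of_mem_band (ha : IsEndpoints n a) {x : ℕ → ℝ}
    (hx : ∀ k ∈ openBands n a, x k ∈ Ioo (a (2 * k)) (a (2 * k + 1))) :
    InjOn x (openBands n a) := by
  intro k hk l hl hkl
  by_contra hne
  exact Set.disjoint_left.1 (ha.disjoint_bands hk hl hne) (hx k hk) (hkl ▸ hx l hl)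

lemma IsEndpoints.eq_zero_of_bandIntegral_eq_zero (ha : IsEndpoints n a)
    (hP : P.degree < (openBands n a).card) (h : ∀ k ∈ openBands n a, bandIntegral n a P k = 0) :
    P = 0 := by
  choose! x hx hx0 using fun k hk => ha.exists_root_of_bandIntegral_eq_zero hk (h k hk)
  exact Polynomial.eq_zero_of_degree_lt_of_eval_index_eq_zero _ (ha.injOn_of_mem_band hx) hP hx0

lemma degree_lt_of_coeff_eq_zero {m : ℕ} (hP : P.degree < (m + 1 : ℕ)) (h0 : P.coeff m = 0) :
    P.degree < m := by
  rw [Polynomial.degree_lt_iff_coeff_zero] at hP ⊢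
  intro k hk
  rcases hk.eq_or_lt with rfl | hk
  · exact h0
  · exact hP k hk

/-- The leading coefficients and the integrals over the bands. -/
def bandMap (ha : IsEndpoints n a) : Polynomial.degreeLT ℝ ((openBands n a).card + 2) →ₗ[ℝ]
    ℝ × ℝ × (openBands n a → ℝ) where
  toFun P := ((P : ℝ[X]).coeff ((openBands n a).card + 1), (P : ℝ[X]).coeff (openBands n a).card,
    fun k => bandIntegral n a P k)
  map_add' P Q := by
    ext k
    · simp
    · simp
    · exact ha.bandIntegral_add P Q (mem_openBands.1 k.2).1
  map_smul' c P := by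
    ext k
    · simp
    · simp
    · exact bandIntegral_smul c P k

/-- Both spaces have dimension m + 2, and the kernel is trivial: vanishing of the two top
coefficients lowers the degree below m, and then the m roots in disjoint bands are too many. -/
lemma bandMap_surjective (ha : IsEndpoints n a) : Function.Surjective (bandMap ha) := by
  have hfr : Module.finrank ℝ (Polynomial.degreeLT ℝ ((openBands n a).card + 2)) =
      Module.finrank ℝ (ℝ × ℝ × (openBands n a → ℝ)) := by
    rw [(Polynomial.degreeLTEquiv ℝ _).finrank_eq]
    simp
    ring
  have : FiniteDimensional ℝ (Polynomial.degreeLT ℝ ((openBands n a).card + 2)) :=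
    (Polynomial.degreeLTEquiv ℝ _).symm.finiteDimensional
  rw [← LinearMap.injective_iff_surjective_of_finrank_eq_finrank hfr, injective_iff_map_eq_zero]
  rintro ⟨P, hP⟩ h
  simp only [bandMap, LinearMap.coe_mk, AddHom.coe_mk, Prod.mk_eq_zero] at h
  obtain ⟨h1, h2, h3⟩ := h
  rw [Polynomial.mem_degreeLT] at hP
  refine Subtype.ext (ha.eq_zero_of_bandIntegral_eq_zero
    (degree_lt_of_coeff_eq_zero (degree_lt_of_coeff_eq_zero hP h1) h2) fun k hk => ?_)
  exact congrFun h3 ⟨k, hk⟩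

lemma IsEndpoints.exists_polynomial (ha : IsEndpoints n a) (c d : ℝ) : ∃ P : ℝ[X],
    P.natDegree ≤ (openBands n a).card + 1 ∧ P.coeff ((openBands n a).card + 1) = c ∧
    P.coeff (openBands n a).card = d ∧ ∀ k ∈ openBands n a, bandIntegral n a P k = 0 := by
  obtain ⟨⟨P, hP⟩, h⟩ := bandMap_surjective ha (c, d, 0)
  simp only [bandMap, LinearMap.coe_mk, AddHom.coe_mk, Prod.mk.injEq] at h
  obtain ⟨h1, h2, h3⟩ := h
  rw [Polynomial.mem_degreeLT] at hP
  rw [Polynomial.degree_lt_iff_coeff_zero] at hP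
  exact ⟨P, Polynomial.natDegree_le_iff_coeff_eq_zero.2 fun N hN => hP N hN, h1, h2,
    fun k hk => congrFun h3 ⟨k, hk⟩⟩

/-- A real polynomial with prescribed behaviour at infinity and vanishing band integrals. -/
structure IsBalanced (n : ℕ) (a : ℕ → ℝ) (α β : ℝ) (P : ℝ[X]) : Prop where
  natDegree_le : P.natDegree ≤ (openBands n a).card + 1
  coeff_eq : P.coeff ((openBands n a).card + 1) = α
  coeff_eq' : α = 0 → P.coeff (openBands n a).card = β
  hasExpansion : HasExpansion (bandEnds n a) (openBands n a).card P α β (-(α / 2))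
  bandIntegral_eq : ∀ k ∈ openBands n a, bandIntegral n a P k = 0

lemma IsEndpoints.gamma_eq (ha : IsEndpoints n a) {α β γ : ℝ}
    (hP : HasExpansion (bandEnds n a) (openBands n a).card P α β γ)
    (h : ∀ k ∈ openBands n a, bandIntegral n a P k = 0) : γ = -(α / 2) := by
  have := ha.sum_bandIntegral hP
  rw [Finset.sum_eq_zero h] at this
  rcases mul_eq_zero.1 (show Real.pi * (γ + α / 2) = 0 by linarith) with h | h
  · exact absurd h Real.pi_pos.ne'
  · linarith

lemma IsEndpoints.exists_isBalanced_zero (ha : IsEndpoints n a) (β : ℝ) :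
    ∃ P, IsBalanced n a 0 β P := by
  obtain ⟨P, h1, h2, h3, h4⟩ := ha.exists_polynomial 0 β
  obtain ⟨β', γ, h5, h6⟩ := exists_hasExpansion ha.bandEnds_subset h1
  obtain rfl : β' = β := (h6 h2).trans h3
  rw [h2] at h5
  obtain rfl := ha.gamma_eq h5 h4
  exact ⟨P, h1, h2, fun _ => h3, h5, h4⟩

/-- The coefficient β produced by the first polynomial is cancelled by adding a balanced polynomial
with parameters (0, -β). -/
lemma IsEndpoints.exists_isBalanced (ha : IsEndpoints n a) {α : ℝ} (hα : α ≠ 0) :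
    ∃ P, IsBalanced n a α 0 P := by
  obtain ⟨P, h1, h2, h3, h4⟩ := ha.exists_polynomial α 0
  obtain ⟨β, γ, h5, h6⟩ := exists_hasExpansion ha.bandEnds_subset h1
  obtain ⟨Q, hQ⟩ := ha.exists_isBalanced_zero (-β)
  rw [h2] at h5
  have h7 := h5.add hQ.hasExpansion
  rw [add_zero, add_neg_cancel] at h7
  have h8 : ∀ k ∈ openBands n a, bandIntegral n a (P + Q) k = 0 := fun k hk => by
    rw [ha.bandIntegral_add P Q (mem_openBands.1 hk).1, h4 k hk, hQ.bandIntegral_eq k hk,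
      add_zero]
  obtain h9 := ha.gamma_eq h7 h8
  rw [h9] at h7
  exact ⟨P + Q, (Polynomial.natDegree_add_le _ _).trans (max_le h1 hQ.natDegree_le),
    by rw [Polynomial.coeff_add, h2, hQ.coeff_eq, add_zero], fun h => absurd h hα, h7, h8⟩

end linear

/-! ### The nonlinear dispersion relations -/

section dispersion

variable {Γ : Set ℝ}

/-- Tonelli with K ≥ 0: a bounded absolute potential of v makes its mutual energy with any
integrable u finite. -/
lemma integrable_kernel_mul_mul (hΓm : MeasurableSet Γ) (hΓ : Γ ⊆ Icc (-1) 1) {u v : ℝ → ℝ}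
    (hu : IntegrableOn u Γ) (hv : IntegrableOn v Γ) {C : ℝ}
    (hC : ∀ z ∈ Γ, IntegrableOn (fun w => kernel z w * ‖v w‖) Γ ∧
      ∫ w in Γ, kernel z w * ‖v w‖ ≤ C) :
    Integrable (fun p : ℝ × ℝ => kernel p.1 p.2 * u p.1 * v p.2)
      ((volume.restrict Γ).prod (volume.restrict Γ)) := by
  have hmeas : AEStronglyMeasurable (fun p : ℝ × ℝ => kernel p.1 p.2 * u p.1 * v p.2)
      ((volume.restrict Γ).prod (volume.restrict Γ)) :=
    (measurable_kernel.aestronglyMeasurable.mul hu.aestronglyMeasurable.comp_fst).mul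
      hv.aestronglyMeasurable.comp_snd
  rw [integrable_prod_iff hmeas]
  constructor
  · filter_upwards [ae_restrict_mem hΓm] with z hz
    refine Integrable.mono' ((hC z hz).1.const_mul |u z|)
      (((measurable_kernel_left z).aestronglyMeasurable.mul_const _).mul
        hv.aestronglyMeasurable) ?_
    filter_upwards [ae_restrict_mem hΓm] with w hw
    rw [norm_mul, norm_mul, Real.norm_of_nonneg (kernel_nonneg (hΓ hz) (hΓ hw)),
      Real.norm_eq_abs (u z)]
    exact le_of_eq (by ring)
  · refine Integrable.mono' (hu.norm.const_mul C) hmeas.norm.integral_prod_right' ?_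
    filter_upwards [ae_restrict_mem hΓm] with z hz
    rw [Real.norm_of_nonneg (integral_nonneg fun _ => norm_nonneg _)]
    have : ∫ w in Γ, ‖kernel z w * u z * v w‖ = ‖u z‖ * ∫ w in Γ, kernel z w * ‖v w‖ := by
      rw [← integral_const_mul]
      refine setIntegral_congr_fun hΓm fun w hw => ?_
      rw [norm_mul, norm_mul, Real.norm_of_nonneg (kernel_nonneg (hΓ hz) (hΓ hw))]
      ring
    simp only [this]
    rw [mul_comm]
    exact mul_le_mul_of_nonneg_right (hC z hz).2 (norm_nonneg _)

/-- A solution with bounded absolute potential is the only solution. -/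
lemma SolvesNDR.ae_eq (hΓm : MeasurableSet Γ) (hΓ : Γ ⊆ Icc (-1) 1) {g u v : ℝ → ℝ}
    (hu : SolvesNDR Γ 0 g u) (hv : SolvesNDR Γ 0 g v) {C : ℝ}
    (hC : ∀ z ∈ Γ, IntegrableOn (fun w => kernel z w * ‖v w‖) Γ ∧
      ∫ w in Γ, kernel z w * ‖v w‖ ≤ C) : u =ᵐ[volume.restrict Γ] v := by
  have huv := integrable_kernel_mul_mul hΓm hΓ hu.integrable hv.integrable hC
  have hvu : Integrable (fun p : ℝ × ℝ => kernel p.1 p.2 * v p.1 * u p.2)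
      ((volume.restrict Γ).prod (volume.restrict Γ)) := by
    refine huv.swap.congr (Eventually.of_forall fun p => ?_)
    simp only [Function.comp, Prod.swap]
    rw [kernel_symm]; ring
  have h := ae_eq_zero_of_potential_eq_zero hΓm hΓ (w := fun x => u x - v x)
    (hu.integrable.sub hv.integrable) ?_ ?_
  · filter_upwards [h] with x hx
    exact sub_eq_zero.1 hx
  -- Energy of the difference by bilinear expansion. The mixed terms are finite thanks to the
  -- bounded potential of v; for u, integrability and finite energy suffice.
  · refine (((hu.energy.sub huv).sub hvu).add hv.energy).congr (Eventually.of_forall fun p => ?_)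
    simp only [Pi.add_apply, Pi.sub_apply]
    ring
  · intro z hz
    have h1 := hu.eqn z hz
    have h2 := hv.eqn z hz
    simp only [Pi.zero_apply, zero_mul, add_zero] at h1 h2
    simp only [mul_sub]
    rw [integral_sub (hu.integrable_kernel z hz) (hv.integrable_kernel z hz), h1, h2, sub_self]

variable {n : ℕ} {a : ℕ → ℝ} {P : ℝ[X]} {α β : ℝ}

lemma IsEndpoints.density_re_ae (ha : IsEndpoints n a) (P : ℝ[X]) :
    (fun z => (density n a (liftPoly n a P) z).re) =ᵐ[volume.restrict (support n a)]
      fun z => (rootQuot (bandEnds n a) P z).re := by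
  filter_upwards [ha.density_ae P _] with x hx
  rw [hx]

lemma IsEndpoints.exists_potential_le (ha : IsEndpoints n a) (P : ℝ[X]) :
    ∃ C, ∀ z ∈ support n a,
      IntegrableOn (fun w => kernel z w * ‖(density n a (liftPoly n a P) w).re‖) (support n a) ∧
      ∫ w in support n a, kernel z w * ‖(density n a (liftPoly n a P) w).re‖ ≤ C := by
  obtain ⟨C, hC⟩ := integrableOn_kernel_mul_rootQuot ha.bandEnds_subset ha.card_bandEnds P
  have hm := measurableSet_support (n := n) (a := a)
  refine ⟨C, fun z hz => ?_⟩
  have hz' := ha.support_subset hz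
  obtain ⟨h1, h2⟩ := hC z hz'
  have h1' := (integrableOn_Icc_iff_integrableOn_Ioo (a := (-1 : ℝ)) (b := 1)).2 h1
  have h3 := h1'.mono_set ha.support_subset
  have hle : ∀ᵐ w ∂volume.restrict (support n a),
      ‖kernel z w * ‖(density n a (liftPoly n a P) w).re‖‖ ≤
        kernel z w * ‖rootQuot (bandEnds n a) P w‖ := by
    filter_upwards [ha.density_ae P _, ae_restrict_mem hm] with w hw hw'
    have hk := kernel_nonneg hz' (ha.support_subset hw')
    rw [norm_mul, norm_norm, Real.norm_of_nonneg hk, hw]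
    exact mul_le_mul_of_nonneg_left (Complex.abs_re_le_norm _) hk
  have hmeas : AEStronglyMeasurable
      (fun w => kernel z w * ‖(density n a (liftPoly n a P) w).re‖)
      (volume.restrict (support n a)) := by
    refine (measurable_kernel_left z).aestronglyMeasurable.mul (AEStronglyMeasurable.norm ?_)
    exact (Complex.measurable_re.comp
      (measurable_rootQuot (bandEnds n a) P)).aestronglyMeasurable.congr (ha.density_re_ae P).symm
  have hint := h3.mono' hmeas hle
  refine ⟨hint, ?_⟩
  calc _ ≤ ∫ w in support n a, kernel z w * ‖rootQuot (bandEnds n a) P w‖ :=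
        integral_mono_ae hint h3 (hle.mono fun w hw => (le_abs_self _).trans hw)
    _ ≤ ∫ w in Icc (-1) 1, kernel z w * ‖rootQuot (bandEnds n a) P w‖ := by
        refine setIntegral_mono_set h1' ?_ (Eventually.of_forall ha.support_subset)
        filter_upwards [ae_restrict_mem measurableSet_Icc] with w hw
        exact mul_nonneg (kernel_nonneg hz' hw) (norm_nonneg _)
    _ ≤ C := by rwa [integral_Icc_eq_integral_Ioo]

lemma IsBalanced.solvesNDR (ha : IsEndpoints n a) (hP : IsBalanced n a α β P) {g : ℝ → ℝ}
    (hg : ∀ z ∈ support n a, g z = Real.pi * ((α / 2 * z + β) * ‖R₀ z‖)) :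
    SolvesNDR (support n a) 0 g (fun z => (density n a (liftPoly n a P) z).re) := by
  have hm := measurableSet_support (n := n) (a := a)
  obtain ⟨C, hC⟩ := ha.exists_potential_le P
  have hint : IntegrableOn (fun z => (density n a (liftPoly n a P) z).re) (support n a) :=
    ((ha.support_ae_subset (ha.integrableOn_rootQuot P)).re).congr (ha.density_re_ae P).symm
  refine ⟨hint, integrable_kernel_mul_mul hm ha.support_subset hint hint hC, fun z hz => ?_,
    fun z hz => ?_⟩
  · refine (hC z hz).1.mono' ((measurable_kernel_left z).aestronglyMeasurable.mul
      hint.aestronglyMeasurable) ?_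
    filter_upwards [ae_restrict_mem hm] with w hw
    rw [norm_mul, Real.norm_of_nonneg
      (kernel_nonneg (ha.support_subset hz) (ha.support_subset hw))]
  · rw [Pi.zero_apply, zero_mul, add_zero, hg z hz, norm_R₀ (ha.support_subset hz),
      ← ha.integral_kernel hP.hasExpansion hP.bandIntegral_eq hz]
    refine integral_congr_ae ?_
    filter_upwards [ha.density_re_ae P] with w hw
    rw [hw]

lemma IsBalanced.ae_eq (ha : IsEndpoints n a) (hP : IsBalanced n a α β P) {g u : ℝ → ℝ}
    (hg : ∀ z ∈ support n a, g z = Real.pi * ((α / 2 * z + β) * ‖R₀ z‖))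
    (hu : SolvesNDR (support n a) 0 g u) :
    u =ᵐ[volume.restrict (support n a)] fun z => (density n a (liftPoly n a P) z).re := by
  obtain ⟨C, hC⟩ := ha.exists_potential_le P
  exact hu.ae_eq measurableSet_support ha.support_subset (hP.solvesNDR ha hg) hC

end dispersion

/-! ### Residues -/

lemma exists_punctured_ball {p : ℂ → Prop} (h : ∀ᶠ t in 𝓝[≠] (0 : ℂ), p t) :
    ∃ ε > 0, ∀ t : ℂ, t ≠ 0 → ‖t‖ < ε → p t := by
  rw [eventually_nhdsWithin_iff, Metric.eventually_nhds_iff] at h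
  obtain ⟨ε, hε, h⟩ := h
  exact ⟨ε, hε, fun t h0 ht => h (by simpa using ht) h0⟩

/-- The exact part has a single-valued primitive on small circles, and the analytic part falls to
Cauchy's theorem. -/
lemma circleIntegral_eq_zero_of_eq_deriv_add {f F g : ℂ → ℂ} (hF : MeromorphicAt F 0)
    (hg : AnalyticAt ℂ g 0) (h : f =ᶠ[𝓝[≠] 0] fun t => deriv F t + g t) :
    ∀ᶠ r in 𝓝[>] (0 : ℝ), (∮ t in C(0, r), f t) = 0 := by
  obtain ⟨ε, hε, hev⟩ := exists_punctured_ball (h.and hF.eventually_analyticAt)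
  obtain ⟨δ, hδ, hga⟩ := Metric.eventually_nhds_iff.1 hg.eventually_analyticAt
  filter_upwards [Ioo_mem_nhdsGT (lt_min hε hδ)] with r hr
  have hr0 : 0 ≤ r := hr.1.le
  have hs : ∀ t ∈ Metric.sphere (0 : ℂ) r, t ≠ 0 ∧ ‖t‖ < ε ∧ ‖t‖ < δ := by
    intro t ht
    have : ‖t‖ = r := by simpa using ht
    exact ⟨fun h0 => by rw [h0, norm_zero] at this; exact hr.1.ne this,
      this ▸ hr.2.trans_le (min_le_left _ _), this ▸ hr.2.trans_le (min_le_right _ _)⟩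
  have hFa : ∀ t ∈ Metric.sphere (0 : ℂ) r, AnalyticAt ℂ F t := fun t ht =>
    (hev t (hs t ht).1 (hs t ht).2.1).2
  have hd : ∀ t, ‖t‖ ≤ r → DifferentiableAt ℂ g t := fun t ht =>
    (hga (show dist t 0 < δ by
      rw [dist_zero_right]; exact ht.trans_lt (hr.2.trans_le (min_le_right _ _)))).differentiableAt
  rw [circleIntegral.integral_congr hr0 (g := fun t => deriv F t + g t)
    fun t ht => (hev t (hs t ht).1 (hs t ht).2.1).1, circleIntegral.integral_add]
  · rw [circleIntegral.integral_eq_zero_of_hasDerivWithinAt hr0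
      fun t ht => (hFa t ht).differentiableAt.hasDerivAt.hasDerivWithinAt, zero_add]
    refine DiffContOnCl.circleIntegral_eq_zero hr0 (DifferentiableOn.diffContOnCl fun t ht => ?_)
    exact (hd t (by simpa using Metric.closure_ball_subset_closedBall ht)).differentiableWithinAt
  · exact ContinuousOn.circleIntegrable hr0 fun t ht =>
      (hFa t ht).deriv.continuousAt.continuousWithinAt
  · exact ContinuousOn.circleIntegrable hr0 fun t ht =>
      (hd t (by simpa using (Metric.sphere_subset_closedBall ht))).continuousAt.continuousWithinAt

/-- `f` agrees with an analytic function in a punctured neighbourhood of `0`. -/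
def IsRemovable (f : ℂ → ℂ) : Prop := ∃ g : ℂ → ℂ, AnalyticAt ℂ g 0 ∧ f =ᶠ[𝓝[≠] 0] g

/-! ### Removable singularities through meromorphic orders -/

section removable

variable {f g : ℂ → ℂ}

lemma isRemovable_iff (hf : MeromorphicAt f 0) : IsRemovable f ↔ 0 ≤ meromorphicOrderAt f 0 :=
  hf.meromorphicOrderAt_nonneg_iff.symm

lemma IsRemovable.congr (hf : IsRemovable f) (h : g =ᶠ[𝓝[≠] 0] f) : IsRemovable g := by
  obtain ⟨f', h1, h2⟩ := hf
  exact ⟨f', h1, h.trans h2⟩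

lemma IsRemovable.mul (hf : IsRemovable f) (hg : IsRemovable g) :
    IsRemovable fun t => f t * g t := by
  obtain ⟨f', h1, h2⟩ := hf
  obtain ⟨g', h3, h4⟩ := hg
  exact ⟨fun t => f' t * g' t, h1.mul h3, h2.mul h4⟩

lemma IsRemovable.deriv (hf : IsRemovable f) : IsRemovable (deriv f) := by
  obtain ⟨f', h1, h2⟩ := hf
  exact ⟨_, h1.deriv, h2.nhdsNE_deriv⟩

lemma IsRemovable.comp {F : ℂ → ℂ} (hF : Differentiable ℂ F) (hf : IsRemovable f) :
    IsRemovable fun t => F (f t) := by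
  obtain ⟨f', h1, h2⟩ := hf
  exact ⟨fun t => F (f' t), (hF.analyticAt _).comp h1, h2.fun_comp F⟩

/-- The norm tends to infinity at a pole, so boundedness along arbitrarily small t already excludes
one. The weak form is needed for the choice of sheet in `HasExpansion.exists_primitive`. -/
lemma isRemovable_of_bounded (hf : MeromorphicAt f 0) {C : ℝ}
    (h : ∃ᶠ t in 𝓝[≠] 0, ‖f t‖ ≤ C) : IsRemovable f := by
  rw [isRemovable_iff hf]
  by_contra! hlt
  have := tendsto_norm_atTop_iff_cobounded.2 (tendsto_cobounded_of_meromorphicOrderAt_neg hlt)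
  exact h ((this.eventually_gt_atTop C).mono fun t ht => not_le.2 ht)

/-- If k is the order of f, then 1 + 2k ≥ 0 forces k ≥ 0 for an integer k. The spare factor t
absorbs the branching of the square root. -/
lemma isRemovable_of_mul_sq (hf : MeromorphicAt f 0) (h : IsRemovable fun t => t * f t ^ 2) :
    IsRemovable f := by
  have h1 : MeromorphicAt (fun t : ℂ => t) 0 := MeromorphicAt.id 0
  rw [isRemovable_iff hf]
  simp only [sq] at h
  rw [isRemovable_iff (h1.fun_mul (hf.fun_mul hf))] at h
  have h2 : meromorphicOrderAt (fun t : ℂ => t) 0 = 1 := meromorphicOrderAt_id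
  rw [fun_meromorphicOrderAt_mul h1 (hf.fun_mul hf), fun_meromorphicOrderAt_mul hf hf, h2] at h
  cases ho : meromorphicOrderAt f 0 with
  | top => exact le_top
  | coe k =>
    rw [ho] at h
    have h4 : (0 : ℤ) ≤ 1 + (k + k) := by exact_mod_cast h
    have : (0 : ℤ) ≤ k := by omega
    exact_mod_cast this

lemma isRemovable_mul_logDeriv (hf : MeromorphicAt f 0) (h : ∃ᶠ t in 𝓝[≠] 0, f t ≠ 0) :
    IsRemovable fun t => t * (deriv f t / f t) := by
  have h1 : MeromorphicAt (fun t : ℂ => t) 0 := MeromorphicAt.id 0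
  have h3 : MeromorphicAt (logDeriv f) 0 := hf.deriv.div hf
  have h2 : meromorphicOrderAt (fun t : ℂ => t) 0 = 1 := meromorphicOrderAt_id
  change IsRemovable fun t => t * logDeriv f t
  rw [isRemovable_iff (h1.fun_mul h3), fun_meromorphicOrderAt_mul h1 h3, h2]
  by_cases h0 : meromorphicOrderAt f 0 = 0
  · exact add_nonneg zero_le_one (meromorphicOrderAt_logDeriv_nonneg hf h0)
  · rw [meromorphicOrderAt_logDeriv_eq_neg_one hf h0 fun ht => by
      rw [meromorphicOrderAt_eq_top_iff] at ht
      exact h (ht.mono fun t ht => not_not.2 ht)]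
    decide

end removable

/-! ### Behaviour at the points at infinity -/

/-- The two solutions z ± √(z²-1) have product 1, so one of them lies in the closed disc. -/
lemma exists_joukowski_eq (z : ℂ) : ∃ ζ : ℂ, ζ ≠ 0 ∧ ‖ζ‖ ≤ 1 ∧ joukowski ζ = z := by
  have key : ∀ s : ℂ, s ^ 2 = z ^ 2 - 1 → ‖z - s‖ ≤ 1 →
      ∃ ζ : ℂ, ζ ≠ 0 ∧ ‖ζ‖ ≤ 1 ∧ joukowski ζ = z := by
    intro s hs h
    have h1 : (z - s) * (z + s) = 1 := by linear_combination -hs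
    refine ⟨z - s, left_ne_zero_of_mul_eq_one h1, h, ?_⟩
    rw [joukowski, inv_eq_of_mul_eq_one_right h1]
    ring
  have hs := csqrt_sq (z ^ 2 - 1)
  set s := csqrt (z ^ 2 - 1)
  rcases le_or_gt ‖z - s‖ 1 with h | h
  · exact key s hs h
  · refine key (-s) (by rw [neg_sq, hs]) ?_
    have h1 : ‖z - s‖ * ‖z + s‖ = 1 := by
      rw [← norm_mul, show (z - s) * (z + s) = 1 by linear_combination -hs, norm_one]
    rw [sub_neg_eq_add]
    nlinarith [norm_nonneg (z + s)]

lemma norm_le_inv_of_joukowski {ζ : ℂ} (h0 : ζ ≠ 0) (h1 : ‖ζ‖ ≤ 1) :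
    ‖joukowski ζ‖ * ‖ζ‖ ≤ 1 := by
  rw [← norm_mul, joukowski]
  have : (ζ + ζ⁻¹) / 2 * ζ = (ζ ^ 2 + 1) / 2 := by field_simp
  rw [this, norm_div]
  have h2 := norm_add_le (ζ ^ 2) 1
  rw [norm_pow, norm_one] at h2
  simp only [Complex.norm_ofNat]
  have : ‖ζ‖ ^ 2 ≤ 1 := pow_le_one₀ (norm_nonneg _) h1
  linarith

section infinity

variable {B : Finset ℝ} {m : ℕ} {P : ℝ[X]} {α β γ : ℝ}

lemma discFun_sq_mul (hB : ↑B ⊆ Icc (-1 : ℝ) 1) (hm : B.card = 2 * m) {ζ : ℂ} (h0 : ζ ≠ 0)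
    (h1 : ‖ζ‖ < 1) :
    discFun B m P ζ ^ 2 * ∏ b ∈ B, (joukowski ζ - b) =
      P.aeval (joukowski ζ) ^ 2 * (joukowski ζ ^ 2 - 1) := by
  have h2 : (∏ b ∈ B, discRoot b ζ) ^ 2 = (2 * ζ) ^ (2 * m) * ∏ b ∈ B, (joukowski ζ - b) := by
    rw [← hm, ← Finset.prod_pow, ← Finset.prod_const, ← Finset.prod_mul_distrib]
    refine Finset.prod_congr rfl fun b hb => ?_
    rw [discRoot_sq (hB hb), joukowski]
    field_simp
    ring
  have h3 : ∏ b ∈ B, discRoot b ζ ≠ 0 :=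
    Finset.prod_ne_zero_iff.2 fun b hb => discRoot_ne_zero (hB hb) h1
  have h4 : ((1 - ζ ^ 2) / (2 * ζ)) ^ 2 = joukowski ζ ^ 2 - 1 := by
    rw [joukowski]; field_simp; ring
  have h5 : (2 * ζ) ^ (2 * m) ≠ 0 := pow_ne_zero _ (mul_ne_zero two_ne_zero h0)
  rw [discFun, div_pow, mul_pow, mul_pow, h4, h2, div_mul_eq_mul_div, ← pow_mul, mul_comm m 2]
  rw [div_eq_iff (by rw [← h2]; exact pow_ne_zero 2 h3)]
  ring

/-- Here q stands for the quotient P/∏(z-b)^{1/2} on an unspecified sheet, so only its square is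
controlled. With γ = -α/2 the expansion of R₀q matches that of R₀(αz + β) up to O(1/z), leaving q no
1/z term on either sheet. -/
lemma HasExpansion.exists_norm_sq_sub_le (hB : ↑B ⊆ Icc (-1 : ℝ) 1) (hm : B.card = 2 * m)
    (hP : HasExpansion B m P α β (-(α / 2))) :
    ∃ C, ∀ᶠ z : ℂ in Bornology.cobounded ℂ, ∀ q : ℂ,
      q ^ 2 * ∏ b ∈ B, (z - (b : ℂ)) = P.aeval z ^ 2 →
      ‖q ^ 2 - (α * z + β) ^ 2‖ * ‖z‖ ^ 2 ≤ C * (|α| * ‖z‖ + 1) := by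
  obtain ⟨h, hd, h0, hf⟩ := hP
  have hO := (hd.differentiableAt (Metric.ball_mem_nhds 0 one_pos)).isBigO_sub
  obtain ⟨C₀, hC₀, hO⟩ := hO.exists_pos
  obtain ⟨δ, hδ, hO⟩ := Metric.eventually_nhds_iff.1 hO.bound
  refine ⟨2 * (|β| + α ^ 2 + β ^ 2 + 2 * C₀ + 2 * C₀ * |β| + 2 * C₀ * |α| + C₀ ^ 2), ?_⟩
  filter_upwards [tendsto_norm_cobounded_atTop.eventually_ge_atTop 2,
    tendsto_norm_cobounded_atTop.eventually_gt_atTop δ⁻¹] with z hz2 hzδ q hq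
  obtain ⟨ζ, hζ0, hζ1, rfl⟩ := exists_joukowski_eq z
  set z := joukowski ζ
  set x := ‖z‖
  have hx0 : 0 < x := by linarith
  have hζx : ‖ζ‖ ≤ x⁻¹ := by
    rw [le_inv_comm₀ (norm_pos_iff.2 hζ0) hx0, ← one_div, le_div_iff₀ (norm_pos_iff.2 hζ0)]
    exact norm_le_inv_of_joukowski hζ0 hζ1
  have hx2 : x⁻¹ ≤ 1 / 2 := by
    rw [one_div]; exact inv_anti₀ two_pos hz2
  have hζlt : ‖ζ‖ < 1 := by linarith
  have hζδ : ‖ζ‖ < δ := hζx.trans_lt (inv_lt_of_inv_lt₀ hδ hzδ)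
  have hη : ‖h ζ‖ ≤ C₀ * x⁻¹ := by
    have := hO (show dist ζ 0 < δ by rwa [dist_zero_right])
    rw [h0, sub_zero, sub_zero] at this
    exact this.trans (mul_le_mul_of_nonneg_left hζx hC₀.le)
  have hD : ∏ b ∈ B, (z - (b : ℂ)) ≠ 0 := by
    refine Finset.prod_ne_zero_iff.2 fun b hb hzb => ?_
    have : x = |b| := by
      rw [← Real.norm_eq_abs, ← Complex.norm_real, ← sub_eq_zero.1 hzb]
    have := abs_le.2 ⟨(hB hb).1, (hB hb).2⟩
    linarith
  have hsq : discFun B m P ζ ^ 2 = q ^ 2 * (z ^ 2 - 1) := by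
    refine mul_right_cancel₀ hD ?_
    rw [discFun_sq_mul hB hm hζ0 hζlt, ← hq]
    ring
  rw [hf ζ (by simpa using hζlt) hζ0] at hsq
  set A : ℂ := α * z ^ 2 + β * z + ((-(α / 2) : ℝ) : ℂ) with hA
  -- In A² - (αz + β)²(z² - 1) all powers above z¹ cancel; the choice γ = -α/2 removes the z² term.
  have hT : (q ^ 2 - (α * z + β) ^ 2) * (z ^ 2 - 1) =
      α * β * z + (α ^ 2 / 4 + β ^ 2) + 2 * A * h ζ + h ζ ^ 2 := by
    rw [sub_mul, ← hsq, hA]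
    push_cast
    ring
  have hnA : ‖A‖ ≤ |α| * x ^ 2 + |β| * x + |α| / 2 := by
    refine (norm_add_le _ _).trans (add_le_add ((norm_add_le _ _).trans (add_le_add ?_ ?_)) ?_)
    · rw [norm_mul, norm_pow, Complex.norm_real, Real.norm_eq_abs]
    · rw [norm_mul, Complex.norm_real, Real.norm_eq_abs]
    · rw [Complex.norm_real, Real.norm_eq_abs, abs_neg, abs_div, abs_two]
  have hnT : ‖(q ^ 2 - (α * z + β) ^ 2) * (z ^ 2 - 1)‖ ≤
      |α| * |β| * x + (α ^ 2 / 4 + β ^ 2) +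
        2 * (|α| * x ^ 2 + |β| * x + |α| / 2) * (C₀ * x⁻¹) + (C₀ * x⁻¹) ^ 2 := by
    rw [hT]
    refine (norm_add_le _ _).trans (add_le_add ((norm_add_le _ _).trans
      (add_le_add ((norm_add_le _ _).trans (add_le_add ?_ ?_)) ?_)) ?_)
    · rw [norm_mul, norm_mul, Complex.norm_real, Complex.norm_real]; rfl
    · rw [show (α : ℂ) ^ 2 / 4 + (β : ℂ) ^ 2 = ((α ^ 2 / 4 + β ^ 2 : ℝ) : ℂ) by push_cast; ring,
        Complex.norm_real, Real.norm_of_nonneg (by positivity)]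
    · rw [norm_mul, norm_mul, Complex.norm_ofNat]
      gcongr
    · rw [norm_pow]
      gcongr
  have hz1 : x ^ 2 / 2 ≤ ‖z ^ 2 - 1‖ := by
    have := norm_sub_norm_le (z ^ 2) 1
    rw [norm_pow, norm_one] at this
    nlinarith
  have e1 : 2 * (|α| * x ^ 2 + |β| * x + |α| / 2) * (C₀ * x⁻¹) =
      2 * C₀ * |α| * x + 2 * C₀ * |β| + C₀ * |α| * x⁻¹ := by
    field_simp
  have e2 : C₀ * |α| * x⁻¹ ≤ C₀ * |α| := by
    refine mul_le_of_le_one_right (by positivity) (by linarith)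
  have e3 : (C₀ * x⁻¹) ^ 2 ≤ C₀ ^ 2 := by
    refine pow_le_pow_left₀ (by positivity) (mul_le_of_le_one_right hC₀.le (by linarith)) 2
  rw [norm_mul, e1] at hnT
  have h6 := mul_le_mul_of_nonneg_left hz1 (norm_nonneg (q ^ 2 - (α * z + β) ^ 2))
  have hα := abs_nonneg α
  have hβ := abs_nonneg β
  have p1 : 0 ≤ (α ^ 2 + β ^ 2 + 2 * C₀ * |β| + 2 * C₀ * |α| + C₀ ^ 2) * (|α| * x) := by positivity
  have p2 : 0 ≤ C₀ * |α| := by positivity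
  have p3 : 0 ≤ α ^ 2 := by positivity
  nlinarith

lemma exists_mul_le_norm_linear {α β : ℝ} (h : α ≠ 0 ∨ β ≠ 0) :
    ∃ c > 0, ∀ᶠ z in Bornology.cobounded ℂ, c * (|α| * ‖z‖ + 1) ≤ ‖(α : ℂ) * z + β‖ := by
  rcases eq_or_ne α 0 with rfl | hα
  · refine ⟨|β|, abs_pos.2 (h.resolve_left (not_not.2 rfl)), Eventually.of_forall fun z => ?_⟩
    simp
  · refine ⟨1 / 2, by norm_num, ?_⟩
    have hα' := abs_pos.2 hα
    filter_upwards [tendsto_norm_cobounded_atTop.eventually_ge_atTop ((2 * |β| + 1) / |α|)]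
      with z hz
    rw [div_le_iff₀ hα'] at hz
    have := norm_sub_norm_le ((α : ℂ) * z) (-β)
    rw [sub_neg_eq_add, norm_neg, norm_mul, Complex.norm_real, Complex.norm_real,
      Real.norm_eq_abs, Real.norm_eq_abs] at this
    nlinarith

/-- The two factors of q² - L² differ by 2L, so the larger has modulus at least |L| and can be
divided out. -/
lemma norm_sub_le_or_norm_add_le {q L : ℂ} {x C c K : ℝ} (hc : 0 < c) (hK : 0 < K)
    (hL : c * K ≤ ‖L‖) (h : ‖q ^ 2 - L ^ 2‖ * x ^ 2 ≤ C * K) :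
    ‖(q - L) * x ^ 2‖ ≤ C / c ∨ ‖(q + L) * x ^ 2‖ ≤ C / c := by
  have h1 : ‖q ^ 2 - L ^ 2‖ = ‖q - L‖ * ‖q + L‖ := by rw [← norm_mul]; congr 1; ring
  have h2 : 2 * ‖L‖ ≤ ‖q + L‖ + ‖q - L‖ := by
    have := norm_sub_le (q + L) (q - L)
    rw [show q + L - (q - L) = 2 * L by ring, norm_mul, Complex.norm_ofNat] at this
    exact this
  have hx : ‖(x : ℂ) ^ 2‖ = x ^ 2 := by
    rw [norm_pow, Complex.norm_real, Real.norm_eq_abs, sq_abs]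
  rw [norm_mul, norm_mul, hx]
  rw [h1] at h
  have hcK := mul_pos hc hK
  rcases le_or_gt ‖L‖ ‖q + L‖ with h3 | h3
  · left
    rw [le_div_iff₀ hc]
    refine le_of_mul_le_mul_right ?_ hK
    have : ‖q - L‖ * x ^ 2 * (c * K) ≤ ‖q - L‖ * x ^ 2 * ‖q + L‖ :=
      mul_le_mul_of_nonneg_left (hL.trans h3) (by positivity)
    nlinarith
  · right
    rw [le_div_iff₀ hc]
    refine le_of_mul_le_mul_right ?_ hK
    have : ‖q + L‖ * x ^ 2 * (c * K) ≤ ‖q + L‖ * x ^ 2 * ‖q - L‖ :=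
      mul_le_mul_of_nonneg_left (by linarith) (by positivity)
    nlinarith

end infinity

/-! ### Differentials of the second kind -/

lemma meromorphicAt_eval {Z : ℂ → ℂ} {x : ℂ} (hZ : MeromorphicAt Z x) (P : ℂ[X]) :
    MeromorphicAt (fun t => P.eval (Z t)) x := by
  induction P using Polynomial.induction_on' with
  | add p q hp hq => simpa only [Polynomial.eval_add] using hp.fun_add hq
  | monomial k c =>
    simpa only [Polynomial.eval_monomial] using (MeromorphicAt.const c x).fun_mul (hZ.fun_pow k)

lemma eventually_ne_of_not_eventually_eq {Z : ℂ → ℂ} (hZ : MeromorphicAt Z 0) {c : ℂ}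
    (h : ¬ ∀ᶠ t in 𝓝[≠] 0, Z t = c) : ∀ᶠ t in 𝓝[≠] 0, Z t ≠ c := by
  rcases (hZ.fun_sub (MeromorphicAt.const c 0)).eventually_eq_zero_or_eventually_ne_zero
    with h' | h'
  · exact absurd (h'.mono fun t ht => sub_eq_zero.1 ht) h
  · exact h'.mono fun t ht => sub_ne_zero.1 ht

lemma isRemovable_inv_prod {Z : ℂ → ℂ} {W : ℂ → ℂ} (hW : AnalyticAt ℂ W 0)
    (hZ : Z =ᶠ[𝓝[≠] 0] W) {S : Finset ℝ} (hS : ∀ b ∈ S, W 0 ≠ b) :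
    IsRemovable fun t => (∏ b ∈ S, (Z t - b))⁻¹ := by
  refine ⟨fun t => (∏ b ∈ S, (W t - b))⁻¹, ?_, ?_⟩
  · refine AnalyticAt.fun_inv (Finset.analyticAt_fun_prod S fun b _ => hW.sub analyticAt_const) ?_
    exact Finset.prod_ne_zero_iff.2 fun b hb => sub_ne_zero.2 (hS b hb)
  · filter_upwards [hZ] with t ht
    rw [ht]

section secondKind

variable {n : ℕ} {a : ℕ → ℝ} {P : ℝ[X]} {α β : ℝ}

lemma liftPoly_eval (P : ℝ[X]) (z : ℂ) : (liftPoly n a P).eval z =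
    (∏ k ∈ Finset.range (n + 1) \ openBands n a, (z - a (2 * k))) * P.aeval z := by
  rw [liftPoly, Polynomial.eval_map_algebraMap, map_mul, collapsePoly, map_prod]
  congr 1
  exact Finset.prod_congr rfl fun k _ => by simp

lemma IsEndpoints.sq_mul_prod (ha : IsEndpoints n a) (P : ℝ[X]) {z y : ℂ}
    (hy : y ^ 2 = ∏ j ∈ Finset.range (2 * n + 2), (z - a j))
    (hz : ∀ j ∈ Finset.range (2 * n + 2), z ≠ a j) :
    ((liftPoly n a P).eval z / y) ^ 2 * ∏ b ∈ bandEnds n a, (z - (b : ℂ)) = P.aeval z ^ 2 := by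
  have h0 : ∏ j ∈ Finset.range (2 * n + 2), (z - (a j : ℂ)) ≠ 0 :=
    Finset.prod_ne_zero_iff.2 fun j hj => sub_ne_zero.2 (hz j hj)
  rw [div_pow, div_mul_eq_mul_div, div_eq_iff (by rw [hy]; exact h0), hy,
    ha.prod_range fun b => z - (b : ℂ), liftPoly_eval, Finset.prod_mul_distrib]
  ring

/-- At a branch point b, t(q Z')² = P(Z)² Z' · (t Z'/(Z-b)) / ∏_{b'≠b}(Z-b'), and a logarithmic
derivative has at most a simple pole. Hence t(q Z')² is regular, and so is q Z'. Only the equation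
for q² is used, so the sheet plays no role. -/
lemma isRemovable_of_finite {B : Finset ℝ} {Z : ℂ → ℂ} {q : ℂ → ℂ}
    (hZ : MeromorphicAt Z 0) (hq : MeromorphicAt q 0) (hZr : IsRemovable Z)
    (hne : ∀ c, ∀ᶠ t in 𝓝[≠] 0, Z t ≠ c)
    (h : ∀ᶠ t in 𝓝[≠] 0,
      q t ^ 2 * ∏ b ∈ B, (Z t - (b : ℂ)) = P.aeval (Z t) ^ 2) :
    IsRemovable fun t => q t * deriv Z t := by
  obtain ⟨W, hW, hZW⟩ := id hZr
  have hP : IsRemovable fun t => P.aeval (Z t) ^ 2 :=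
    hZr.comp (F := fun z => P.aeval z ^ 2) ((Polynomial.differentiable_aeval P).pow 2)
  have hid : IsRemovable fun t : ℂ => t := ⟨_, analyticAt_id, EventuallyEq.rfl⟩
  have hB : ∀ᶠ t in 𝓝[≠] 0, ∀ b ∈ B, Z t ≠ b :=
    (Filter.eventually_all_finset _).2 fun b _ => hne b
  refine isRemovable_of_mul_sq (hq.fun_mul hZ.deriv) ?_
  by_cases hb : ∃ b ∈ B, W 0 = b
  · obtain ⟨b, hb, hWb⟩ := hb
    have h1 := isRemovable_inv_prod hW hZW (S := B.erase b) fun b' hb' hWb' => by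
      rw [hWb] at hWb'
      exact (Finset.mem_erase.1 hb').1 (by exact_mod_cast hWb'.symm)
    have h2 := isRemovable_mul_logDeriv (f := fun t => Z t - b)
      (hZ.fun_sub (MeromorphicAt.const _ _)) ((hne b).mono fun t ht => sub_ne_zero.2 ht).frequently
    refine (((hP.mul hZr.deriv).mul h2).mul h1).congr ?_
    filter_upwards [h, hB] with t ht htB
    have h3 : Z t - b ≠ 0 := sub_ne_zero.2 (htB b hb)
    have h4 : ∏ b' ∈ B.erase b, (Z t - (b' : ℂ)) ≠ 0 :=
      Finset.prod_ne_zero_iff.2 fun b' hb' => sub_ne_zero.2 (htB b' (Finset.mem_of_mem_erase hb'))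
    rw [← Finset.mul_prod_erase _ _ hb] at ht
    rw [← ht, deriv_sub_const]
    field_simp
  · push Not at hb
    have h1 := isRemovable_inv_prod hW hZW hb
    refine ((((hid.mul hP).mul hZr.deriv).mul hZr.deriv).mul h1).congr ?_
    filter_upwards [h, hB] with t ht htB
    have h4 : ∏ b ∈ B, (Z t - (b : ℂ)) ≠ 0 :=
      Finset.prod_ne_zero_iff.2 fun b hb => sub_ne_zero.2 (htB b hb)
    rw [← ht]
    field_simp

/-- Z'/Z² = -(1/Z)', and 1/Z is regular where Z has a pole. -/
lemma isRemovable_of_sub {Z q : ℂ → ℂ} {L : ℂ → ℂ} (hZ : MeromorphicAt Z 0)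
    (hZt : Tendsto Z (𝓝[≠] 0) (Bornology.cobounded ℂ))
    (hr : IsRemovable fun t => (q t - L t) * Z t ^ 2) :
    IsRemovable fun t => (q t - L t) * deriv Z t := by
  have h1 : IsRemovable fun t => (Z t)⁻¹ := by
    refine isRemovable_of_bounded hZ.fun_inv (C := 1) (Eventually.frequently ?_)
    filter_upwards [(tendsto_norm_cobounded_atTop.comp hZt).eventually_ge_atTop 1] with t ht
    rw [norm_inv]
    exact inv_le_one_of_one_le₀ ht
  obtain ⟨g, hg, hg'⟩ := hr.mul h1.deriv
  refine ⟨fun t => -g t, hg.neg, ?_⟩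
  filter_upwards [hg', hZ.eventually_analyticAt,
    (tendsto_norm_cobounded_atTop.comp hZt).eventually_ge_atTop 1] with t ht hat h1t
  have h0 : Z t ≠ 0 := fun h => by
    have : (1 : ℝ) ≤ ‖Z t‖ := h1t
    rw [h, norm_zero] at this; linarith
  rw [← ht, (hat.differentiableAt.hasDerivAt.fun_inv h0).deriv]
  field_simp

lemma HasExpansion.exists_primitive (ha : IsEndpoints n a)
    (hP : HasExpansion (bandEnds n a) (openBands n a).card P α β (-(α / 2)))
    (hαβ : α ≠ 0 ∨ β ≠ 0) {Z q : ℂ → ℂ}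
    (hZ : MeromorphicAt Z 0) (hq : MeromorphicAt q 0)
    (hZt : Tendsto Z (𝓝[≠] 0) (Bornology.cobounded ℂ))
    (h : ∀ᶠ t in 𝓝[≠] 0,
      q t ^ 2 * ∏ b ∈ bandEnds n a, (Z t - (b : ℂ)) = P.aeval (Z t) ^ 2) :
    ∃ F : ℂ → ℂ, MeromorphicAt F 0 ∧ IsRemovable fun t => q t * deriv Z t - deriv F t := by
  obtain ⟨C, hC⟩ := hP.exists_norm_sq_sub_le ha.bandEnds_subset ha.card_bandEnds
  obtain ⟨c, hc, hL⟩ := exists_mul_le_norm_linear hαβ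
  have hconst : ∀ c : ℂ, MeromorphicAt (fun _ : ℂ => c) (0 : ℂ) := fun c => MeromorphicAt.const c 0
  have hLm : MeromorphicAt (fun t => (α : ℂ) * Z t + β) 0 :=
    ((hconst α).fun_mul hZ).fun_add (hconst β)
  set F : ℂ → ℂ := fun t => α / 2 * Z t ^ 2 + β * Z t
  have hF : MeromorphicAt F 0 :=
    ((hconst _).fun_mul (hZ.fun_pow 2)).fun_add ((hconst β).fun_mul hZ)
  have hdF : ∀ᶠ t in 𝓝[≠] 0, deriv F t = (α * Z t + β) * deriv Z t := by
    filter_upwards [hZ.eventually_analyticAt] with t ht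
    have hd := ht.differentiableAt.hasDerivAt
    have := ((hd.fun_pow 2).const_mul ((α : ℂ) / 2)).fun_add (hd.const_mul (β : ℂ))
    rw [this.deriv]
    push_cast
    ring
  have hev : ∀ᶠ t in 𝓝[≠] 0, ‖(q t - (α * Z t + β)) * Z t ^ 2‖ ≤ C / c ∨
      ‖(q t - -(α * Z t + β)) * Z t ^ 2‖ ≤ C / c := by
    filter_upwards [h, hZt.eventually hC, hZt.eventually hL] with t h1 h2 h3
    have := norm_sub_le_or_norm_add_le hc (by positivity) h3 (h2 _ h1)
    simpa only [norm_mul, norm_pow, Complex.norm_real, norm_norm, sub_neg_eq_add] using this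
  -- The sign, that is the point at infinity, might a priori depend on t. One sign occurs for
  -- arbitrarily small t, and meromorphy makes that enough.
  rcases frequently_or_distrib.1 hev.frequently with h' | h'
  · refine ⟨F, hF, (isRemovable_of_sub hZ hZt (isRemovable_of_bounded
      ((hq.fun_sub hLm).fun_mul (hZ.fun_pow 2)) h')).congr ?_⟩
    filter_upwards [hdF] with t ht
    rw [ht]; ring
  · refine ⟨fun t => -F t, hF.fun_neg, (isRemovable_of_sub hZ hZt (isRemovable_of_bounded
      ((hq.fun_sub hLm.fun_neg).fun_mul (hZ.fun_pow 2)) h')).congr ?_⟩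
    filter_upwards [hdF] with t ht
    rw [deriv.fun_neg, ht]; ring

lemma IsBalanced.isSecondKind (ha : IsEndpoints n a) (hP : IsBalanced n a α β P)
    (hαβ : α ≠ 0 ∨ β ≠ 0) :
    IsSecondKind n a fun z y => (liftPoly n a P).eval z / y := by
  intro Z Y hc
  have hZ := hc.meromorphic_z
  have hq := (meromorphicAt_eval hZ (liftPoly n a P)).fun_div hc.meromorphic_y
  refine ⟨hq.fun_mul hZ.deriv, ?_⟩
  suffices h : ∃ F : ℂ → ℂ, MeromorphicAt F 0 ∧
      IsRemovable fun t => (liftPoly n a P).eval (Z t) / Y t * deriv Z t - deriv F t by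
    obtain ⟨F, hF, g, hg, hgF⟩ := h
    have hω : (fun t => (liftPoly n a P).eval (Z t) / Y t * deriv Z t) =ᶠ[𝓝[≠] 0]
        fun t => deriv F t + g t := by
      filter_upwards [hgF] with t ht
      rw [← ht]; ring
    filter_upwards [circleIntegral_eq_zero_of_eq_deriv_add hF hg hω] with r hr
    rw [hr, mul_zero]
  by_cases hconst : ∃ c, ∀ᶠ t in 𝓝[≠] 0, Z t = c
  · obtain ⟨c, hcst⟩ := hconst
    have hd : deriv Z =ᶠ[𝓝[≠] 0] deriv fun _ => c := EventuallyEq.nhdsNE_deriv hcst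
    refine ⟨fun _ => 0, MeromorphicAt.const 0 0, fun _ => 0, analyticAt_const, ?_⟩
    filter_upwards [hd] with t ht
    rw [ht]
    simp
  have hne : ∀ c, ∀ᶠ t in 𝓝[≠] 0, Z t ≠ c := fun c =>
    eventually_ne_of_not_eventually_eq hZ fun h => hconst ⟨c, h⟩
  have hsq : ∀ᶠ t in 𝓝[≠] 0, ((liftPoly n a P).eval (Z t) / Y t) ^ 2 *
      ∏ b ∈ bandEnds n a, (Z t - (b : ℂ)) = P.aeval (Z t) ^ 2 := by
    filter_upwards [hc.curve, (Filter.eventually_all_finset (Finset.range (2 * n + 2))).2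
      fun j _ => hne (a j)] with t h1 h2 using ha.sq_mul_prod P h1 h2
  by_cases hZr : IsRemovable Z
  · refine ⟨fun _ => 0, MeromorphicAt.const 0 0, ?_⟩
    simpa using isRemovable_of_finite hZ hq hZr hne hsq
  · rw [isRemovable_iff hZ, not_le] at hZr
    exact hP.hasExpansion.exists_primitive ha hαβ hZ hq
      (tendsto_cobounded_of_meromorphicOrderAt_neg hZr) hsq

end secondKind

/-! ### Uniqueness of the polynomials -/

section collapsed

variable {n : ℕ} {a : ℕ → ℝ}

lemma IsEndpoints.ne_of_ne (ha : IsEndpoints n a) {j k : ℕ} (hk : k ≤ n)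
    (hj : j ≤ 2 * n + 1) (hab : a (2 * k + 1) = a (2 * k)) (h1 : j ≠ 2 * k) (h2 : j ≠ 2 * k + 1) :
    a j ≠ a (2 * k) := by
  rcases lt_or_gt_of_ne h1 with h | h
  · obtain ⟨l, rfl⟩ : ∃ l, k = l + 1 := ⟨k - 1, by omega⟩
    have h3 := ha.mono (i := j) (j := 2 * l + 1) (by omega) (by omega)
    have h4 := ha.gap l (by omega)
    rw [show 2 * (l + 1) = 2 * l + 2 by ring]
    linarith
  · have h3 := ha.mono (i := 2 * k + 2) (j := j) (by omega) (by omega)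
    have h4 := ha.gap k (by omega)
    linarith

lemma analyticAt_csqrt {z : ℂ} (hz : z ∈ Complex.slitPlane) : AnalyticAt ℂ csqrt z :=
  analyticAt_id.cpow analyticAt_const hz

/-- A differential of the second kind has no residues over a collapsed band. -/
lemma IsSecondKind.eval_eq_zero (ha : IsEndpoints n a) {P : ℂ[X]}
    (h : IsSecondKind n a fun z y => P.eval z / y) {k : ℕ} (hk : k ≤ n)
    (hab : a (2 * k + 1) = a (2 * k)) : P.eval (a (2 * k) : ℂ) = 0 := by
  set b : ℂ := ((a (2 * k) : ℝ) : ℂ)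
  set S := ((Finset.range (2 * n + 2)).erase (2 * k)).erase (2 * k + 1)
  set D : ℂ → ℂ := fun t => ∏ j ∈ S, (b + t - a j) with hD
  have hD0 : D 0 ≠ 0 := by
    refine Finset.prod_ne_zero_iff.2 fun j hj => ?_
    obtain ⟨h1, hj⟩ := Finset.mem_erase.1 hj
    obtain ⟨h2, hj⟩ := Finset.mem_erase.1 hj
    rw [Finset.mem_range] at hj
    rw [add_zero]
    refine sub_ne_zero.2 fun h0 => ha.ne_of_ne hk (by omega) hab h2 h1 ?_
    exact Complex.ofReal_injective h0.symm
  have hDa : AnalyticAt ℂ D 0 := Finset.analyticAt_fun_prod S fun j _ =>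
    (analyticAt_const.add analyticAt_id).sub analyticAt_const
  -- Dividing by D(0) keeps the argument of the second root near 1, away from its cut. Over a
  -- collapsed band the curve has two smooth sheets y = ±t G(t), on which P dz/y has residue
  -- ±P(b)/G(0).
  set G : ℂ → ℂ := fun t => csqrt (D 0) * csqrt (D t / D 0) with hG
  have hGa : AnalyticAt ℂ G 0 := by
    refine analyticAt_const.mul (AnalyticAt.comp (g := csqrt) (analyticAt_csqrt ?_)
      (hDa.div_const))
    rw [div_self hD0]
    exact Complex.one_mem_slitPlane
  have hG2 : ∀ t, G t ^ 2 = D t := fun t => by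
    rw [hG, mul_pow, csqrt_sq, csqrt_sq, mul_div_cancel₀ _ hD0]
  have hG0 : G 0 ≠ 0 := fun h0 => hD0 (by rw [← hG2, h0, zero_pow two_ne_zero])
  have hchart : IsLocalChart n a (fun t => b + t) fun t => t * G t := by
    refine ⟨(analyticAt_const.add analyticAt_id).meromorphicAt,
      (analyticAt_id.mul hGa).meromorphicAt, Eventually.of_forall fun t => ?_,
      univ, univ_mem, fun s _ t _ hst => ?_⟩
    · have h1 : 2 * k ∈ Finset.range (2 * n + 2) := Finset.mem_range.2 (by omega)
      have h2 : 2 * k + 1 ∈ (Finset.range (2 * n + 2)).erase (2 * k) :=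
        Finset.mem_erase.2 ⟨by omega, Finset.mem_range.2 (by omega)⟩
      rw [← Finset.mul_prod_erase _ _ h1, ← Finset.mul_prod_erase _ _ h2, hab, mul_pow, hG2]
      change t ^ 2 * D t = (b + t - b) * ((b + t - b) * D t)
      ring
    · simpa using congrArg Prod.fst hst
  have hΦ : AnalyticAt ℂ (fun t => P.eval (b + t) / G t) 0 :=
    ((P.differentiable.analyticAt _).comp (f := fun t => b + t)
      (analyticAt_const.add analyticAt_id)).fun_div hGa hG0
  obtain ⟨δ, hδ, hΦd⟩ := Metric.eventually_nhds_iff.1 hΦ.eventually_analyticAt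
  obtain ⟨r, hr, hr0⟩ := ((h _ _ hchart).2.and (Ioo_mem_nhdsGT hδ)).exists
  have hd : DifferentiableOn ℂ (fun t => P.eval (b + t) / G t) (Metric.closedBall 0 r) :=
    fun t ht => (hΦd ((Metric.mem_closedBall.1 ht).trans_lt
      hr0.2)).differentiableAt.differentiableWithinAt
  have key := hd.circleIntegral_sub_inv_smul (Metric.mem_ball_self hr0.1)
  have e : (fun t => (t - 0)⁻¹ • (P.eval (b + t) / G t)) =
      fun t => P.eval (b + t) / (t * G t) * deriv (fun t => b + t) t := by
    funext t
    rw [sub_zero, smul_eq_mul, deriv_const_add, deriv_id'', mul_one, inv_mul_eq_div, div_div,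
      mul_comm]
  rw [e] at key
  rw [key, add_zero, smul_eq_mul, inv_mul_cancel_left₀ Complex.two_pi_I_ne_zero,
    div_eq_zero_iff] at hr
  exact hr.resolve_right hG0

lemma IsSecondKind.exists_eq_mul (ha : IsEndpoints n a) {P : ℂ[X]}
    (h : IsSecondKind n a fun z y => P.eval z / y) :
    ∃ S, P = (collapsePoly n a).map (algebraMap ℝ ℂ) * S := by
  change (collapsePoly n a).map (algebraMap ℝ ℂ) ∣ P
  rw [collapsePoly, Polynomial.map_prod]
  refine Finset.prod_dvd_of_coprime (fun k hk l hl hkl => ?_) fun k hk => ?_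
  · rw [Finset.mem_coe, Finset.mem_sdiff, Finset.mem_range] at hk hl
    rw [Function.onFun]
    simp only [Polynomial.map_sub, Polynomial.map_X, Polynomial.map_C]
    refine Polynomial.isCoprime_X_sub_C_of_isUnit_sub (IsUnit.mk0 _ (sub_ne_zero.2 fun h0 => ?_))
    exact ha.ne_of_ne (j := 2 * k) (k := l) (by omega) (by omega)
      (ha.eq_of_notMem_openBands (by omega) hl.2) (by omega) (by omega)
      (Complex.ofReal_injective h0)
  · rw [Finset.mem_sdiff, Finset.mem_range] at hk
    simp only [Polynomial.map_sub, Polynomial.map_X, Polynomial.map_C]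
    rw [Polynomial.dvd_iff_isRoot]
    exact h.eval_eq_zero ha (by omega) (ha.eq_of_notMem_openBands (by omega) hk.2)

lemma exists_eq_add_I_mul (S : ℂ[X]) : ∃ S₁ S₂ : ℝ[X],
    S = S₁.map (algebraMap ℝ ℂ) + C Complex.I * S₂.map (algebraMap ℝ ℂ) ∧
    S₁.natDegree ≤ S.natDegree ∧ S₂.natDegree ≤ S.natDegree := by
  refine ⟨∑ k ∈ Finset.range (S.natDegree + 1), C (S.coeff k).re * X ^ k,
    ∑ k ∈ Finset.range (S.natDegree + 1), C (S.coeff k).im * X ^ k, ?_, ?_, ?_⟩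
  · conv_lhs => rw [S.as_sum_range_C_mul_X_pow]
    simp only [Polynomial.map_sum, Polynomial.map_mul, Polynomial.map_C, Polynomial.map_pow,
      Polynomial.map_X, Finset.mul_sum]
    rw [← Finset.sum_add_distrib]
    refine Finset.sum_congr rfl fun k _ => ?_
    rw [← mul_assoc, ← add_mul, ← C_mul, ← C_add]
    congr 2
    rw [mul_comm]
    exact (Complex.re_add_im _).symm
  all_goals
    exact Polynomial.natDegree_sum_le_of_forall_le _ _ fun k hk =>
      (Polynomial.natDegree_C_mul_X_pow_le _ _).trans (by
        have := Finset.mem_range.1 hk; omega)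

end collapsed

/-! ### The finite Hilbert transform -/

section hilbert

variable {Γ : Set ℝ} {f g : ℝ → ℂ} {x : ℝ} {L M : ℂ}

lemma integrableOn_div_sub (hf : IntegrableOn f Γ) (x : ℝ) {ε : ℝ} (hε : 0 < ε) :
    IntegrableOn (fun w => f w / ((w : ℂ) - x)) (Γ ∩ {w : ℝ | ε < |w - x|}) := by
  have hS : MeasurableSet {w : ℝ | ε < |w - x|} := measurableSet_lt measurable_const (by fun_prop)
  have h1 := hf.mono_set (inter_subset_left (t := {w : ℝ | ε < |w - x|}))
  refine Integrable.mono' (h1.norm.const_mul ε⁻¹)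
    (h1.aestronglyMeasurable.mul ?_) ?_
  · exact (Measurable.inv (by fun_prop)).aestronglyMeasurable
  · have : ∀ᵐ w ∂volume.restrict (Γ ∩ {w : ℝ | ε < |w - x|}), w ∈ {w : ℝ | ε < |w - x|} := by
      rw [inter_comm, ← Measure.restrict_restrict hS]
      exact ae_restrict_mem hS
    filter_upwards [this] with w hw
    rw [norm_div, ← Complex.ofReal_sub, Complex.norm_real, Real.norm_eq_abs, div_eq_inv_mul]
    gcongr

lemma HasFHT.add (hf : HasFHT Γ f x L) (hg : HasFHT Γ g x M) :
    HasFHT Γ (fun w => f w + g w) x (L + M) := by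
  refine ⟨hf.1.add hg.1, (hf.2.add hg.2).congr' ?_⟩
  filter_upwards [self_mem_nhdsWithin] with ε hε
  rw [← mul_add, ← integral_add (integrableOn_div_sub hf.1 x hε) (integrableOn_div_sub hg.1 x hε)]
  simp only [add_div]

lemma HasFHT.const_mul (hf : HasFHT Γ f x L) (c : ℂ) :
    HasFHT Γ (fun w => c * f w) x (c * L) := by
  refine ⟨hf.1.const_mul c, (hf.2.const_mul c).congr fun ε => ?_⟩
  simp only [mul_div_assoc]
  rw [integral_const_mul]
  ring

lemma HasFHT.unique (hf : HasFHT Γ f x L) (hg : HasFHT Γ f x M) : L = M :=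
  tendsto_nhds_unique hf.2 hg.2

end hilbert

/-! ### Determination of the numerators by n band conditions -/

section unique

variable {n : ℕ} {a : ℕ → ℝ} {P : ℝ[X]} {α β : ℝ}

lemma density_add (P Q : ℂ[X]) (x : ℝ) :
    density n a (P + Q) x = density n a P x + density n a Q x := by
  rw [density, density, density, Polynomial.eval_add, add_div]

lemma density_C_mul (c : ℂ) (P : ℂ[X]) (x : ℝ) :
    density n a (C c * P) x = c * density n a P x := by
  rw [density, density, Polynomial.eval_mul, Polynomial.eval_C, mul_div_assoc]

lemma infinite_interior_support (hn : 1 ≤ n) (ha : IsEndpoints n a) :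
    (interior (support n a)).Infinite := by
  have h1 := ha.gap 0 (by omega)
  refine (Ioo_infinite h1).mono ?_
  refine interior_maximal (fun x hx => ?_) isOpen_Ioo
  exact mem_support.2 ⟨0, by omega, Ioo_subset_Icc_self hx⟩

lemma eq_zero_of_quadratic {s : Set ℝ} (hs : s.Infinite) {α β γ : ℝ}
    (h : ∀ x ∈ s, α * x ^ 2 + β * x + γ = 0) : α = 0 ∧ β = 0 ∧ γ = 0 := by
  have h0 : C α * X ^ 2 + C β * X + C γ = (0 : ℝ[X]) :=
    Polynomial.eq_zero_of_infinite_isRoot _ (hs.mono fun x hx => by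
      simpa [Polynomial.IsRoot] using h x hx)
  refine ⟨?_, ?_, ?_⟩
  · simpa [Polynomial.coeff_X, Polynomial.coeff_C] using congrArg (fun p => p.coeff 2) h0
  · simpa [Polynomial.coeff_X, Polynomial.coeff_C] using congrArg (fun p => p.coeff 1) h0
  · simpa using congrArg (fun p => p.coeff 0) h0

/-- With α = β = γ = 0 the degree drops below m and the sum rule `IsEndpoints.sum_bandIntegral`
reads that all band integrals sum to zero, so the band with index n follows from the others. -/
lemma IsEndpoints.eq_zero_of_quadratic_eq_zero (ha : IsEndpoints n a) {α β γ : ℝ}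
    (hP : P.natDegree ≤ (openBands n a).card + 1)
    (hα : α = P.coeff ((openBands n a).card + 1))
    (hβ : α = 0 → β = P.coeff (openBands n a).card)
    (he : HasExpansion (bandEnds n a) (openBands n a).card P α β γ)
    (h0 : α = 0 ∧ β = 0 ∧ γ = 0)
    (hb : ∀ k ∈ openBands n a, k < n → bandIntegral n a P k = 0) : P = 0 := by
  obtain ⟨rfl, rfl, rfl⟩ := h0
  refine ha.eq_zero_of_bandIntegral_eq_zero (degree_lt_of_coeff_eq_zero
    (degree_lt_of_coeff_eq_zero ?_ hα.symm) (hβ rfl).symm) fun k hk => ?_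
  · rw [Polynomial.degree_lt_iff_coeff_zero]
    exact Polynomial.natDegree_le_iff_coeff_eq_zero.1 hP
  · rcases lt_or_ge k n with hkn | hkn
    · exact hb k hk hkn
    · have hs := ha.sum_bandIntegral he
      have hle := (mem_openBands.1 hk).1
      rw [Finset.sum_eq_single_of_mem k hk fun l hl hlk => hb l hl (by
        have := (mem_openBands.1 hl).1; omega)] at hs
      simpa using hs

lemma natDegree_collapsePoly :
    (collapsePoly n a).natDegree = n + 1 - (openBands n a).card := by
  rw [collapsePoly, Polynomial.natDegree_prod_of_monic _ _ fun _ _ => monic_X_sub_C _]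
  simp [Finset.card_sdiff_of_subset openBands_subset]

lemma monic_collapsePoly : (collapsePoly n a).Monic :=
  Polynomial.monic_prod_of_monic _ _ fun _ _ => monic_X_sub_C _

lemma card_openBands_le : (openBands n a).card ≤ n + 1 := by
  simpa using Finset.card_le_card (openBands_subset (n := n) (a := a))

theorem IsBalanced.eq_liftPoly (hn : 1 ≤ n) (ha : IsEndpoints n a) (hP : IsBalanced n a α β P)
    {g : ℝ → ℝ} (hg : ∀ x, g x = -(Real.pi * (α * x ^ 2 + β * x + -(α / 2))))
    {d : ℕ} (hd : d ≤ n + 2) {P' : ℂ[X]} (hP' : IsCondensatePolynomial n a d g n P') :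
    P' = liftPoly n a P := by
  obtain ⟨S, hS⟩ := hP'.secondKind.exists_eq_mul ha
  obtain ⟨S₁, S₂, hS₁₂, hd₁, hd₂⟩ := exists_eq_add_I_mul S
  have hmon := (monic_collapsePoly (n := n) (a := a)).map (algebraMap ℝ ℂ)
  have hS0 : S ≠ 0 := by
    rintro rfl
    have := hP'.degree
    rw [hS, mul_zero, Polynomial.degree_zero] at this
    exact absurd this (by simp)
  -- `collapsePoly` has degree n + 1 - m, so d ≤ n + 2 leaves at most m + 1.
  have hdS : S.natDegree ≤ (openBands n a).card + 1 := by
    have h1 := Polynomial.natDegree_eq_of_degree_eq_some hP'.degree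
    rw [hS, hmon.natDegree_mul' hS0, Polynomial.natDegree_map, natDegree_collapsePoly] at h1
    have := card_openBands_le (n := n) (a := a)
    omega
  set T := S₁ - P with hT
  have hTd : T.natDegree ≤ (openBands n a).card + 1 :=
    (Polynomial.natDegree_sub_le _ _).trans (max_le (hd₁.trans hdS) hP.natDegree_le)
  have hsplit : P' = liftPoly n a P + (liftPoly n a T + C Complex.I * liftPoly n a S₂) := by
    rw [hS, hS₁₂, hT]
    simp only [liftPoly, Polynomial.map_mul, Polynomial.map_sub]
    ring
  have hdens : ∀ x, density n a P' x = density n a (liftPoly n a P) x +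
      (density n a (liftPoly n a T) x + Complex.I * density n a (liftPoly n a S₂) x) := by
    intro x
    rw [hsplit, density_add, density_add, density_C_mul]
  obtain ⟨β₁, γ₁, he₁, hc₁⟩ := exists_hasExpansion ha.bandEnds_subset hTd
  obtain ⟨β₂, γ₂, he₂, hc₂⟩ := exists_hasExpansion ha.bandEnds_subset (hd₂.trans hdS)
  set α₁ := T.coeff ((openBands n a).card + 1) with hα₁
  set α₂ := S₂.coeff ((openBands n a).card + 1) with hα₂
  -- The numerator may be complex. The Hilbert transform returns real quadratics for T and for S₂,
  -- so the vanishing complex error separates into two real equations.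
  have hquad : ∀ x ∈ interior (support n a),
      α₁ * x ^ 2 + β₁ * x + γ₁ = 0 ∧ α₂ * x ^ 2 + β₂ * x + γ₂ = 0 := by
    intro x hx
    obtain ⟨L, hL, hLg⟩ := hP'.fht x hx
    have h1 := (ha.hasFHT hP.hasExpansion hx).add
      ((ha.hasFHT he₁ hx).add ((ha.hasFHT he₂ hx).const_mul Complex.I))
    have h2 : (fun w => density n a P' w * (‖R₀ w‖ : ℂ)) = fun w =>
        density n a (liftPoly n a P) w * (‖R₀ w‖ : ℂ) +
        (density n a (liftPoly n a T) w * (‖R₀ w‖ : ℂ) +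
          Complex.I * (density n a (liftPoly n a S₂) w * (‖R₀ w‖ : ℂ))) := by
      funext w; rw [hdens]; ring
    rw [h2] at hL
    have h3 := hL.unique h1
    rw [h3, hg, ← mul_neg, Complex.ofReal_mul] at hLg
    have h4 := mul_left_cancel₀ (Complex.ofReal_ne_zero.2 Real.pi_pos.ne') hLg
    rw [add_eq_left] at h4
    have hre := congrArg Complex.re h4
    have him := congrArg Complex.im h4
    simp only [Complex.add_re, Complex.add_im, Complex.re_mul_ofReal, Complex.im_mul_ofReal,
      Complex.I_re, Complex.I_im, Complex.ofReal_re, Complex.ofReal_im, Complex.zero_re,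
      Complex.zero_im] at hre him
    constructor <;> linarith
  have hb : ∀ k ∈ openBands n a, k < n →
      bandIntegral n a T k = 0 ∧ bandIntegral n a S₂ k = 0 := by
    intro k hk hkn
    have h1 := (hP'.bands k hkn).2
    have i1 := ha.intervalIntegrable_density P hkn.le
    have i2 := ha.intervalIntegrable_density T hkn.le
    have i3 := ha.intervalIntegrable_density S₂ hkn.le
    simp only [hdens] at h1
    rw [intervalIntegral.integral_add i1 (i2.add (i3.const_mul _)),
      intervalIntegral.integral_add i2 (i3.const_mul _), intervalIntegral.integral_const_mul,
      ha.intervalIntegral_density _ hk, ha.intervalIntegral_density _ hk,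
      ha.intervalIntegral_density _ hk, hP.bandIntegral_eq k hk] at h1
    have hre := congrArg Complex.re h1
    have him := congrArg Complex.im h1
    simp at hre him
    exact ⟨him, hre⟩
  have hinf := infinite_interior_support hn ha
  have hT0 : T = 0 := ha.eq_zero_of_quadratic_eq_zero hTd hα₁ hc₁ he₁
    (eq_zero_of_quadratic hinf fun x hx => (hquad x hx).1) fun k hk hkn => (hb k hk hkn).1
  have hS₂0 : S₂ = 0 := ha.eq_zero_of_quadratic_eq_zero (hd₂.trans hdS) hα₂ hc₂ he₂
    (eq_zero_of_quadratic hinf fun x hx => (hquad x hx).2) fun k hk hkn => (hb k hk hkn).2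
  rw [hsplit, hT0, hS₂0]
  simp [liftPoly]

end unique

/-! ### Positivity and limits of the densities -/

section positivity

variable {n : ℕ} {a : ℕ → ℝ} {P : ℝ[X]} {α β : ℝ}

/-- Parity as a sign: the product over all endpoints of the function equal to -1 at x and 1
elsewhere is (-1) to the multiplicity of x. Collapsed bands contribute squares, and the ends of open
bands are distinct. -/
lemma IsEndpoints.mem_branchPoints (ha : IsEndpoints n a) {x : ℝ} :
    x ∈ branchPoints n a ↔ x ∈ bandEnds n a := by
  have h := ha.prod_range fun b => if b = x then (-1 : ℤ) else 1
  have h1 : ∏ k ∈ Finset.range (n + 1) \ openBands n a,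
      ((if a (2 * k) = x then (-1 : ℤ) else 1) * (if a (2 * k) = x then (-1 : ℤ) else 1)) = 1 :=
    Finset.prod_eq_one fun k _ => by split_ifs <;> norm_num
  rw [h1, one_mul, Finset.prod_ite, Finset.prod_const_one, mul_one, Finset.prod_const,
    Finset.prod_ite_eq'] at h
  rw [branchPoints, mem_ofPred_eq, ← neg_one_pow_eq_neg_one_iff_odd (R := ℤ) (by norm_num), h]
  split_ifs with hx <;> simp [hx]

/-- For α = 0 the polynomial has degree at most m, with coefficient β at X^m and a root in each of
the m disjoint open bands. Subtracting the product leaves degree below m with m roots. -/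
lemma IsBalanced.exists_eq_prod (ha : IsEndpoints n a) (hP : IsBalanced n a 0 β P) :
    ∃ r : ℕ → ℝ, (∀ k ∈ openBands n a, r k ∈ Ioo (a (2 * k)) (a (2 * k + 1))) ∧
      P = C β * ∏ k ∈ openBands n a, (X - C (r k)) := by
  choose! r hr hr0 using fun k hk =>
    ha.exists_root_of_bandIntegral_eq_zero hk (hP.bandIntegral_eq k hk)
  refine ⟨r, hr, sub_eq_zero.1 ?_⟩
  set Q : ℝ[X] := ∏ k ∈ openBands n a, (X - C (r k))
  have hQm : Q.Monic := Polynomial.monic_prod_of_monic _ _ fun _ _ => monic_X_sub_C _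
  have hQd : Q.natDegree = (openBands n a).card := by
    rw [Polynomial.natDegree_prod_of_monic _ _ fun _ _ => monic_X_sub_C _]
    simp
  refine Polynomial.eq_zero_of_degree_lt_of_eval_index_eq_zero _ (ha.injOn_of_mem_band hr)
    ((Polynomial.degree_lt_iff_coeff_zero _ _).2 fun j hj => ?_) fun k hk => ?_
  · rw [Polynomial.coeff_sub, Polynomial.coeff_C_mul]
    rcases hj.eq_or_lt with rfl | hj
    · rw [hP.coeff_eq' rfl, ← hQd, hQm.coeff_natDegree, mul_one, sub_self]
    · rw [Polynomial.coeff_eq_zero_of_natDegree_lt (hQd.trans_lt hj), mul_zero, sub_zero]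
      rcases (Nat.succ_le_of_lt hj).eq_or_lt with rfl | hj
      · exact hP.coeff_eq
      · exact Polynomial.coeff_eq_zero_of_natDegree_lt (hP.natDegree_le.trans_lt hj)
  · rw [Polynomial.eval_sub, hr0 k hk, Polynomial.eval_mul, Polynomial.eval_prod,
      Finset.prod_eq_zero hk (by simp), mul_zero, sub_zero]

lemma IsBalanced.eval_ne_zero (ha : IsEndpoints n a) (hP : IsBalanced n a 0 β P) (hβ : β ≠ 0)
    {x : ℝ} (hx : x ∈ support n a) : P.eval x ≠ 0 := by
  obtain ⟨r, hr, h⟩ := hP.exists_eq_prod ha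
  rw [h, Polynomial.eval_mul, Polynomial.eval_C, Polynomial.eval_prod]
  refine mul_ne_zero hβ (Finset.prod_ne_zero_iff.2 fun k hk h0 => ?_)
  simp only [Polynomial.eval_sub, Polynomial.eval_X, Polynomial.eval_C] at h0
  rw [sub_eq_zero.1 h0] at hx
  exact ha.notMem_support_of_mem_band (mem_openBands.1 hk).1 (hr k hk) hx

/-- The root r_k lies inside its band, so x - r_k and the pair root of that band are both negative
to the left of the band and both positive to the right. -/
lemma IsBalanced.rootQuot_re_pos (ha : IsEndpoints n a) (hP : IsBalanced n a 0 β P) (hβ : 0 < β)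
    {x : ℝ} (hx : x ∈ support n a) (hxB : x ∉ bandEnds n a) :
    0 < (rootQuot (bandEnds n a) P x).re := by
  obtain ⟨r, hr, h⟩ := hP.exists_eq_prod ha
  rw [rootQuot, ha.rootProd_eq_of_mem_support hx, ← Complex.ofReal_div, Complex.ofReal_re, h,
    Polynomial.eval_mul, Polynomial.eval_C, Polynomial.eval_prod, mul_div_assoc,
    ← Finset.prod_div_distrib]
  refine mul_pos hβ (Finset.prod_pos fun k hk => ?_)
  simp only [Polynomial.eval_sub, Polynomial.eval_X, Polynomial.eval_C]
  obtain ⟨hkn, hlt⟩ := mem_openBands.1 hk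
  have h1 := (hr k hk).1
  have h2 := (hr k hk).2
  rcases ha.le_or_le_of_mem_support hx hkn with hle | hle
  · have := lt_of_le_of_ne hle fun h => hxB (mem_bandEnds.2 ⟨k, hk, Or.inl h⟩)
    exact div_pos_of_neg_of_neg (by linarith) (pairRoot_neg hlt.le this)
  · have := lt_of_le_of_ne hle fun h => hxB (mem_bandEnds.2 ⟨k, hk, Or.inr h.symm⟩)
    exact div_pos (by linarith) (pairRoot_pos hlt.le this)

lemma IsEndpoints.density_im (ha : IsEndpoints n a) (P : ℝ[X]) {x : ℝ}
    (hx : x ∈ support n a \ endpoints n a) : (density n a (liftPoly n a P) x).im = 0 := by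
  rw [ha.density_eq P hx.2, ha.rootQuot_im_of_mem_support P hx.1]

lemma IsBalanced.density_re_pos (ha : IsEndpoints n a) (hP : IsBalanced n a 0 β P) (hβ : 0 < β)
    {x : ℝ} (hx : x ∈ support n a \ endpoints n a) :
    0 < (density n a (liftPoly n a P) x).re := by
  rw [ha.density_eq P hx.2]
  exact hP.rootQuot_re_pos ha hβ hx.1 fun h => hx.2 (bandEnds_subset_endpoints h)

lemma IsEndpoints.tendsto_density (ha : IsEndpoints n a) (P : ℝ[X]) {z : ℝ}
    (hz : z ∈ support n a) (hzB : z ∉ bandEnds n a) :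
    Tendsto (density n a (liftPoly n a P)) (𝓝[support n a \ endpoints n a] z)
      (𝓝 ((rootQuot (bandEnds n a) P z).re : ℂ)) := by
  rw [← ha.rootQuot_of_mem_support P hz]
  refine ((continuousAt_rootQuot P hzB).tendsto.mono_left nhdsWithin_le_nhds).congr' ?_
  filter_upwards [self_mem_nhdsWithin] with x hx using (ha.density_eq P hx.2).symm

/-- All roots of P lie in open bands, so the numerator stays away from zero at a branch point while
the denominator tends to zero. Positivity lets the modulus be computed instead of the signed value.
-/
lemma IsBalanced.tendsto_density_atTop (ha : IsEndpoints n a) (hP : IsBalanced n a 0 β P)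
    (hβ : 0 < β) {z : ℝ} (hz : z ∈ support n a) (hzB : z ∈ bandEnds n a) :
    Tendsto (fun x => (density n a (liftPoly n a P) x).re)
      (𝓝[support n a \ endpoints n a] z) atTop := by
  have h1 : Tendsto (fun x => |P.eval x|) (𝓝[support n a \ endpoints n a] z)
      (𝓝 |P.eval z|) :=
    (P.continuous.abs.tendsto z).mono_left nhdsWithin_le_nhds
  have h2 : Tendsto (fun x => ‖rootProd (bandEnds n a) x‖)
      (𝓝[support n a \ endpoints n a] z) (𝓝[>] 0) := by
    refine tendsto_nhdsWithin_iff.2 ⟨?_, ?_⟩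
    · have hc : Continuous fun x : ℝ => ∏ b ∈ bandEnds n a, √|x - b| := by fun_prop
      have h0 : ∏ b ∈ bandEnds n a, √|z - b| = 0 := Finset.prod_eq_zero hzB (by simp)
      have := hc.tendsto z
      rw [h0] at this
      exact (this.mono_left nhdsWithin_le_nhds).congr fun x => (norm_rootProd _ x).symm
    · filter_upwards [self_mem_nhdsWithin] with x hx
      exact norm_pos_iff.2 (rootProd_ne_zero fun h => hx.2 (bandEnds_subset_endpoints h))
  refine (h1.pos_mul_atTop (abs_pos.2 (hP.eval_ne_zero ha hβ.ne' hz))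
    (tendsto_inv_nhdsGT_zero.comp h2)).congr' ?_
  filter_upwards [self_mem_nhdsWithin] with x hx
  have h3 := hP.density_re_pos ha hβ hx
  have h4 := ha.rootQuot_of_mem_support P hx.1
  rw [ha.density_eq P hx.2] at h3 ⊢
  have h5 : ‖rootQuot (bandEnds n a) P x‖ = (rootQuot (bandEnds n a) P x).re := by
    rw [h4, Complex.norm_real, Complex.ofReal_re, Real.norm_of_nonneg h3.le]
  rw [← h5, rootQuot, norm_div, Complex.norm_real, Real.norm_eq_abs, div_eq_mul_inv]
  rfl

end positivity

/-! ### Degrees and assembly of the condensate polynomials -/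

section condensate

variable {n : ℕ} {a : ℕ → ℝ} {P : ℝ[X]} {α β : ℝ}

lemma degree_liftPoly {d : ℕ} (hd : P.natDegree = d) (hP : P ≠ 0) :
    (liftPoly n a P).degree = (n + 1 - (openBands n a).card + d : ℕ) := by
  have hm := monic_collapsePoly (n := n) (a := a)
  have h0 : collapsePoly n a * P ≠ 0 := mul_ne_zero hm.ne_zero hP
  rw [liftPoly, Polynomial.degree_map, Polynomial.degree_eq_natDegree h0, hm.natDegree_mul' hP,
    natDegree_collapsePoly, hd]

lemma IsBalanced.degree_of_eq_zero (hP : IsBalanced n a 0 β P) (hβ : β ≠ 0) :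
    (liftPoly n a P).degree = (n + 1 : ℕ) := by
  have hc : P.coeff (openBands n a).card ≠ 0 := by rwa [hP.coeff_eq' rfl]
  have hd : P.natDegree = (openBands n a).card := by
    refine Polynomial.natDegree_eq_of_le_of_coeff_ne_zero
      (Polynomial.natDegree_le_iff_coeff_eq_zero.2 fun j hj => ?_) hc
    rcases (Nat.succ_le_of_lt hj).eq_or_lt with rfl | hj
    · exact hP.coeff_eq
    · exact Polynomial.coeff_eq_zero_of_natDegree_lt (hP.natDegree_le.trans_lt hj)
  rw [degree_liftPoly hd fun h => hc (by rw [h, Polynomial.coeff_zero]),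
    Nat.sub_add_cancel card_openBands_le]

lemma IsBalanced.degree_of_ne_zero (hP : IsBalanced n a α β P) (hα : α ≠ 0) :
    (liftPoly n a P).degree = (n + 2 : ℕ) := by
  have hc : P.coeff ((openBands n a).card + 1) ≠ 0 := by rwa [hP.coeff_eq]
  rw [degree_liftPoly (Polynomial.natDegree_eq_of_le_of_coeff_ne_zero hP.natDegree_le hc)
    fun h => hc (by rw [h, Polynomial.coeff_zero]), ← add_assoc,
    Nat.sub_add_cancel card_openBands_le]

lemma IsBalanced.isCondensatePolynomial (ha : IsEndpoints n a) (hP : IsBalanced n a α β P)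
    (hαβ : α ≠ 0 ∨ β ≠ 0) {g : ℝ → ℝ}
    (hg : ∀ x, g x = -(Real.pi * (α * x ^ 2 + β * x + -(α / 2))))
    {d : ℕ} (hd : (liftPoly n a P).degree = d) :
    IsCondensatePolynomial n a d g (n + 1) (liftPoly n a P) where
  degree := hd
  fht x hx := ⟨_, ha.hasFHT hP.hasExpansion hx, by rw [hg]; push_cast; ring⟩
  bands := (ha.bandVanishing_iff P le_rfl).2 fun k hk _ => hP.bandIntegral_eq k hk
  secondKind := hP.isSecondKind ha hαβ

end condensate

end DefNLS

end

theorem mainTheorem4 (n : ℕ) (hn : 1 ≤ n) (a : ℕ → ℝ) (ha : DefNLS.IsEndpoints n a) :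
    ∃ P Q : ℂ[X],
      -- `u = P / (R R₀)` is the density of states of the condensate
      DefNLS.IsDOS (DefNLS.support n a) 0 (fun z => (DefNLS.density n a P z).re) ∧
      (∀ u : ℝ → ℝ, DefNLS.IsDOS (DefNLS.support n a) 0 u →
        u =ᵐ[volume.restrict (DefNLS.support n a)] fun z => (DefNLS.density n a P z).re) ∧
      -- `v = Q / (R R₀)` is the density of fluxes of the condensate
      DefNLS.IsDOF (DefNLS.support n a) 0 (fun z => (DefNLS.density n a Q z).re) ∧
      (∀ v : ℝ → ℝ, DefNLS.IsDOF (DefNLS.support n a) 0 v →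
        v =ᵐ[volume.restrict (DefNLS.support n a)] fun z => (DefNLS.density n a Q z).re) ∧
      -- degrees, differentiated relations, all `n + 1` band conditions, second kind
      DefNLS.IsCondensatePolynomial n a (n + 1) (fun z => -z) (n + 1) P ∧
      DefNLS.IsCondensatePolynomial n a (n + 2) (fun z => 2 - 4 * z ^ 2) (n + 1) Q ∧
      -- `P` and `Q` are already fixed by the conditions on the first `n` bands
      (∀ P' : ℂ[X],
        DefNLS.IsCondensatePolynomial n a (n + 1) (fun z => -z) n P' → P' = P) ∧
      (∀ Q' : ℂ[X],
        DefNLS.IsCondensatePolynomial n a (n + 2) (fun z => 2 - 4 * z ^ 2) n Q' → Q' = Q) ∧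
      -- `u` and `v` are real on `Γ`, and `u` is positive there
      (∀ z ∈ DefNLS.support n a \ DefNLS.endpoints n a,
        (DefNLS.density n a P z).im = 0 ∧ (DefNLS.density n a Q z).im = 0 ∧
        0 < (DefNLS.density n a P z).re) ∧
      -- also, by continuity, at `±1` and at collapsed bands; at the branch points `u = +∞`
      (∀ z ∈ DefNLS.support n a \ DefNLS.branchPoints n a, ∃ c d : ℝ, 0 < c ∧
        Tendsto (DefNLS.density n a P) (𝓝[DefNLS.support n a \ DefNLS.endpoints n a] z)
          (𝓝 (c : ℂ)) ∧
        Tendsto (DefNLS.density n a Q) (𝓝[DefNLS.support n a \ DefNLS.endpoints n a] z)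
          (𝓝 (d : ℂ))) ∧
      (∀ z ∈ DefNLS.support n a ∩ DefNLS.branchPoints n a,
        Tendsto (fun x => (DefNLS.density n a P x).re)
          (𝓝[DefNLS.support n a \ DefNLS.endpoints n a] z) atTop) := by
  have hπ := Real.pi_pos.ne'
  have hβ : 0 < 1 / Real.pi := one_div_pos.2 Real.pi_pos
  have hα : 4 / Real.pi ≠ 0 := div_ne_zero four_ne_zero hπ
  -- The parameters solve π(αz/2 + β) = 1 for the density of states and = 2z for the density of
  -- fluxes; the same pairs turn -π(αz² + βz - α/2) into -z and 2 - 4z².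
  obtain ⟨P, hP⟩ := ha.exists_isBalanced_zero (1 / Real.pi)
  obtain ⟨Q, hQ⟩ := ha.exists_isBalanced hα
  have hPn : ∀ z ∈ DefNLS.support n a,
      ‖DefNLS.R₀ z‖ = Real.pi * ((0 / 2 * z + 1 / Real.pi) * ‖DefNLS.R₀ z‖) := fun z _ => by
    field_simp
    ring
  have hQn : ∀ z ∈ DefNLS.support n a,
      2 * z * ‖DefNLS.R₀ z‖ = Real.pi * ((4 / Real.pi / 2 * z + 0) * ‖DefNLS.R₀ z‖) :=
    fun z _ => by
      field_simp
      ring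
  have hPg : ∀ z : ℝ, -z = -(Real.pi * (0 * z ^ 2 + 1 / Real.pi * z + -(0 / 2))) := fun z => by
    field_simp
    ring
  have hQg : ∀ z : ℝ, 2 - 4 * z ^ 2 =
      -(Real.pi * (4 / Real.pi * z ^ 2 + 0 * z + -(4 / Real.pi / 2))) := fun z => by
    field_simp
    ring
  refine ⟨DefNLS.liftPoly n a P, DefNLS.liftPoly n a Q, hP.solvesNDR ha hPn,
    fun u hu => hP.ae_eq ha hPn hu, hQ.solvesNDR ha hQn, fun v hv => hQ.ae_eq ha hQn hv,
    hP.isCondensatePolynomial ha (Or.inr hβ.ne') hPg (hP.degree_of_eq_zero hβ.ne'),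
    hQ.isCondensatePolynomial ha (Or.inl hα) hQg (hQ.degree_of_ne_zero hα),
    fun P' hP' => hP.eq_liftPoly hn ha hPg (by omega) hP',
    fun Q' hQ' => hQ.eq_liftPoly hn ha hQg le_rfl hQ',
    fun z hz => ⟨ha.density_im P hz, ha.density_im Q hz, hP.density_re_pos ha hβ hz⟩,
    fun z hz => ?_, fun z hz => hP.tendsto_density_atTop ha hβ hz.1 (ha.mem_branchPoints.1 hz.2)⟩
  have hzB : z ∉ DefNLS.bandEnds n a := fun h => hz.2 (ha.mem_branchPoints.2 h)
  exact ⟨_, _, hP.rootQuot_re_pos ha hβ hz.1 hzB, ha.tendsto_density P hz.1 hzB,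
    ha.tendsto_density Q hz.1 hzB⟩
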